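/- **Setting.** Let $d>1$ be a constant, $p=d/n$ and $G\sim G_{n,p}$ (for $n\ge d$). Fix a truncation constant $c_{\deg}\ge 10$ and let $G'$ be obtained from $G$ by removing all edges incident to vertices whose degree in $G$ is at least $c_{\deg}d$. For distinct $u,v\in[n]$ let $\chi(u,v)=\sqrt{(1-p)/p}$ if $uv\in E(G')$ and $\chi(u,v)=-\sqrt{p/(1-p)}$ otherwise. The Z-shape matrix $M_Z\in\mathbb R^{n(n-1)\times n(n-1)}$, indexed by ordered pairs of distinct vertices, has $M_Z[(i,j),(k,\ell)]=\chi(i,k)\chi(j,k)\chi(j,\ell)$ if $i,j,k,\ell$ are distinct and $0$ otherwise. A graph is *2-cycle free* if any two vertices are joined by at most two simple paths; the *2-cycle free radius* of a graph is the largest $r$ such that for every vertex $v$ the subgraph induced by the vertices within distance $r$ of $v$ is 2-cycle free. For $\kappa_0>0$ let $\mathcal E=\mathcal E_{\kappa_0}$ be the event that $G$ has 2-cycle free radius at least $\kappa_0\log_d n$. **Walks and labels.** A *shape walk* of length $2q$ is a cyclic sequence of $2q$ blocks, alternately copies of the Z-shape (edges $ik,jk,j\ell$, boundaries $(i,j)$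 and $(k,\ell)$) and of its transpose, each with an injective labelling of its four vertices by $[n]$, such that consecutive blocks have the same labels, as ordered pairs, on their common boundary. In the direction of the walk each block is a Z-shape with entry boundary $(i,j)$ and exit boundary $(k,\ell)$ (in a transposed block exchange the names $i\leftrightarrow\ell$, $j\leftrightarrow k$) and consists of the steps $i\to k$, $j\to k$, $j\to\ell$, in this order. A step is *singleton* if its edge of $[n]$ is used only once in the whole walk. Otherwise it is labelled: $F$ (resp. $S$) if it is the first use of its edge and its destination has not (resp. has) appeared before in the walk; $R$ if it is the last use of its edge; $H$ in all other cases. An exit-boundary vertex of a block makes its *first appearance* there if it is in no earlier block; an entry-boundary vertex makes its *last appearance* there if it is in no later block. **Factor assignment scheme** (constants $c\ge1$, $a\in\mathbb N$). For a block, $\mathsf{edgeval}$ is the product over its three steps of: $\sqrt{n/d}\cdot\frac dn\cdot e^{-d}$ for a singleton, $\sqrt{n/d}$ for $H$, and $1$ for $F,S,R$. $\mathsf{vtxcost}$ is the product of: $\sqrt n$ for each vertex making its first or its last appearance; for each other exit-boundary vertex, $c$ if it is reached by an $R$ step or by two $H$ steps of the block, otherwise $c\sqrt d$ if it is reached by an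 $H$ step, otherwise $8q$; and $(8q)^a$ for each $S$ step. A function $B=B(n)$ is a *valid block-value* for walk lengths $q=q(n)$ if, for all large $n$, $\mathsf{vtxcost}\cdot\mathsf{edgeval}\le B$ for every block of every shape walk of length $2q$, and $$\mathbb E\big[\operatorname{Tr}\big((M_ZM_Z^{\top})^{q}\big)\cdot\mathbf 1_{\mathcal E}\big]\le n(n-1)\cdot\mathsf{auxcost}\cdot B^{2q}$$ for some $\mathsf{auxcost}=\mathsf{auxcost}(n)\ge0$ with $\big(n(n-1)\cdot\mathsf{auxcost}\big)^{1/2q}\le 1+o_n(1)$. **Lemma (norm bound for the Z-shape).** (1) For all $c\ge 1$ and $a\in\mathbb N$ there is a constant $C>0$, depending only on $c_{\deg},c,a$, such that for every $d>1$ and $\kappa_0>0$ there is $\delta>0$ such that for all $q=q(n)$ with $q=\Omega(\log^2 n)$ and $q\le n^{\delta}$ for all large $n$, the function $B=C\cdot n\sqrt{n/d}$ is a valid block-value. (2) There is a constant $C>0$, depending only on $c_{\deg}$ (in particular independent of $d$), such that for every $d>1$, with probability $1-o_n(1)$, $$\|M_Z\|\le C\cdot n\sqrt{\frac nd}.$$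 -/

import Mathlib

open Filter Topology MeasureTheory

noncomputable section

namespace SparseZ

/-! ### The random graph, its pruning, and local 2-cycle freeness -/

/-- The edge probability `d / n` (clamped to `[0, 1]`; it equals `d / n` as soon as `d ≤ n`). -/
def edgeProb (d : ℝ) (n : ℕ) : unitInterval :=
  Set.projIcc (0 : ℝ) 1 zero_le_one (d / n)

/-- The law `G(n, d/n)`. -/
def sparseGraph (d : ℝ) (n : ℕ) : Measure (SimpleGraph (Fin n)) :=
  SimpleGraph.binomialRandom (Fin n) (edgeProb d n)

/-- The pruned graph: every edge incident to a vertex whose degree in `G` is at least `τ`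
is removed. -/
def prune {n : ℕ} (τ : ℝ) (G : SimpleGraph (Fin n)) : SimpleGraph (Fin n) where
  Adj u v := G.Adj u v ∧ ((G.neighborSet u).ncard : ℝ) < τ ∧ ((G.neighborSet v).ncard : ℝ) < τ
  symm := ⟨fun _ _ h => ⟨h.1.symm, h.2.2, h.2.1⟩⟩
  loopless := ⟨fun _ h => G.irrefl h.1⟩

/-- Any two vertices are joined by at most two simple paths. -/
def IsTwoCycleFree {V : Type*} (G : SimpleGraph V) : Prop :=
  ∀ u v : V, (Set.univ : Set (G.Path u v)).encard ≤ 2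

/-- The largest `r` such that for every vertex `v` the subgraph induced by the vertices at distance
at most `r` from `v` is 2-cycle free (`⊤` if this holds for every `r`). -/
def twoCycleFreeRadius {V : Type*} (G : SimpleGraph V) : ℕ∞ :=
  ⨆ (r : ℕ) (_ : ∀ v : V, IsTwoCycleFree (G.induce {w : V | G.edist v w ≤ (r : ℕ∞)})), (r : ℕ∞)

/-- The event that the 2-cycle free radius is at least `κ₀ * log_d n`. -/
def TwoCycleEvent (κ₀ d : ℝ) (n : ℕ) : Set (SimpleGraph (Fin n)) :=
  {G | ENNReal.ofReal (κ₀ * Real.logb d n) ≤ ((twoCycleFreeRadius G : ℕ∞) : ENNReal)}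

/-! ### The Z-shape graph matrix -/

open Classical in
/-- The `p`-biased Fourier character of the pair `{u, v}`. -/
def chi {n : ℕ} (p : ℝ) (G : SimpleGraph (Fin n)) (u v : Fin n) : ℝ :=
  if G.Adj u v then √((1 - p) / p) else -√(p / (1 - p))

/-- Ordered pairs of distinct vertices. -/
abbrev OrdPair (n : ℕ) : Type := {x : Fin n × Fin n // x.1 ≠ x.2}

/-- `M_Z[(i,j),(k,l)] = χ(i,k) χ(j,k) χ(j,l)` if `i, j, k, l` are distinct, and `0` otherwise. -/
def zMatrix {n : ℕ} (p : ℝ) (G : SimpleGraph (Fin n)) : Matrix (OrdPair n) (OrdPair n) ℝ :=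
  Matrix.of fun x y =>
    if x.1.1 ≠ y.1.1 ∧ x.1.1 ≠ y.1.2 ∧ x.1.2 ≠ y.1.1 ∧ x.1.2 ≠ y.1.2 then
      chi p G x.1.1 y.1.1 * chi p G x.1.2 y.1.1 * chi p G x.1.2 y.1.2
    else 0

/-- The Z-shape matrix of the graph pruned at degree `cdeg * d`, in the `d/n`-biased basis. -/
def prunedZ (cdeg d : ℝ) {n : ℕ} (G : SimpleGraph (Fin n)) : Matrix (OrdPair n) (OrdPair n) ℝ :=
  zMatrix (edgeProb d n : ℝ) (prune (cdeg * d) G)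

/-- Spectral norm: the operator norm on Euclidean space. -/
def specNorm {ι : Type*} [Fintype ι] [DecidableEq ι] (M : Matrix ι ι ℝ) : ℝ :=
  ‖Matrix.toEuclideanCLM (𝕜 := ℝ) M‖

/-! ### Shape walks of the Z-shape and their step labels -/

/-- A closed shape walk of `2q` blocks, alternately copies of the Z-shape and of its transpose.
The vertices `i, j, k, l` of the shape are `0, 1, 2, 3 : Fin 4`; block `t` is labelled by the
injection `ψ t`. Copies of `Z` sit at even `t`, copies of `Zᵀ` at odd `t`; consecutive blocks (cyclically) share their common boundary as an ordered pair. -/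
structure ShapeWalk (n q : ℕ) where
  ψ : Fin (2 * q) → Fin 4 ↪ Fin n
  right_eq : ∀ t : Fin (2 * q), Even (t : ℕ) →
    ψ (finRotate _ t) 2 = ψ t 2 ∧ ψ (finRotate _ t) 3 = ψ t 3
  left_eq : ∀ t : Fin (2 * q), ¬ Even (t : ℕ) →
    ψ (finRotate _ t) 0 = ψ t 0 ∧ ψ (finRotate _ t) 1 = ψ t 1

/-- The status of a step. -/
inductive StepLabel
  | singleton
  | F
  | S
  | R
  | H
  deriving DecidableEq

namespace ShapeWalk

variable {n q : ℕ} (P : ShapeWalk n q)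

/-- The labels of block `t` in the direction of the walk. The transpose of the Z-shape is the
Z-shape with `i, l` and `j, k` exchanged, so after this exchange every block has entry boundary
`{0, 1}`, exit boundary `{2, 3}`, and steps `0 → 2`, `1 → 2`, `1 → 3`, in this order. -/
def role (t : Fin (2 * q)) (r : Fin 4) : Fin n :=
  if Even (t : ℕ) then P.ψ t r else P.ψ t r.rev

/-- Tail of each of the three steps of a block. -/
def tail : Fin 3 → Fin 4 := ![0, 1, 1]

/-- Head of each of the three steps of a block. -/
def head : Fin 3 → Fin 4 := ![2, 2, 3]

/-- The edge of the underlying graph that step `e` uses. -/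
def edge (e : Fin (2 * q) × Fin 3) : Sym2 (Fin n) :=
  s(P.role e.1 (tail e.2), P.role e.1 (head e.2))

/-- The position of a step in the walk. -/
def time (e : Fin (2 * q) × Fin 3) : ℕ := 3 * (e.1 : ℕ) + (e.2 : ℕ)

/-- The edge of the step is used once in the whole walk. -/
def IsSingleton (e : Fin (2 * q) × Fin 3) : Prop :=
  ∀ e', P.edge e' = P.edge e → e' = e

def IsFirstUse (e : Fin (2 * q) × Fin 3) : Prop :=
  ∀ e', P.edge e' = P.edge e → time e ≤ time e'

def IsLastUse (e : Fin (2 * q) × Fin 3) : Prop :=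
  ∀ e', P.edge e' = P.edge e → time e' ≤ time e

/-- The destination of step `e` has appeared before this step: in an earlier block, on the entry
boundary of the current block, or as the destination of an earlier step of the current block. -/
def DestSeen (e : Fin (2 * q) × Fin 3) : Prop :=
  (∃ t' < e.1, ∃ r, P.role t' r = P.role e.1 (head e.2)) ∨
  P.role e.1 0 = P.role e.1 (head e.2) ∨ P.role e.1 1 = P.role e.1 (head e.2) ∨
  ∃ s' < e.2, P.role e.1 (head s') = P.role e.1 (head e.2)

open Classical in
/-- Step labels: an edge used once is a singleton; otherwise its first use is fresh (`F`) or a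
surprise visit (`S`), its last use is a return (`R`), all other uses are high-mul (`H`). -/
def label (e : Fin (2 * q) × Fin 3) : StepLabel :=
  if P.IsSingleton e then .singleton
  else if P.IsFirstUse e then (if P.DestSeen e then .S else .F)
  else if P.IsLastUse e then .R
  else .H

/-- A vertex on the exit boundary of block `t` that was not seen before. -/
def FirstAppearance (t : Fin (2 * q)) (r : Fin 4) : Prop :=
  (r = 2 ∨ r = 3) ∧ ∀ t' < t, ∀ r', P.role t' r' ≠ P.role t r

/-- A vertex on the entry boundary of block `t` that is not seen again. -/
def LastAppearance (t : Fin (2 * q)) (r : Fin 4) : Prop :=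
  (r = 0 ∨ r = 1) ∧ ∀ t' > t, ∀ r', P.role t' r' ≠ P.role t r

/-! ### The vertex/edge-factor assignment scheme -/

/-- The value of a step with given label, with `Singdecay = exp (-d)`. -/
def stepValue (d : ℝ) (n : ℕ) : StepLabel → ℝ
  | .singleton => √(n / d) * (d / n) * Real.exp (-d)
  | .F => 1
  | .S => 1
  | .R => 1
  | .H => √(n / d)

/-- The edge value of block `t`. -/
def edgeval (d : ℝ) (t : Fin (2 * q)) : ℝ :=
  ∏ s : Fin 3, stepValue d n (P.label (t, s))

open Classical in
/-- The factor of vertex `r` of block `t`: `√n` for a first and for a last appearance. A vertex on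
the exit boundary in a middle appearance costs `c` if it is reached by an `R` step or doubly
constrained by `H` steps, `c * √d` if it is reached by an `H` step only, and otherwise a label in
`2 |V(Z)| q = 8 q`. A vertex of the entry boundary is known and needs no label. -/
def vertexFactor (c d : ℝ) (t : Fin (2 * q)) (r : Fin 4) : ℝ :=
  if P.FirstAppearance t r ∨ P.LastAppearance t r then √n
  else if r = 0 ∨ r = 1 then 1
  else if ∃ s, head s = r ∧ P.label (t, s) = .R then c
  else if ∃ s s', s ≠ s' ∧ head s = r ∧ head s' = r ∧
      P.label (t, s) = .H ∧ P.label (t, s') = .H then c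
  else if ∃ s, head s = r ∧ P.label (t, s) = .H then c * √d
  else 8 * q

/-- The cost of settling unforced returns: each surprise visit pays for at most `a` of them, each
settled by a label in `2 |V(Z)| q = 8 q`. -/
def purFactor (a : ℕ) (t : Fin (2 * q)) : ℝ :=
  ∏ s : Fin 3, if P.label (t, s) = .S then (8 * q : ℝ) ^ a else 1

/-- The vertex cost of block `t`. -/
def vtxcost (c : ℝ) (a : ℕ) (d : ℝ) (t : Fin (2 * q)) : ℝ :=
  (∏ r : Fin 4, P.vertexFactor c d t r) * P.purFactor a t

end ShapeWalk

/-! ### Block values -/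

/-- `𝔼[ Tr((M Mᵀ)^q) · 𝟙_E ]` for `M` the Z-shape matrix of the pruned graph and `E` the event that
the graph sample has 2-cycle free radius at least `κ₀ * log_d n`. -/
def traceMoment (cdeg κ₀ d : ℝ) (n q : ℕ) : ℝ :=
  ∫ G, (TwoCycleEvent κ₀ d n).indicator
    (fun G => ((prunedZ cdeg d G * (prunedZ cdeg d G).transpose) ^ q).trace) G ∂(sparseGraph d n)

/-- `B` is a valid block-value function for the Z-shape with walk lengths `q`, under the factor
assignment scheme with constants `c`, `a`: the trace moment is at most
`dimension * auxcost * B ^ (2q)` for some `auxcost` with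
`(dimension * auxcost) ^ (1 / 2q) ≤ 1 + o(1)`, and every block of every shape walk satisfies
`vtxcost * edgeval ≤ B`. -/
def IsValidBlockValue (cdeg κ₀ d c : ℝ) (a : ℕ) (q : ℕ → ℕ) (B : ℕ → ℝ) : Prop :=
  (∃ aux : ℕ → ℝ, (∀ n, 0 ≤ aux n) ∧
    (∀ᶠ n : ℕ in atTop,
      traceMoment cdeg κ₀ d n (q n) ≤ ((n : ℝ) * (n - 1)) * aux n * B n ^ (2 * q n)) ∧
    (∀ ε > (0 : ℝ), ∀ᶠ n : ℕ in atTop,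
      ((n : ℝ) * (n - 1) * aux n) ^ ((1 : ℝ) / (2 * q n)) ≤ 1 + ε)) ∧
  ∀ᶠ n : ℕ in atTop, ∀ (P : ShapeWalk n (q n)) (t : Fin (2 * q n)),
    P.vtxcost c a d t * P.edgeval d t ≤ B n

end SparseZ

end

namespace SparseZ

/-! Everything rests on one estimate: the centred adjacency matrix of the pruned graph has norm
O(√d), with a constant free of d. Dividing by √(p(1-p)) gives the character matrix X, so ‖X‖ =
O(√n), while its entries are at most √(n/d) in absolute value. Apart from the terms with l = i, M_Z
applies X in the variable l, multiplies pointwise by χ(j,k) and applies X in the variable k. Hence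
‖M_Z‖ = O(√n · √(n/d) · √n), and the terms with l = i are of lower order (`specNorm_zMatrix_le`).

The estimate for the centred matrix is a Kahn–Szemerédi argument over integer vectors k. Light
couples, |k_u k_v| ≤ √d, are handled by a Chernoff bound and a net (`LightBound`). Heavy couples are
split in `sum_heavy_le`: entries of very different size are controlled by the degree cap, two very
large entries by local sparsity, and the others by a discrepancy bound over dyadic levels. Leaving
the largest entries to local sparsity allows a slack n^(δ/2) in the discrepancy bound. The failure
probability is then about exp(-n^(δ/2)), small enough for the trace moment.

Local sparsity is deterministic on the 2-cycle event: a connected 2-cycle free graph has at most as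
many edges as vertices, so a set of inner minimum degree 3 doubles at each step of its growth and
must have more than n^δ elements. For the norm bound with high probability, a union bound gives it
instead.

The trace moment is not expanded into walks. The trace is at most the dimension times ‖M_Z‖^(2q);
where the norm bound fails, a deterministic bound, worse by a factor ρ depending on d, is outweighed
by the tiny probability as long as q is at most a small power of n (`traceMoment_le`). The bound on
the value of a block is a separate finite case analysis of step labels (`block_product_le`). -/

/-! ### Exponential moments of edge sums in the binomial random graph -/

instance {V : Type*} [Countable V] : MeasurableSingletonClass (SimpleGraph V) where
  measurableSet_singleton G := by
    have := SimpleGraph.measurableEmbedding_edgeSet.measurable (measurableSet_singleton G.edgeSet)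
    convert this using 1
    ext H
    simp

open Classical in
/-- exponential moment generating function -/
lemma sum_graph_eq_sum_powerset {V : Type*} [Fintype V] (g : Finset (Sym2 V) → ℝ) :
    ∑ G : SimpleGraph V, g G.edgeFinset = ∑ t ∈ ((⊤ : SimpleGraph V).edgeFinset).powerset, g t := by
  refine Finset.sum_bij (fun G _ => G.edgeFinset) ?_ ?_ ?_ ?_
  · intro G _
    simp only [Finset.mem_powerset]
    exact SimpleGraph.edgeFinset_mono le_top
  · intro G _ H _ h
    exact SimpleGraph.edgeFinset_inj.1 h
  · intro t ht
    refine ⟨SimpleGraph.fromEdgeSet (t : Set (Sym2 V)), Finset.mem_univ _, ?_⟩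
    ext e
    simp only [SimpleGraph.mem_edgeFinset, SimpleGraph.edgeSet_fromEdgeSet]
    have := Finset.mem_powerset.1 ht
    constructor
    · rintro ⟨h, -⟩; exact h
    · intro h
      refine ⟨h, ?_⟩
      have := this h
      simpa using this
  · intros; rfl

open Classical in
lemma sum_adj_eq_two_mul_sum_edge {V : Type*} [Fintype V] (G : SimpleGraph V) (f : V → V → ℝ)
    (hf : ∀ u v, f u v = f v u) :
    ∑ u, ∑ v, (if G.Adj u v then f u v else 0) =
      2 * ∑ e ∈ G.edgeFinset, Sym2.lift ⟨f, hf⟩ e := by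
  have h1 : ∑ d : G.Dart, Sym2.lift ⟨f, hf⟩ d.edge = ∑ u, ∑ v, (if G.Adj u v then f u v else 0) := by
    rw [← Fintype.sum_prod_type', ← Finset.sum_filter]
    refine Finset.sum_bij (fun d _ => d.toProd) ?_ ?_ ?_ ?_
    · intro d _; simp
    · intro d _ d' _ h; exact SimpleGraph.Dart.ext d d' h
    · intro b hb; exact ⟨⟨b, by simpa using hb⟩, Finset.mem_univ _, rfl⟩
    · intro d _; rfl
  rw [← h1, ← Finset.sum_fiberwise_of_maps_to (g := fun d : G.Dart => d.edge) (t := G.edgeFinset)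
    (fun d _ => by simp), Finset.mul_sum]
  refine Finset.sum_congr rfl fun e he => ?_
  rw [Finset.sum_congr rfl (g := fun _ => Sym2.lift ⟨f, hf⟩ e)
    (fun d hd => by rw [(Finset.mem_filter.1 hd).2]), Finset.sum_const,
    G.dart_edge_fiber_card e (by simpa using he)]
  simp

open Classical in
lemma integral_graph {V : Type*} [Fintype V] (p : unitInterval) (F : SimpleGraph V → ℝ) :
    ∫ G, F G ∂(SimpleGraph.binomialRandom V p) = ∑ G : SimpleGraph V,
      ((p : ℝ) ^ G.edgeFinset.card * (1 - p : ℝ) ^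
        ((⊤ : SimpleGraph V).edgeFinset.card - G.edgeFinset.card)) * F G := by
  rw [integral_fintype Integrable.of_finite]
  refine Finset.sum_congr rfl fun G _ => ?_
  rw [smul_eq_mul, measureReal_def, SimpleGraph.binomialRandom_singleton,
    SimpleGraph.card_edgeFinset_top_eq_card_choose_two, Nat.card_eq_fintype_card,
    Set.ncard_eq_toFinset_card', ← SimpleGraph.edgeFinset]
  simp

open Classical in
/-- The exponential moment of a sum of edge weights over the binomial random graph. -/
lemma integral_exp_edges_le {V : Type*} [Fintype V] (p : unitInterval) (f : Sym2 V → ℝ) :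
    ∫ G, Real.exp (∑ e ∈ G.edgeFinset, f e) ∂(SimpleGraph.binomialRandom V p) ≤
      Real.exp (p * ∑ e ∈ (⊤ : SimpleGraph V).edgeFinset, (Real.exp (f e) - 1)) := by
  rw [integral_graph, sum_graph_eq_sum_powerset (fun t => ((p : ℝ) ^ t.card * (1 - p : ℝ) ^
        ((⊤ : SimpleGraph V).edgeFinset.card - t.card)) * Real.exp (∑ e ∈ t, f e))]
  have : ∑ t ∈ (⊤ : SimpleGraph V).edgeFinset.powerset, ((p : ℝ) ^ t.card * (1 - p : ℝ) ^
        ((⊤ : SimpleGraph V).edgeFinset.card - t.card)) * Real.exp (∑ e ∈ t, f e) =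
      ∏ e ∈ (⊤ : SimpleGraph V).edgeFinset, (p * Real.exp (f e) + (1 - p)) := by
    rw [Finset.prod_add]
    refine Finset.sum_congr rfl fun t ht => ?_
    rw [Finset.prod_mul_distrib, Finset.prod_const, Finset.prod_const, Real.exp_sum,
      Finset.card_sdiff_of_subset (Finset.mem_powerset.1 ht)]
    ring
  rw [this, Finset.mul_sum, Real.exp_sum]
  -- Each factor is 1 + p(e^f - 1), which is at most exp(p(e^f - 1)).
  refine Finset.prod_le_prod (fun e _ => ?_) (fun e _ => ?_)
  · have := p.2.1; have := p.2.2; have := Real.exp_pos (f e)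
    have h1 : (0:ℝ) ≤ 1 - p := by linarith
    positivity
  · refine le_trans (le_of_eq ?_) (Real.add_one_le_exp _)
    ring

open Classical in
/-- Chernoff bound for weighted sums of the edge indicators. -/
lemma chernoff {V : Type*} [Fintype V] (p : unitInterval) (f : V → V → ℝ)
    (hf : ∀ u v, f u v = f v u) (x : ℝ) :
    (SimpleGraph.binomialRandom V p).real
      {G | p * ∑ u, ∑ v, (if u ≠ v then Real.exp (f u v) - 1 else 0) + 2 * x ≤
        ∑ u, ∑ v, (if G.Adj u v then f u v else 0)} ≤ Real.exp (-x) := by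
  set μ := SimpleGraph.binomialRandom V p
  set F := Sym2.lift ⟨f, hf⟩
  set K := p * ∑ e ∈ (⊤ : SimpleGraph V).edgeFinset, (Real.exp (F e) - 1)
  -- Sums over ordered pairs count every edge twice; this is the origin of the 2 in front of x.
  have hK : p * ∑ u, ∑ v, (if u ≠ v then Real.exp (f u v) - 1 else 0) = 2 * K := by
    have := sum_adj_eq_two_mul_sum_edge (⊤ : SimpleGraph V) (fun u v => Real.exp (f u v) - 1)
      (fun u v => by rw [hf])
    simp only [SimpleGraph.top_adj] at this
    rw [this]
    have h2 : ∀ e, Sym2.lift ⟨fun u v => Real.exp (f u v) - 1, fun u v => by simp [hf u v]⟩ e =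
        Real.exp (F e) - 1 := fun e => by induction e with | h x y => rfl
    simp only [h2, K]
    rw [mul_left_comm]
    congr!
  have h := mul_meas_ge_le_integral_of_nonneg (μ := μ)
    (f := fun G => Real.exp (∑ e ∈ G.edgeFinset, F e)) (Eventually.of_forall fun G => (Real.exp_pos _).le)
    Integrable.of_finite (Real.exp (K + x))
  have h2 := h.trans (integral_exp_edges_le p F)
  have h3 : μ.real {G | Real.exp (K + x) ≤ Real.exp (∑ e ∈ G.edgeFinset, F e)} ≤ Real.exp (-x) := by
    have : Real.exp (-x) = Real.exp K / Real.exp (K + x) := by rw [← Real.exp_sub]; congr 1; ring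
    rw [this, le_div_iff₀ (Real.exp_pos _), mul_comm]
    exact h2
  refine le_trans (le_of_eq ?_) h3
  congr 1
  ext G
  simp only [Set.mem_ofPred_eq, Real.exp_le_exp, hK, sum_adj_eq_two_mul_sum_edge G f hf]
  constructor <;> intro h <;> linarith

/-! ### 2-cycle free graphs are sparse -/

/-- A walk to u can be followed up to the first time it uses the deleted edge, and there it stands
at u or w. -/
lemma reachable_deleteEdges_or {V : Type*} {T : SimpleGraph V} (hT : T.Connected) (u w z : V) :
    (T.deleteEdges {s(u, w)}).Reachable z u ∨ (T.deleteEdges {s(u, w)}).Reachable z w := by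
  have key : ∀ (z u' : V) (_ : T.Walk z u'), u' = u →
      (T.deleteEdges {s(u, w)}).Reachable z u ∨ (T.deleteEdges {s(u, w)}).Reachable z w := by
    intro z u' p
    induction p with
    | nil => rintro rfl; exact Or.inl .rfl
    | @cons a b c h p ih =>
      intro hu
      by_cases he : s(a, b) = s(u, w)
      · rcases Sym2.eq_iff.1 he with ⟨rfl, rfl⟩ | ⟨rfl, rfl⟩
        · exact Or.inl .rfl
        · exact Or.inr .rfl
      · have hab : (T.deleteEdges {s(u, w)}).Reachable a b :=
          SimpleGraph.Adj.reachable (by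
            rw [SimpleGraph.deleteEdges_adj]; exact ⟨h, fun h' => he (Set.mem_singleton_iff.1 h')⟩)
        rcases ih hu with h1 | h1
        · exact Or.inl (hab.trans h1)
        · exact Or.inr (hab.trans h1)
  obtain ⟨p⟩ := hT.preconnected z u
  exact key z u p rfl

lemma not_reachable_deleteEdges {V : Type*} {T : SimpleGraph V} (hT : T.IsTree) {u w : V}
    (h : T.Adj u w) : ¬ (T.deleteEdges {s(u, w)}).Reachable u w := by
  have := SimpleGraph.isAcyclic_iff_forall_isBridge.1 hT.isAcyclic (e := s(u, w)) (by simpa using h)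
  exact SimpleGraph.isBridge_iff.1 this

lemma exists_edge_separating {V : Type*} {T : SimpleGraph V} (hT : T.IsTree) {a b : V}
    (hab : a ≠ b) :
    ∃ u w, T.Adj u w ∧ ¬ (T.deleteEdges {s(u, w)}).Reachable a b := by
  obtain ⟨p, hp, -⟩ := hT.existsUnique_path a b
  cases p with
  | nil => exact absurd rfl hab
  | @cons _ c _ h p =>
    refine ⟨a, c, h, fun hr => not_reachable_deleteEdges hT h (hr.trans ?_)⟩
    rw [SimpleGraph.Walk.cons_isPath_iff] at hp
    refine ⟨(p.toDeleteEdges {s(a, c)} ?_).reverse⟩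
    rintro e he rfl
    exact hp.2 (SimpleGraph.Walk.fst_mem_support_of_mem_edges p he)

/-- Exchange property of spanning trees: ab reconnects the two sides of T - uw. Since x and y lie on
different sides, the path joining them in T - uw + ab must use ab. -/
lemma exists_path_through {V : Type*} {T K : SimpleGraph V} (hT : T.IsTree) (hTK : T ≤ K)
    {u w a b x y : V} (hK : K.Adj a b)
    (hab : ¬ (T.deleteEdges {s(u, w)}).Reachable a b)
    (hxy : ¬ (T.deleteEdges {s(u, w)}).Reachable x y) :
    ∃ P : K.Path x y, s(a, b) ∈ P.1.edges ∧ ∀ e ∈ P.1.edges, e = s(a, b) ∨ e ∈ T.edgeSet := by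
  classical
  set D := T.deleteEdges {s(u, w)} with hD
  set D' := D ⊔ SimpleGraph.edge a b with hD'
  have hDD' : D ≤ D' := le_sup_left
  have hadj : D'.Adj a b := Or.inr (by rw [SimpleGraph.edge_adj]; exact ⟨by simp, hK.ne⟩)
  have hreach : D'.Reachable x y := by
    have key : (D.Reachable x a ∧ D.Reachable b y) ∨ (D.Reachable x b ∧ D.Reachable a y) := by
      have e1 := reachable_deleteEdges_or hT.connected u w a
      have e2 := reachable_deleteEdges_or hT.connected u w b
      have e3 := reachable_deleteEdges_or hT.connected u w x
      have e4 := reachable_deleteEdges_or hT.connected u w y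
      rw [← hD] at e1 e2 e3 e4
      rcases e1 with e1 | e1 <;> rcases e2 with e2 | e2
      · exact absurd (e1.trans e2.symm) hab
      · rcases e3 with e3 | e3 <;> rcases e4 with e4 | e4
        · exact absurd (e3.trans e4.symm) hxy
        · exact Or.inl ⟨e3.trans e1.symm, e2.trans e4.symm⟩
        · exact Or.inr ⟨e3.trans e2.symm, e1.trans e4.symm⟩
        · exact absurd (e3.trans e4.symm) hxy
      · rcases e3 with e3 | e3 <;> rcases e4 with e4 | e4
        · exact absurd (e3.trans e4.symm) hxy
        · exact Or.inr ⟨e3.trans e2.symm, e1.trans e4.symm⟩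
        · exact Or.inl ⟨e3.trans e1.symm, e2.trans e4.symm⟩
        · exact absurd (e3.trans e4.symm) hxy
      · exact absurd (e1.trans e2.symm) hab
    rcases key with ⟨h1, h2⟩ | ⟨h1, h2⟩
    · exact ((h1.mono hDD').trans hadj.reachable).trans (h2.mono hDD')
    · exact ((h1.mono hDD').trans hadj.symm.reachable).trans (h2.mono hDD')
  obtain ⟨W⟩ := hreach
  have hD'K : D' ≤ K := by
    refine sup_le ((SimpleGraph.deleteEdges_le _).trans hTK) ?_
    rw [SimpleGraph.edge_le_iff]
    exact Or.inr hK
  let P := W.toPath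
  refine ⟨⟨P.1.mapLe hD'K, P.2.mapLe hD'K⟩, ?_, ?_⟩
  · simp only [SimpleGraph.Walk.edges_mapLe_eq_edges]
    by_contra hc
    refine hxy ⟨P.1.transfer D fun e he => ?_⟩
    have h1 := P.1.edges_subset_edgeSet he
    induction e with
    | h s t =>
    rcases h1 with h1 | h1
    · exact h1
    · rw [SimpleGraph.edge_adj] at h1
      exfalso
      apply hc
      rcases h1.1 with ⟨rfl, rfl⟩ | ⟨rfl, rfl⟩
      · exact he
      · rwa [Sym2.eq_swap]
  · intro e he
    simp only [SimpleGraph.Walk.edges_mapLe_eq_edges] at he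
    have h1 := P.1.edges_subset_edgeSet he
    induction e with
    | h s t =>
    rcases h1 with h1 | h1
    · exact Or.inr ((SimpleGraph.deleteEdges_le _) h1)
    · rw [SimpleGraph.edge_adj] at h1
      left
      rcases h1.1 with ⟨rfl, rfl⟩ | ⟨rfl, rfl⟩
      · rfl
      · exact Sym2.eq_swap

/-- Removing two distinct tree edges leaves three components in a row, and x, y are taken from the
outer two: each is the end of one edge that is far from the other edge. -/
lemma exists_separated_by_both {V : Type*} {T : SimpleGraph V} (hT : T.IsTree) {u₁ w₁ u₂ w₂ : V}
    (h₁ : T.Adj u₁ w₁) (h₂ : T.Adj u₂ w₂) :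
    ∃ x y, ¬ (T.deleteEdges {s(u₁, w₁)}).Reachable x y ∧
      ¬ (T.deleteEdges {s(u₂, w₂)}).Reachable x y := by
  have b₁ := not_reachable_deleteEdges hT h₁
  have b₂ := not_reachable_deleteEdges hT h₂
  by_cases he : s(u₁, w₁) = s(u₂, w₂)
  · exact ⟨u₁, w₁, b₁, by rwa [← he]⟩
  · have r₂ : (T.deleteEdges {s(u₁, w₁)}).Reachable u₂ w₂ :=
      SimpleGraph.Adj.reachable (by
        rw [SimpleGraph.deleteEdges_adj]; exact ⟨h₂, fun h => he (Set.mem_singleton_iff.1 h).symm⟩)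
    have r₁ : (T.deleteEdges {s(u₂, w₂)}).Reachable u₁ w₁ :=
      SimpleGraph.Adj.reachable (by
        rw [SimpleGraph.deleteEdges_adj]; exact ⟨h₁, fun h => he (Set.mem_singleton_iff.1 h)⟩)
    obtain ⟨z₂, hz₂, hz₂'⟩ : ∃ z, (T.deleteEdges {s(u₁, w₁)}).Reachable z u₂ ∧
        ¬ (T.deleteEdges {s(u₂, w₂)}).Reachable z u₁ := by
      by_cases h : (T.deleteEdges {s(u₂, w₂)}).Reachable u₂ u₁
      · exact ⟨w₂, r₂.symm, fun h' => b₂ (h.trans h'.symm)⟩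
      · exact ⟨u₂, .rfl, h⟩
    obtain ⟨z₁, hz₁, hz₁'⟩ : ∃ z, (T.deleteEdges {s(u₂, w₂)}).Reachable z u₁ ∧
        ¬ (T.deleteEdges {s(u₁, w₁)}).Reachable z u₂ := by
      by_cases h : (T.deleteEdges {s(u₁, w₁)}).Reachable u₁ u₂
      · exact ⟨w₁, r₁.symm, fun h' => b₁ (h.trans h'.symm)⟩
      · exact ⟨u₁, .rfl, h⟩
    exact ⟨z₁, z₂, fun h => hz₁' (h.trans hz₂), fun h => hz₂' (h.symm.trans hz₁)⟩

/-- A connected 2-cycle free graph has at most as many edges as vertices. -/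
lemma IsTwoCycleFree.ncard_edgeSet_le {V : Type*} [Finite V] {K : SimpleGraph V}
    (h : IsTwoCycleFree K) (hK : K.Connected) : K.edgeSet.ncard ≤ Nat.card V := by
  classical
  cases nonempty_fintype V
  by_contra! hc
  obtain ⟨T, hTK, hT⟩ := hK.exists_isTree_le
  have hTc := hT.card_edgeFinset
  -- A spanning tree has one edge less than vertices, so an excess of edges leaves at least two
  -- edges outside it. The tree path avoids both and each exchanged path uses exactly one: three
  -- paths with the same ends.
  have hdiff : 1 < (K.edgeSet \ T.edgeSet).ncard := by
    rw [Set.ncard_sdiff (SimpleGraph.edgeSet_mono hTK), Set.ncard_eq_toFinset_card' T.edgeSet,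
      ← SimpleGraph.edgeFinset]
    rw [Nat.card_eq_fintype_card] at hc
    omega
  obtain ⟨e₁, he₁, e₂, he₂, hne⟩ := (Set.one_lt_ncard (Set.toFinite _)).1 hdiff
  induction e₁ with | h a₁ b₁ =>
  induction e₂ with | h a₂ b₂ =>
  obtain ⟨u₁, w₁, ht₁, hs₁⟩ := exists_edge_separating hT (SimpleGraph.Adj.ne he₁.1)
  obtain ⟨u₂, w₂, ht₂, hs₂⟩ := exists_edge_separating hT (SimpleGraph.Adj.ne he₂.1)
  obtain ⟨x, y, hx₁, hx₂⟩ := exists_separated_by_both hT ht₁ ht₂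
  obtain ⟨P₁, hP₁, hP₁'⟩ := exists_path_through hT hTK he₁.1 hs₁ hx₁
  obtain ⟨P₂, hP₂, hP₂'⟩ := exists_path_through hT hTK he₂.1 hs₂ hx₂
  obtain ⟨P, hP, -⟩ := hT.existsUnique_path x y
  let P₀ : K.Path x y := ⟨P.mapLe hTK, hP.mapLe hTK⟩
  have hP₀ : ∀ e ∈ P₀.1.edges, e ∈ T.edgeSet := fun e he => by
    simp only [P₀, SimpleGraph.Walk.edges_mapLe_eq_edges] at he
    exact P.edges_subset_edgeSet he
  have h01 : P₀ ≠ P₁ := fun h => he₁.2 (hP₀ _ (h ▸ hP₁))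
  have h02 : P₀ ≠ P₂ := fun h => he₂.2 (hP₀ _ (h ▸ hP₂))
  have h12 : P₁ ≠ P₂ := fun h => by
    rcases hP₂' _ (h ▸ hP₁) with h | h
    · exact hne h
    · exact he₁.2 h
  have h3 : (({P₀, P₁, P₂} : Set (K.Path x y))).encard = 3 := by
    rw [Set.encard_eq_three]
    exact ⟨_, _, _, h01, h02, h12, rfl⟩
  have := (Set.encard_le_encard (Set.subset_univ ({P₀, P₁, P₂} : Set (K.Path x y)))).trans (h x y)
  rw [h3] at this
  norm_num at this

lemma IsTwoCycleFree.of_hom {V W : Type*} {K : SimpleGraph V} {G : SimpleGraph W}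
    (h : IsTwoCycleFree G) (f : K →g G) (hf : Function.Injective f) : IsTwoCycleFree K := by
  intro u v
  refine le_trans ?_ (h (f u) (f v))
  have hinj : Function.Injective (fun P : K.Path u v => SimpleGraph.Path.map f hf P) := by
    intro P Q hPQ
    apply Subtype.ext
    exact SimpleGraph.Walk.map_injective_of_injective hf u v (congrArg Subtype.val hPQ)
  rw [← hinj.encard_image]
  exact Set.encard_le_encard (Set.subset_univ _)

/-! ### Small vertex sets of a locally 2-cycle free graph have a vertex of small inner degree -/

open Classical in
/-- The vertices of `W` that are reached from `v` by at most `i` steps inside `W`. -/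
noncomputable def innerBall {V : Type*} (G : SimpleGraph V) (W : Finset V) (v : V) : ℕ → Finset V
  | 0 => {v}
  | i + 1 => innerBall G W v i ∪ W.filter (fun w => ∃ u ∈ innerBall G W v i, G.Adj u w)

section
variable {V : Type*} {G : SimpleGraph V} {W : Finset V} {v : V}

lemma innerBall_mono (i : ℕ) : innerBall G W v i ⊆ innerBall G W v (i + 1) := by
  classical
  rw [innerBall]; exact Finset.subset_union_left

lemma mem_innerBall_self (i : ℕ) : v ∈ innerBall G W v i := by
  induction i with
  | zero => simp [innerBall]
  | succ i ih => exact innerBall_mono i ih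

lemma mem_innerBall_succ {i : ℕ} {w : V} : w ∈ innerBall G W v (i + 1) ↔
    w ∈ innerBall G W v i ∨ (w ∈ W ∧ ∃ u ∈ innerBall G W v i, G.Adj u w) := by
  classical
  simp [innerBall]

lemma innerBall_subset (hv : v ∈ W) (i : ℕ) : innerBall G W v i ⊆ W := by
  induction i with
  | zero => simpa [innerBall] using hv
  | succ i ih =>
    intro w hw
    rcases mem_innerBall_succ.1 hw with h | h
    · exact ih h
    · exact h.1

lemma edist_le_of_mem_innerBall {i : ℕ} {w : V} (hw : w ∈ innerBall G W v i) :
    G.edist v w ≤ (i : ℕ∞) := by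
  induction i generalizing w with
  | zero =>
    have : w = v := by simpa [innerBall] using hw
    simp [this]
  | succ i ih =>
    rcases mem_innerBall_succ.1 hw with h | ⟨-, u, hu, h⟩
    · exact (ih h).trans (by exact_mod_cast Nat.le_succ i)
    · refine (SimpleGraph.edist_triangle (v := u)).trans ?_
      rw [SimpleGraph.edist_eq_one_iff_adj.2 h]
      push_cast
      gcongr
      exact ih hu

lemma connected_induce_innerBall (i : ℕ) :
    (G.induce (innerBall G W v i : Set V)).Connected := by
  have key : ∀ (i : ℕ) (w : V) (hw : w ∈ innerBall G W v i),
      (G.induce (innerBall G W v i : Set V)).Reachable ⟨v, mem_innerBall_self i⟩ ⟨w, hw⟩ := by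
    intro i
    induction i with
    | zero =>
      intro w hw
      have : w = v := by simpa [innerBall] using hw
      subst this
      exact .rfl
    | succ i ih =>
      have hsub : (innerBall G W v i : Set V) ≤ (innerBall G W v (i + 1) : Set V) :=
        Finset.coe_subset.2 (innerBall_mono i)
      intro w hw
      rcases mem_innerBall_succ.1 hw with h | ⟨-, u, hu, h⟩
      · exact (ih w h).map (SimpleGraph.induceHomOfLE G hsub).toHom
      · refine ((ih u hu).map (SimpleGraph.induceHomOfLE G hsub).toHom).trans ?_
        exact SimpleGraph.Adj.reachable (show G.Adj u w from h)
  have : Nonempty (innerBall G W v i : Set V) := ⟨⟨v, mem_innerBall_self i⟩⟩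
  exact SimpleGraph.Connected.mk fun a b => (key i a.1 a.2).symm.trans (key i b.1 b.2)

open Classical in
-- Degrees are summed inside the larger ball B. Vertices of the smaller ball A keep all their
-- neighbours in W, hence have degree at least 3; the others have degree at least 1. So |B| + 2|A| ≤
-- 2 · (number of edges) ≤ 2|B|.
lemma two_mul_card_innerBall_le (hv : v ∈ W) (hdeg : ∀ u ∈ W, 3 ≤ (W.filter (G.Adj u)).card)
    (i : ℕ) (h2 : IsTwoCycleFree (G.induce (innerBall G W v (i + 1) : Set V))) :
    2 * (innerBall G W v i).card ≤ (innerBall G W v (i + 1)).card := by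
  set B := innerBall G W v (i + 1) with hB
  set A := innerBall G W v i with hA
  set K := G.induce (B : Set V) with hK
  have he := h2.ncard_edgeSet_le (connected_induce_innerBall (i + 1))
  rw [Set.ncard_eq_toFinset_card', ← SimpleGraph.edgeFinset] at he
  have hsum := K.sum_degrees_eq_twice_card_edges
  have hAB : A ⊆ B := innerBall_mono i
  have hcard : Nat.card (B : Set V) = B.card := by simp
  have hlow : ∀ u : (B : Set V), (if u.1 ∈ A then 3 else 1) ≤ K.degree u := by
    intro u
    have himg : ∀ S : Finset V, (∀ w ∈ S, w ∈ B ∧ G.Adj u.1 w) → S.card ≤ K.degree u := by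
      intro S hS
      rw [← SimpleGraph.card_neighborFinset_eq_degree]
      refine le_trans (Finset.card_le_card ?_) (Finset.card_image_le (f := Subtype.val))
      intro w hw
      exact Finset.mem_image.2 ⟨⟨w, (hS w hw).1⟩, by simpa [K] using (hS w hw).2, rfl⟩
    split_ifs with hu
    · refine (hdeg u.1 (innerBall_subset hv i hu)).trans (himg _ fun w hw => ?_)
      rw [Finset.mem_filter] at hw
      exact ⟨mem_innerBall_succ.2 (Or.inr ⟨hw.1, u.1, hu, hw.2⟩), hw.2⟩
    · rcases mem_innerBall_succ.1 u.2 with h | ⟨-, z, hz, h⟩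
      · exact absurd h hu
      · have := himg {z} (fun w hw => by
          rw [Finset.mem_singleton.1 hw]; exact ⟨hAB hz, h.symm⟩)
        simpa using this
  have h3 : ∑ u : (B : Set V), (if u.1 ∈ A then 3 else 1) = B.card + 2 * A.card := by
    have h5 : ∑ u : (B : Set V), (if u.1 ∈ A then 3 else 1) = ∑ u ∈ B, if u ∈ A then 3 else 1 := by
      rw [← Finset.sum_coe_sort B]
      congr!
    rw [h5]
    have : ∀ u, (if u ∈ A then 3 else 1) = 1 + if u ∈ A then 2 else 0 := by
      intro u; split_ifs <;> rfl
    simp only [this, Finset.sum_add_distrib, ← Finset.sum_filter]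
    rw [Finset.filter_mem_eq_inter, Finset.inter_eq_right.2 hAB]
    simp; ring
  have h4 := Finset.sum_le_sum fun u (_ : u ∈ Finset.univ) => hlow u
  rw [h3, hsum] at h4
  rw [hcard] at he
  omega

open Classical in
/-- In a graph all whose balls of radius `r` are 2-cycle free, a vertex set of inner minimum degree
at least three has at least `2 ^ r` elements. -/
lemma two_pow_le_card {r : ℕ} (hr : ∀ v, IsTwoCycleFree (G.induce {w | G.edist v w ≤ (r : ℕ∞)}))
    (hv : v ∈ W) (hdeg : ∀ u ∈ W, 3 ≤ (W.filter (G.Adj u)).card) : 2 ^ r ≤ W.card := by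
  have key : ∀ i ≤ r, 2 ^ i ≤ (innerBall G W v i).card := by
    intro i
    induction i with
    | zero => simp [innerBall]
    | succ i ih =>
      intro hi
      have hsub : (innerBall G W v (i + 1) : Set V) ≤ {w | G.edist v w ≤ (r : ℕ∞)} := fun w hw =>
        (edist_le_of_mem_innerBall hw).trans (by exact_mod_cast hi)
      have h2 := (hr v).of_hom (SimpleGraph.induceHomOfLE G hsub).toHom
        (SimpleGraph.induceHomOfLE G hsub).injective
      have := two_mul_card_innerBall_le hv hdeg i h2
      have := ih (by omega)
      rw [pow_succ]; omega
  exact (key r le_rfl).trans (Finset.card_le_card (innerBall_subset hv r))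
end

open Classical in
/-- Every vertex set of size at most `m` has a vertex with at most two neighbours in it. -/
def LocallySparse {V : Type*} (m : ℝ) (G : SimpleGraph V) : Prop :=
  ∀ W : Finset V, W.Nonempty → (W.card : ℝ) ≤ m → ∃ v ∈ W, (W.filter (G.Adj v)).card ≤ 2

lemma locallySparse_of_mem_twoCycleEvent {κ₀ d : ℝ} {n r : ℕ} {m : ℝ}
    (hr : (r : ℝ) < κ₀ * Real.logb d n) (hm : m < 2 ^ r) {G : SimpleGraph (Fin n)}
    (hG : G ∈ TwoCycleEvent κ₀ d n) : LocallySparse m G := by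
  classical
  have h1 : (r : ℕ∞) < twoCycleFreeRadius G := by
    have h2 : ENNReal.ofReal (κ₀ * Real.logb d n) ≤ ((twoCycleFreeRadius G : ℕ∞) : ENNReal) := hG
    have h3 : ((r : ℕ∞) : ENNReal) < ((twoCycleFreeRadius G : ℕ∞) : ENNReal) := by
      refine lt_of_lt_of_le ?_ h2
      rw [ENat.toENNReal_coe, ← ENNReal.ofReal_natCast]
      exact (ENNReal.ofReal_lt_ofReal_iff (lt_of_le_of_lt (Nat.cast_nonneg r) hr)).2 hr
    exact ENat.toENNReal_lt.1 h3
  -- The radius is a supremum; being strictly above r, it is exceeded at r by an admissible radius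
  -- R.
  rw [twoCycleFreeRadius, lt_iSup_iff] at h1
  obtain ⟨R, hR⟩ := h1
  rw [lt_iSup_iff] at hR
  obtain ⟨hR, hrR⟩ := hR
  intro W ⟨v, hv⟩ hW
  by_contra! hc
  have h4 := two_pow_le_card hR hv (fun u hu => hc u hu)
  have h5 : (2:ℝ) ^ R ≤ W.card := by exact_mod_cast h4
  have h6 : (2:ℝ) ^ r ≤ 2 ^ R := pow_le_pow_right₀ (by norm_num) (by exact_mod_cast hrR.le)
  linarith

noncomputable section

/-! ### Typical properties of the sparse random graph -/

section
variable {d : ℝ} {n : ℕ}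

instance : IsProbabilityMeasure (sparseGraph d n) := by
  unfold sparseGraph; infer_instance

lemma edgeProb_eq (hd : 0 ≤ d) (hdn : d ≤ n) : (edgeProb d n : ℝ) = d / n := by
  rcases Nat.eq_zero_or_pos n with rfl | hn
  · simp [edgeProb]
  · have : (0:ℝ) < n := by exact_mod_cast hn
    rw [edgeProb, Set.projIcc_of_mem]
    exact ⟨by positivity, (div_le_one this).2 hdn⟩

open Classical in
lemma sparseGraph_chernoff {S : Set (SimpleGraph (Fin n))} {x K : ℝ} (f : Fin n → Fin n → ℝ)
    (hf : ∀ u v, f u v = f v u)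
    (hK : (edgeProb d n : ℝ) * ∑ u, ∑ v, (if u ≠ v then Real.exp (f u v) - 1 else 0) ≤ K)
    (hS : ∀ G ∈ S, K + 2 * x ≤ ∑ u, ∑ v, (if G.Adj u v then f u v else 0)) :
    (sparseGraph d n).real S ≤ Real.exp (-x) := by
  refine le_trans (measureReal_mono ?_) (chernoff (edgeProb d n) f hf x)
  intro G hG
  refine le_trans (add_le_add_left (le_trans (le_of_eq ?_) hK) _) (hS G hG)
  congr!

lemma sum_powerset_pow {V : Type*} [Fintype V] [DecidableEq V] (r : ℝ) :
    ∑ S : Finset V, r ^ S.card = (r + 1) ^ Fintype.card V := by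
  have := Finset.sum_pow_mul_eq_add_pow r 1 (Finset.univ : Finset V)
  simpa using this

lemma sum_powerset_pow_le {V : Type*} [Fintype V] [DecidableEq V] {r : ℝ} (hr : 0 ≤ r) :
    ∑ S : Finset V, r ^ S.card ≤ Real.exp (Fintype.card V * r) := by
  rw [sum_powerset_pow, Real.exp_nat_mul]
  exact pow_le_pow_left₀ (by linarith) (Real.add_one_le_exp r) _

lemma measureReal_exists_le {ι : Type*} [Fintype ι] (P : ι → SimpleGraph (Fin n) → Prop)
    {b : ι → ℝ} (h : ∀ i, (sparseGraph d n).real {G | P i G} ≤ b i) :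
    (sparseGraph d n).real {G | ∃ i, P i G} ≤ ∑ i, b i := by
  have : {G | ∃ i, P i G} = ⋃ i ∈ (Finset.univ : Finset ι), {G | P i G} := by ext; simp
  rw [this]
  exact (measureReal_biUnion_finset_le _ _).trans (Finset.sum_le_sum fun i _ => h i)

/-! ### High degree vertices -/

open Classical in
/-- The vertices of degree less than `τ`. -/
def lowDegree (τ : ℝ) (G : SimpleGraph (Fin n)) : Finset (Fin n) :=
  Finset.univ.filter fun v => ((G.neighborSet v).ncard : ℝ) < τ

open Classical in
lemma ncard_neighborSet_eq_sum (G : SimpleGraph (Fin n)) (v : Fin n) :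
    ((G.neighborSet v).ncard : ℝ) = ∑ u, if G.Adj v u then 1 else 0 := by
  rw [Set.ncard_eq_toFinset_card', Finset.sum_boole]
  congr 2
  ext; simp

lemma exp_two_lt : Real.exp 2 < 7.4 := by
  have : Real.exp 2 = Real.exp 1 ^ 2 := by rw [← Real.exp_nat_mul]; norm_num
  rw [this]
  have h1 := Real.exp_one_lt_d9
  have h0 := Real.exp_pos 1
  nlinarith

open Classical in
-- Each edge is weighted by its number of ends in T. Over ordered pairs the weights add up to at
-- least 20 d |T|, as `cdeg` ≥ 10, while the exponential mean is at most 6.4 d |T| because e^2 - 1 ≤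
-- 6.4. The gap exceeds 2 · 6 d |T|.
lemma measure_forall_high_degree_le {cdeg : ℝ} (hc : 10 ≤ cdeg) (hd : 1 < d) (hdn : d ≤ n)
    (T : Finset (Fin n)) :
    (sparseGraph d n).real {G | ∀ v ∈ T, cdeg * d ≤ (G.neighborSet v).ncard} ≤
      Real.exp (-(6 * d * T.card)) := by
  have hn : (0:ℝ) < n := by linarith
  set i : Fin n → ℝ := fun v => if v ∈ T then 1 else 0 with hi
  have hisum : ∑ v, i v = T.card := by simp [hi]
  refine sparseGraph_chernoff (K := 6.4 * d * T.card) (fun u v => i u + i v)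
    (fun u v => add_comm _ _) ?_ ?_
  · rw [edgeProb_eq (by linarith) hdn]
    have h1 : ∑ u, ∑ v, (if u ≠ v then Real.exp (i u + i v) - 1 else 0) ≤
        ∑ u : Fin n, ∑ v : Fin n, 3.2 * (i u + i v) := by
      refine Finset.sum_le_sum fun u _ => Finset.sum_le_sum fun v _ => ?_
      have h2 := exp_two_lt
      have h3 := Real.exp_one_lt_d9
      simp only [hi]
      split_ifs <;> norm_num <;> linarith
    have h2 : ∑ u : Fin n, ∑ v : Fin n, 3.2 * (i u + i v) = 6.4 * n * T.card := by
      simp only [← Finset.mul_sum, Finset.sum_add_distrib, Finset.sum_const, hisum, Finset.card_univ,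
        Fintype.card_fin, nsmul_eq_mul]
      ring
    calc d / n * _ ≤ d / n * (6.4 * n * T.card) := by
          rw [← h2]; gcongr
      _ = _ := by field_simp
  · intro G hG
    have h1 : ∑ u, ∑ v, (if G.Adj u v then i u + i v else 0) =
        2 * ∑ u, i u * ∑ v, (if G.Adj u v then 1 else 0) := by
      have h2 : ∑ u, ∑ v, (if G.Adj u v then i u + i v else 0) =
          ∑ u, ∑ v, (if G.Adj u v then i u else 0) + ∑ u, ∑ v, (if G.Adj u v then i v else 0) := by
        simp only [← Finset.sum_add_distrib]
        refine Finset.sum_congr rfl fun u _ => Finset.sum_congr rfl fun v _ => ?_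
        split_ifs <;> simp
      have h3 : ∑ u, ∑ v, (if G.Adj u v then i v else 0) =
          ∑ u, ∑ v, (if G.Adj u v then i u else 0) := by
        rw [Finset.sum_comm]; simp only [G.adj_comm]
      rw [h2, h3, two_mul]
      congr 1 <;>
      exact Finset.sum_congr rfl fun u _ => by rw [Finset.mul_sum]; simp
    rw [h1]
    have h4 : 10 * d * T.card ≤ ∑ u, i u * ∑ v, (if G.Adj u v then (1:ℝ) else 0) := by
      rw [← hisum, Finset.mul_sum]
      refine Finset.sum_le_sum fun u _ => ?_
      rw [← ncard_neighborSet_eq_sum]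
      simp only [hi]
      split_ifs with hu
      · have := hG u hu
        nlinarith
      · simp
    have : 0 ≤ d * T.card := by positivity
    nlinarith

/-- A set T with d |T| > n has probability at most e^(-6n), which survives a union bound over all
2^n sets. -/
lemma measure_card_compl_lowDegree_le {cdeg : ℝ} (hc : 10 ≤ cdeg) (hd : 1 < d) (hdn : d ≤ n) :
    (sparseGraph d n).real {G | n / d < ((lowDegree (cdeg * d) G)ᶜ.card : ℝ)} ≤
      Real.exp (-n) := by
  classical
  have hn : (0:ℝ) < n := by linarith
  have h1 := measureReal_exists_le (d := d) (n := n)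
    (fun (T : Finset (Fin n)) G => n / d < (T.card : ℝ) ∧
      ∀ v ∈ T, cdeg * d ≤ (G.neighborSet v).ncard) (b := fun _ => Real.exp (-(6 * n))) (by
    intro T
    by_cases hT : n / d < (T.card : ℝ)
    · refine (le_trans ?_ (measure_forall_high_degree_le hc hd hdn T)).trans ?_
      · exact measureReal_mono fun G hG => hG.2
      · rw [Real.exp_le_exp]
        rw [div_lt_iff₀ (by linarith)] at hT
        linarith
    · have : {G : SimpleGraph (Fin n) | n / d < (T.card : ℝ) ∧
          ∀ v ∈ T, cdeg * d ≤ (G.neighborSet v).ncard} = ∅ := by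
        ext G; simp [hT]
      rw [this]; simp [Real.exp_nonneg])
  refine (measureReal_mono ?_).trans (h1.trans ?_)
  · intro G hG
    exact ⟨_, hG, fun v hv => by simpa [lowDegree] using hv⟩
  · simp only [Finset.sum_const, Finset.card_univ, Fintype.card_finset, Fintype.card_fin,
      nsmul_eq_mul]
    push_cast
    have h2 : (2:ℝ) ^ n ≤ Real.exp n := by
      rw [← Real.exp_one_pow]
      exact pow_le_pow_left₀ (by norm_num) (by have := Real.exp_one_gt_d9; linarith) _
    calc (2:ℝ) ^ n * Real.exp (-(6 * n)) ≤ Real.exp n * Real.exp (-(6 * n)) := by gcongr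
      _ = Real.exp (-5 * n) := by rw [← Real.exp_add]; ring_nf
      _ ≤ _ := by rw [Real.exp_le_exp]; linarith

/-! ### Light couples -/

open Classical in
/-- The weight of a couple of vertices of `U` with product at most `√d`. -/
def lightWeight (d : ℝ) (k : Fin n → ℤ) (U : Finset (Fin n)) (u v : Fin n) : ℝ :=
  if u ∈ U ∧ v ∈ U ∧ |(k u * k v : ℝ)| ≤ √d then k u * k v else 0

open Classical in
/-- The contribution of the light couples is concentrated, for all integer vectors of squared norm at
most `64 n` and all vertex sets. -/
def LightBound (d : ℝ) (G : SimpleGraph (Fin n)) : Prop :=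
  ∀ k : Fin n → ℤ, ∑ u, (k u : ℝ) ^ 2 ≤ 64 * n → ∀ U : Finset (Fin n),
    |∑ u, ∑ v, (if G.Adj u v then lightWeight d k U u v else 0) -
      d / n * ∑ u, ∑ v, (if u ≠ v then lightWeight d k U u v else 0)| ≤ 4236 * √d * n

open Classical in
-- With the tilt 1/√d a light couple has exponent at most 1 in absolute value, so e^y ≤ 1 + y + y².
-- The quadratic term costs (d/n)(64n)²/d = 4096 n, and 4236 = 4096 + 2 · 70. The rate 70 n has to
-- beat the e^(66n) vectors and 2^n sets of the union bound.
lemma measure_light_deviation_le (hd : 1 < d) (hdn : d ≤ n) {k : Fin n → ℤ}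
    (hk : ∑ u, (k u : ℝ) ^ 2 ≤ 64 * n) (U : Finset (Fin n)) {ε : ℝ} (hε : ε ^ 2 = 1) :
    (sparseGraph d n).real {G | 4236 * √d * n ≤
      ε * (∑ u, ∑ v, (if G.Adj u v then lightWeight d k U u v else 0) -
      d / n * ∑ u, ∑ v, (if u ≠ v then lightWeight d k U u v else 0))} ≤ Real.exp (-(70 * n)) := by
  have hn : (0:ℝ) < n := by linarith
  have hsd : 0 < √d := Real.sqrt_pos.2 (by linarith)
  have hsq : √d ^ 2 = d := Real.sq_sqrt (by linarith)
  set w := lightWeight d k U with hw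
  have hwsymm : ∀ u v, w u v = w v u := fun u v => by
    simp only [hw, lightWeight, mul_comm (k u : ℝ), and_left_comm]
  have habs : ∀ u v, |ε * w u v / √d| ≤ 1 := by
    intro u v
    have hε' : |ε| = 1 := by
      rcases sq_eq_one_iff.1 hε with h | h <;> simp [h]
    rw [abs_div, abs_mul, hε', one_mul, abs_of_pos hsd, div_le_one hsd]
    simp only [hw, lightWeight]
    split_ifs with h
    · exact h.2.2
    · simp
  have hsqle : ∑ u, ∑ v, (ε * w u v / √d) ^ 2 ≤ 4096 * n ^ 2 / d := by
    have h1 : ∀ u v, (ε * w u v / √d) ^ 2 ≤ (k u : ℝ) ^ 2 * (k v : ℝ) ^ 2 / d := by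
      intro u v
      rw [div_pow, mul_pow, hε, one_mul, hsq]
      refine div_le_div_of_nonneg_right ?_ (by linarith)
      simp only [hw, lightWeight]
      split_ifs
      · rw [mul_pow]
      · rw [zero_pow two_ne_zero]; positivity
    calc _ ≤ ∑ u, ∑ v, (k u : ℝ) ^ 2 * (k v : ℝ) ^ 2 / d :=
          Finset.sum_le_sum fun u _ => Finset.sum_le_sum fun v _ => h1 u v
      _ = (∑ u, (k u : ℝ) ^ 2) ^ 2 / d := by
          simp only [← Finset.sum_div, ← Finset.mul_sum, ← Finset.sum_mul, sq (∑ u, _)]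
      _ ≤ (64 * n) ^ 2 / d := by
          gcongr
      _ = _ := by ring
  have hmean : ∑ u, ∑ v, (if u ≠ v then ε * w u v / √d else 0) =
      ε / √d * ∑ u, ∑ v, (if u ≠ v then w u v else 0) := by
    simp only [Finset.mul_sum]
    refine Finset.sum_congr rfl fun u _ => Finset.sum_congr rfl fun v _ => ?_
    split_ifs <;> ring
  refine sparseGraph_chernoff (K := d / n * (ε / √d * ∑ u, ∑ v, (if u ≠ v then w u v else 0)) +
    4096 * n) (fun u v => ε * w u v / √d) (fun u v => by rw [hwsymm]) ?_ ?_
  · rw [edgeProb_eq (by linarith) hdn]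
    have h1 : ∑ u, ∑ v, (if u ≠ v then Real.exp (ε * w u v / √d) - 1 else 0) ≤
        ∑ u, ∑ v, (if u ≠ v then ε * w u v / √d else 0) + 4096 * n ^ 2 / d := by
      refine le_trans ?_ (add_le_add_right hsqle _)
      simp only [← Finset.sum_add_distrib]
      refine Finset.sum_le_sum fun u _ => Finset.sum_le_sum fun v _ => ?_
      split_ifs
      · have := Real.abs_exp_sub_one_sub_id_le (habs u v)
        have := le_abs_self (Real.exp (ε * w u v / √d) - 1 - ε * w u v / √d)
        linarith
      · positivity
    refine (mul_le_mul_of_nonneg_left h1 (by positivity)).trans (le_of_eq ?_)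
    rw [hmean, mul_add]
    congr 1
    field_simp
  · intro G hG
    simp only [Set.mem_ofPred_eq] at hG
    have h1 : ∑ u, ∑ v, (if G.Adj u v then ε * w u v / √d else 0) =
        ε / √d * ∑ u, ∑ v, (if G.Adj u v then w u v else 0) := by
      simp only [Finset.mul_sum]
      refine Finset.sum_congr rfl fun u _ => Finset.sum_congr rfl fun v _ => ?_
      split_ifs <;> ring
    rw [h1]
    have h2 : 4236 * n ≤ ε * (∑ u, ∑ v, (if G.Adj u v then w u v else 0) -
      d / n * ∑ u, ∑ v, (if u ≠ v then w u v else 0)) / √d := by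
      rw [le_div_iff₀ hsd]; linarith
    have h3 : ε * (∑ u, ∑ v, (if G.Adj u v then w u v else 0) -
      d / n * ∑ u, ∑ v, (if u ≠ v then w u v else 0)) / √d =
      ε / √d * ∑ u, ∑ v, (if G.Adj u v then w u v else 0) -
      d / n * (ε / √d * ∑ u, ∑ v, (if u ≠ v then w u v else 0)) := by ring
    linarith

lemma sum_Icc_half_pow_le (N : ℕ) :
    ∑ j ∈ Finset.Icc (-(N : ℤ)) N, (1 / 2 : ℝ) ^ j.natAbs ≤ 4 := by
  rw [← Finset.sum_fiberwise_of_maps_to (g := Int.natAbs) (t := Finset.range (N + 1))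
    (fun j hj => by rw [Finset.mem_Icc] at hj; rw [Finset.mem_range]; omega)]
  calc _ ≤ ∑ i ∈ Finset.range (N + 1), 2 * (1 / 2 : ℝ) ^ i := by
        refine Finset.sum_le_sum fun i _ => ?_
        rw [Finset.sum_congr rfl (g := fun _ => (1 / 2 : ℝ) ^ i)
          (fun j hj => by rw [(Finset.mem_filter.1 hj).2]), Finset.sum_const, nsmul_eq_mul]
        gcongr
        have : Finset.filter (fun j => Int.natAbs j = i) (Finset.Icc (-(N : ℤ)) N) ⊆
            {(i : ℤ), -(i : ℤ)} := by
          intro j hj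
          have := (Finset.mem_filter.1 hj).2
          simp only [Finset.mem_insert, Finset.mem_singleton]
          omega
        exact_mod_cast (Finset.card_le_card this).trans Finset.card_le_two
    _ ≤ 2 * ∑' i : ℕ, (1 / 2 : ℝ) ^ i := by
        rw [← Finset.mul_sum]
        gcongr
        exact summable_geometric_two.sum_le_tsum _ fun i _ => by positivity
    _ = 4 := by rw [tsum_geometric_two]; norm_num

/-- The integer vectors of squared norm at most `64 n`. -/
def intNet (n : ℕ) : Finset (Fin n → ℤ) :=
  (Fintype.piFinset fun _ => Finset.Icc (-((64 * n : ℕ) : ℤ)) ((64 * n : ℕ) : ℤ)).filter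
    fun k => ∑ u, k u ^ 2 ≤ 64 * n

lemma mem_intNet {k : Fin n → ℤ} (hk : ∑ u, (k u : ℝ) ^ 2 ≤ 64 * n) : k ∈ intNet n := by
  have hk' : ∑ u, k u ^ 2 ≤ 64 * n := by exact_mod_cast hk
  refine Finset.mem_filter.2 ⟨Fintype.mem_piFinset.2 fun u => ?_, hk'⟩
  have h1 : k u ^ 2 ≤ 64 * n :=
    (Finset.single_le_sum (f := fun u => k u ^ 2) (fun v _ => sq_nonneg _) (Finset.mem_univ u)).trans hk'
  rw [Finset.mem_Icc]
  push_cast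
  have h2 := Int.le_self_sq (k u)
  have h3 := Int.le_self_sq (-k u)
  rw [neg_sq] at h3
  constructor <;> linarith

/-- A vector of the net satisfies 1 ≤ e^(64n) ∏ e^(-k_u²) ≤ e^(64n) ∏ 2^(-|k_u|). Summed over all
vectors, the product factors into n sums, each at most 4 ≤ e². -/
lemma card_intNet_le : ((intNet n).card : ℝ) ≤ Real.exp (66 * n) := by
  set I := Finset.Icc (-((64 * n : ℕ) : ℤ)) ((64 * n : ℕ) : ℤ)
  have h1 : ((intNet n).card : ℝ) ≤
      ∑ k ∈ Fintype.piFinset fun _ : Fin n => I, Real.exp (64 * n) * ∏ u, (1 / 2 : ℝ) ^ (k u).natAbs := by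
    rw [Finset.card_eq_sum_ones, Nat.cast_sum, intNet, Finset.sum_filter]
    refine Finset.sum_le_sum fun k _ => ?_
    split_ifs with h
    · have h2 : ∏ u, Real.exp (-((k u : ℝ) ^ 2)) ≤ ∏ u, (1 / 2 : ℝ) ^ (k u).natAbs := by
        refine Finset.prod_le_prod (fun u _ => (Real.exp_pos _).le) fun u _ => ?_
        have h3 : Real.exp (-1) ≤ 1 / 2 := by
          rw [Real.exp_neg, one_div]
          gcongr
          have := Real.exp_one_gt_d9; linarith
        calc Real.exp (-((k u : ℝ) ^ 2)) ≤ Real.exp ((k u).natAbs * (-1)) := by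
              rw [Real.exp_le_exp]
              have h4 : |k u| ≤ k u ^ 2 := by rw [← sq_abs]; exact Int.le_self_sq _
              have h5 : |(k u : ℝ)| ≤ (k u : ℝ) ^ 2 := by exact_mod_cast h4
              rw [Nat.cast_natAbs, Int.cast_abs]
              linarith
          _ = Real.exp (-1) ^ (k u).natAbs := Real.exp_nat_mul _ _
          _ ≤ _ := by gcongr
      rw [← Real.exp_sum] at h2
      have h4 : (1:ℝ) ≤ Real.exp (64 * n) * Real.exp (∑ u, -((k u : ℝ) ^ 2)) := by
        rw [← Real.exp_add, Real.one_le_exp_iff, Finset.sum_neg_distrib]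
        have : ∑ u, (k u : ℝ) ^ 2 ≤ 64 * n := by exact_mod_cast h
        linarith
      have h5 := mul_le_mul_of_nonneg_left h2 (Real.exp_pos (64 * (n:ℝ))).le
      push_cast
      linarith
    · positivity
  refine h1.trans ?_
  rw [← Finset.mul_sum, ← Finset.prod_univ_sum (fun _ : Fin n => I) (fun _ j => (1 / 2 : ℝ) ^ j.natAbs),
    Finset.prod_const, Finset.card_univ, Fintype.card_fin]
  have h6 : (4:ℝ) ≤ Real.exp 2 := by
    have : Real.exp 2 = Real.exp 1 ^ 2 := by rw [← Real.exp_nat_mul]; norm_num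
    rw [this]
    have h1 := Real.exp_one_gt_d9
    nlinarith
  calc _ ≤ Real.exp (64 * n) * Real.exp 2 ^ n := by
        gcongr
        exact (sum_Icc_half_pow_le (64 * n)).trans h6
    _ = Real.exp (66 * n) := by rw [← Real.exp_nat_mul, ← Real.exp_add]; ring_nf

lemma measure_not_lightBound_le (hd : 1 < d) (hdn : d ≤ n) :
    (sparseGraph d n).real {G | ¬ LightBound d G} ≤ Real.exp (-n) := by
  classical
  have hn : (1:ℝ) ≤ n := by linarith
  have h1 := measureReal_exists_le (d := d) (n := n)
    -- The Boolean records the sign of the deviation.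
    (ι := intNet n × Finset (Fin n) × Bool)
    (fun i G => ∑ u, (i.1.1 u : ℝ) ^ 2 ≤ 64 * n ∧ 4236 * √d * n ≤
      (if i.2.2 then 1 else -1) *
      (∑ u, ∑ v, (if G.Adj u v then lightWeight d i.1.1 i.2.1 u v else 0) -
      d / n * ∑ u, ∑ v, (if u ≠ v then lightWeight d i.1.1 i.2.1 u v else 0)))
    (b := fun _ => Real.exp (-(70 * n))) (by
    rintro ⟨k, U, b⟩
    by_cases hk : ∑ u, (k.1 u : ℝ) ^ 2 ≤ 64 * n
    · refine (measureReal_mono ?_).trans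
        (measure_light_deviation_le hd hdn hk U (ε := if b then 1 else -1) (by split_ifs <;> norm_num))
      exact fun G hG => hG.2
    · have : ∀ P : SimpleGraph (Fin n) → Prop, {G | ∑ u, (k.1 u : ℝ) ^ 2 ≤ 64 * n ∧ P G} = ∅ := by
        intro P; ext G; simp [hk]
      rw [this]; simp [Real.exp_nonneg])
  refine (measureReal_mono ?_).trans (h1.trans ?_)
  · intro G hG
    simp only [Set.mem_ofPred_eq, LightBound, not_forall, not_le] at hG
    obtain ⟨k, hk, U, hU⟩ := hG
    rcases lt_abs.1 hU with h | h
    · exact ⟨⟨⟨k, mem_intNet hk⟩, U, true⟩, hk, by simpa using h.le⟩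
    · exact ⟨⟨⟨k, mem_intNet hk⟩, U, false⟩, hk, by simpa using h.le⟩
  · simp only [Finset.sum_const, Finset.card_univ, Fintype.card_prod, Fintype.card_finset,
      Fintype.card_fin, Fintype.card_bool, Fintype.card_coe, nsmul_eq_mul]
    push_cast
    have h2 : (2:ℝ) ≤ Real.exp 1 := by have := Real.exp_one_gt_d9; linarith
    have h3 : (2:ℝ) ^ n ≤ Real.exp n := by
      rw [← Real.exp_one_pow]
      exact pow_le_pow_left₀ (by norm_num) h2 _
    calc _ ≤ Real.exp (66 * n) * (Real.exp n * Real.exp 1) * Real.exp (-(70 * n)) := by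
          gcongr
          exact card_intNet_le
      _ = Real.exp (1 - 3 * n) := by
          rw [← Real.exp_add, ← Real.exp_add, ← Real.exp_add]; ring_nf
      _ ≤ _ := by rw [Real.exp_le_exp]; linarith
end

section
variable {d : ℝ} {n : ℕ}

/-! ### Discrepancy -/

open Classical in
/-- The number of ordered pairs in `S × T` joined by an edge. -/
def edgeCount (G : SimpleGraph (Fin n)) (S T : Finset (Fin n)) : ℝ :=
  ∑ u, ∑ v, if G.Adj u v ∧ u ∈ S ∧ v ∈ T then 1 else 0

/-- The entropy cost of a set at dyadic level `s`. -/
def levelCost (n : ℕ) (s : ℕ) (S : Finset (Fin n)) : ℝ :=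
  s * Real.log 8 * S.card + n * (1 / 8) ^ s

/-- The tilt used for sets at dyadic levels `s` and `t`. -/
def tilt (d : ℝ) (s t : ℕ) : ℝ := 1 + Real.log (4 * 2 ^ s * 2 ^ t / √d)

/-- No two vertex sets have many more edges between them than expected. -/
def Discrepancy (d x : ℝ) (G : SimpleGraph (Fin n)) : Prop :=
  ∀ s ≤ 64 * n, ∀ t ≤ 64 * n, ∀ S T : Finset (Fin n),
    tilt d s t * edgeCount G S T ≤
      d / n * S.card * T.card * (Real.exp 1 * (4 * 2 ^ s * 2 ^ t / √d)) +
        2 * (levelCost n s S + levelCost n t T + x)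

lemma exp_tilt (hd : 0 < d) (s t : ℕ) :
    Real.exp (tilt d s t) = Real.exp 1 * (4 * 2 ^ s * 2 ^ t / √d) := by
  have := Real.sqrt_pos.2 hd
  rw [tilt, Real.exp_add, Real.exp_log (by positivity)]

lemma measure_edgeCount_large_le (hd : 1 < d) (hdn : d ≤ n) (θ x : ℝ) (S T : Finset (Fin n)) :
    (sparseGraph d n).real {G | d / n * S.card * T.card * Real.exp θ + 2 * x ≤
      θ * edgeCount G S T} ≤ Real.exp (-x) := by
  classical
  have hn : (0:ℝ) < n := by linarith
  set i : Fin n → Fin n → ℝ := fun u v => if u ∈ S ∧ v ∈ T then 1 else 0 with hi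
  have hisum : ∑ u, ∑ v, i u v = S.card * T.card := by
    have : ∀ u v, i u v = (if u ∈ S then 1 else 0) * (if v ∈ T then 1 else 0) := by
      intro u v; simp only [hi]; split_ifs <;> simp_all
    simp [this]
  have hisum' : ∑ u, ∑ v, i v u = S.card * T.card := by rw [Finset.sum_comm, hisum]
  refine sparseGraph_chernoff (K := d / n * S.card * T.card * Real.exp θ)
    (fun u v => θ / 2 * (i u v + i v u)) (fun u v => by rw [add_comm]) ?_ ?_
  · rw [edgeProb_eq (by linarith) hdn]
    have h1 : ∑ u, ∑ v, (if u ≠ v then Real.exp (θ / 2 * (i u v + i v u)) - 1 else 0) ≤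
        ∑ u, ∑ v, Real.exp θ / 2 * (i u v + i v u) := by
      refine Finset.sum_le_sum fun u _ => Finset.sum_le_sum fun v _ => ?_
      have h0 : ∀ u v, 0 ≤ i u v := fun u v => by simp only [hi]; split_ifs <;> norm_num
      -- A couple that lies in S × T in only one order carries θ/2 instead of θ; this inequality
      -- makes its cost half of e^θ.
      have h2 : Real.exp (θ / 2) - 1 ≤ Real.exp θ / 2 := by
        have : Real.exp θ = Real.exp (θ / 2) ^ 2 := by rw [← Real.exp_nat_mul]; ring_nf
        rw [this]; nlinarith [sq_nonneg (Real.exp (θ / 2) - 1)]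
      split_ifs
      · have e1 : i u v = 1 ∨ i u v = 0 := by simp only [hi]; split_ifs <;> simp
        have e2 : i v u = 1 ∨ i v u = 0 := by simp only [hi]; split_ifs <;> simp
        have := Real.exp_pos θ
        rcases e1 with e1 | e1 <;> rcases e2 with e2 | e2 <;> rw [e1, e2] <;> ring_nf at h2 ⊢ <;>
          simp <;> linarith
      · have := h0 u v; have := h0 v u; positivity
    refine (mul_le_mul_of_nonneg_left h1 (by positivity)).trans (le_of_eq ?_)
    simp only [← Finset.mul_sum, Finset.sum_add_distrib, hisum, hisum']
    ring
  · intro G hG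
    have h1 : ∑ u, ∑ v, (if G.Adj u v then θ / 2 * (i u v + i v u) else 0) =
        θ * edgeCount G S T := by
      have e1 : edgeCount G S T = ∑ u, ∑ v, if G.Adj u v then i u v else 0 := by
        simp only [edgeCount, hi, ite_and]
      have e2 : edgeCount G S T = ∑ u, ∑ v, if G.Adj u v then i v u else 0 := by
        rw [e1, Finset.sum_comm]; simp only [G.adj_comm]
      have : θ * edgeCount G S T = θ / 2 * edgeCount G S T + θ / 2 * edgeCount G S T := by ring
      rw [this]
      nth_rewrite 1 [e1]
      rw [e2]
      simp only [Finset.mul_sum, ← Finset.sum_add_distrib]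
      refine Finset.sum_congr rfl fun u _ => Finset.sum_congr rfl fun v _ => ?_
      split_ifs <;> ring
    rw [h1]; exact hG

/-- The cost is designed for this: the sum of 8^(-s|S|) over all S is (1 + 8^(-s))^n ≤ exp(n
8^(-s)). In the union bound for `Discrepancy` the choice of S and T is thus free, and only the
number of pairs of levels is paid for. -/
lemma sum_exp_neg_levelCost_le (s : ℕ) :
    ∑ S : Finset (Fin n), Real.exp (-levelCost n s S) ≤ 1 := by
  have h1 : ∀ S : Finset (Fin n), Real.exp (-levelCost n s S) =
      Real.exp (-(n * (1 / 8) ^ s)) * ((1 / 8 : ℝ) ^ s) ^ S.card := by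
    intro S
    rw [levelCost, neg_add_rev, Real.exp_add]
    congr 1
    have : (1 / 8 : ℝ) ^ s = Real.exp (-(s * Real.log 8)) := by
      rw [Real.exp_neg, Real.exp_nat_mul, Real.exp_log (by norm_num), one_div, inv_pow]
    rw [this, ← Real.exp_nat_mul]
    ring_nf
  simp only [h1]
  rw [← Finset.mul_sum]
  have h2 := sum_powerset_pow_le (V := Fin n) (r := (1 / 8 : ℝ) ^ s) (by positivity)
  rw [Fintype.card_fin] at h2
  calc _ ≤ Real.exp (-(n * (1 / 8) ^ s)) * Real.exp (n * (1 / 8 : ℝ) ^ s) := by gcongr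
    _ = 1 := by rw [← Real.exp_add]; simp

lemma measure_not_discrepancy_le (hd : 1 < d) (hdn : d ≤ n) (x : ℝ) :
    (sparseGraph d n).real {G | ¬ Discrepancy d x G} ≤ (64 * n + 1) ^ 2 * Real.exp (-x) := by
  have h1 := measureReal_exists_le (d := d) (n := n)
    (ι := (Fin (64 * n + 1) × Fin (64 * n + 1)) × Finset (Fin n) × Finset (Fin n))
    (fun i G => d / n * i.2.1.card * i.2.2.card * Real.exp (tilt d i.1.1 i.1.2) +
      2 * (levelCost n i.1.1 i.2.1 + levelCost n i.1.2 i.2.2 + x) ≤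
        tilt d i.1.1 i.1.2 * edgeCount G i.2.1 i.2.2)
    (fun i => measure_edgeCount_large_le hd hdn _ _ _ _)
  refine (measureReal_mono ?_).trans (h1.trans ?_)
  · intro G hG
    simp only [Set.mem_ofPred_eq, Discrepancy, not_forall, not_le] at hG
    obtain ⟨s, hs, t, ht, S, T, h⟩ := hG
    refine ⟨⟨⟨⟨s, by omega⟩, ⟨t, by omega⟩⟩, S, T⟩, ?_⟩
    simp only
    rw [exp_tilt (by linarith)]
    exact h.le
  · rw [Fintype.sum_prod_type]
    have h2 : ∀ i : Fin (64 * n + 1) × Fin (64 * n + 1),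
        ∑ y : Finset (Fin n) × Finset (Fin n),
          Real.exp (-(levelCost n i.1 y.1 + levelCost n i.2 y.2 + x)) ≤ Real.exp (-x) := by
      intro i
      rw [Fintype.sum_prod_type]
      have : ∀ S T : Finset (Fin n), Real.exp (-(levelCost n i.1 S + levelCost n i.2 T + x)) =
          Real.exp (-x) * Real.exp (-levelCost n i.1 S) * Real.exp (-levelCost n i.2 T) := by
        intro S T; rw [← Real.exp_add, ← Real.exp_add]; ring_nf
      simp only [this, ← Finset.mul_sum, ← Finset.sum_mul]
      calc _ ≤ Real.exp (-x) * 1 * 1 := by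
            gcongr
            · exact sum_exp_neg_levelCost_le _
            · exact sum_exp_neg_levelCost_le _
        _ = _ := by ring
    refine (Finset.sum_le_sum fun i _ => h2 i).trans (le_of_eq ?_)
    simp
    ring

/-! ### Local sparsity holds with high probability -/

open Classical in
-- The tilt n^(3/4) on edges inside W keeps the exponential mean below |W|, since d/n · |W|² ·
-- n^(3/4) ≤ d n^(-1/8) |W|. Inner degrees of at least 3 give edge weight 3θ|W|. The resulting
-- probability per vertex, of order n^(-9/8), beats the n choices of that vertex.
lemma measure_inner_degree_le (hd : 1 < d) (hdn : d ≤ n)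
    (hlarge : d * (n : ℝ) ^ (-(1 / 8) : ℝ) ≤ 1) {W : Finset (Fin n)}
    (hW : (W.card : ℝ) ≤ (n : ℝ) ^ (1 / 8 : ℝ)) :
    (sparseGraph d n).real {G | ∀ v ∈ W, 3 ≤ (W.filter (G.Adj v)).card} ≤
      (Real.exp (1 / 2) * (n : ℝ) ^ (-(9 / 8) : ℝ)) ^ W.card := by
  have hn : (0:ℝ) < n := by linarith
  set θ := 3 / 4 * Real.log n with hθ
  have hθe : Real.exp θ = (n : ℝ) ^ (3 / 4 : ℝ) := by
    rw [Real.rpow_def_of_pos hn, hθ, mul_comm]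
  have hx : (Real.exp (1 / 2) * (n : ℝ) ^ (-(9 / 8) : ℝ)) ^ W.card =
      Real.exp (-(W.card * (3 / 2 * θ - 1 / 2))) := by
    rw [Real.rpow_def_of_pos hn, ← Real.exp_add, ← Real.exp_nat_mul]
    congr 1; rw [hθ]; ring
  rw [hx]
  have hθ0 : 0 ≤ θ := by
    have : 0 ≤ Real.log n := Real.log_nonneg (by linarith)
    positivity
  set i : Fin n → Fin n → ℝ := fun u v => if u ∈ W ∧ v ∈ W then θ else 0 with hi
  refine sparseGraph_chernoff (K := W.card) i
    (fun u v => by simp only [hi, and_comm]) ?_ ?_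
  · rw [edgeProb_eq (by linarith) hdn]
    have h1 : ∑ u, ∑ v, (if u ≠ v then Real.exp (i u v) - 1 else 0) ≤
        ∑ u, ∑ v, (if u ∈ W then 1 else 0) * (if v ∈ W then 1 else 0) * Real.exp θ := by
      refine Finset.sum_le_sum fun u _ => Finset.sum_le_sum fun v _ => ?_
      simp only [hi]
      have := Real.exp_pos θ
      split_ifs <;> simp_all <;> linarith
    refine (mul_le_mul_of_nonneg_left h1 (by positivity)).trans ?_
    have h2 : ∑ u : Fin n, ∑ v : Fin n, (if u ∈ W then (1:ℝ) else 0) * (if v ∈ W then 1 else 0) * Real.exp θ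
        = W.card * W.card * Real.exp θ := by
      simp only [← Finset.mul_sum, ← Finset.sum_mul]
      simp
    rw [h2, hθe]
    calc d / n * (W.card * W.card * (n : ℝ) ^ (3 / 4 : ℝ))
        ≤ d / n * (W.card * (n : ℝ) ^ (1 / 8 : ℝ) * (n : ℝ) ^ (3 / 4 : ℝ)) := by gcongr
      _ = (d * (n : ℝ) ^ (-(1 / 8) : ℝ)) * W.card := by
          have : (n : ℝ) ^ (-(1 / 8) : ℝ) = (n : ℝ) ^ (1 / 8 : ℝ) * (n : ℝ) ^ (3 / 4 : ℝ) / n := by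
            rw [← Real.rpow_add hn, ← Real.rpow_sub_one hn.ne']; norm_num
          rw [this]; ring
      _ ≤ 1 * W.card := by gcongr
      _ = _ := one_mul _
  · intro G hG
    have h1 : ∑ u, ∑ v, (if G.Adj u v then i u v else 0) =
        ∑ u ∈ W, θ * ((W.filter (G.Adj u)).card : ℝ) := by
      rw [← Finset.sum_filter_add_sum_filter_not Finset.univ (· ∈ W)]
      have e2 : ∑ u ∈ Finset.univ.filter (· ∉ W), ∑ v, (if G.Adj u v then i u v else 0) = 0 := by
        refine Finset.sum_eq_zero fun u hu => Finset.sum_eq_zero fun v _ => ?_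
        simp [hi, (Finset.mem_filter.1 hu).2]
      rw [e2, add_zero]
      refine Finset.sum_congr (by ext; simp) fun u hu => ?_
      rw [Finset.card_filter, Nat.cast_sum, Finset.mul_sum]
      rw [← Finset.sum_filter_add_sum_filter_not Finset.univ (· ∈ W)]
      have e3 : ∑ v ∈ Finset.univ.filter (· ∉ W), (if G.Adj u v then i u v else 0) = 0 := by
        refine Finset.sum_eq_zero fun v hv => ?_
        simp [hi, (Finset.mem_filter.1 hv).2]
      rw [e3, add_zero]
      refine Finset.sum_congr (by ext; simp) fun v hv => ?_
      simp [hi, hu, hv]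
    rw [h1]
    have h2 : ∑ u ∈ W, θ * 3 ≤ ∑ u ∈ W, θ * ((W.filter (G.Adj u)).card : ℝ) := by
      refine Finset.sum_le_sum fun u hu => ?_
      have : (3:ℝ) ≤ ((W.filter (G.Adj u)).card : ℝ) := by exact_mod_cast hG u hu
      gcongr
    rw [Finset.sum_const, nsmul_eq_mul] at h2
    linarith

lemma measure_not_locallySparse_le (hd : 1 < d) (hdn : d ≤ n)
    (hlarge : d * (n : ℝ) ^ (-(1 / 8) : ℝ) ≤ 1) :
    (sparseGraph d n).real {G | ¬ LocallySparse ((n : ℝ) ^ (1 / 8 : ℝ)) G} ≤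
      Real.exp (Real.exp (1 / 2) * (n : ℝ) ^ (-(1 / 8) : ℝ)) - 1 := by
  classical
  have hn : (0:ℝ) < n := by linarith
  set r := Real.exp (1 / 2) * (n : ℝ) ^ (-(9 / 8) : ℝ) with hr
  have hr0 : 0 ≤ r := by positivity
  have h1 := measureReal_exists_le (d := d) (n := n)
    (fun (W : Finset (Fin n)) G => (W.Nonempty ∧ (W.card : ℝ) ≤ (n : ℝ) ^ (1 / 8 : ℝ)) ∧
      ∀ v ∈ W, 3 ≤ (W.filter (G.Adj v)).card)
    (b := fun W => if W = ∅ then 0 else r ^ W.card) (by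
    intro W
    by_cases hW : W.Nonempty ∧ (W.card : ℝ) ≤ (n : ℝ) ^ (1 / 8 : ℝ)
    · rw [if_neg hW.1.ne_empty]
      exact (measureReal_mono fun G hG => hG.2).trans (measure_inner_degree_le hd hdn hlarge hW.2)
    · have : ∀ P : SimpleGraph (Fin n) → Prop, {G | (W.Nonempty ∧ (W.card : ℝ) ≤
          (n : ℝ) ^ (1 / 8 : ℝ)) ∧ P G} = ∅ := by
        intro P; ext G; simp only [hW, false_and]; simp
      rw [this]
      simp only [measureReal_empty]
      split_ifs <;> positivity)
  refine (measureReal_mono ?_).trans (h1.trans ?_)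
  · intro G hG
    simp only [Set.mem_ofPred_eq, LocallySparse, not_forall] at hG
    obtain ⟨W, hW, hc, h⟩ := hG
    push Not at h
    refine ⟨W, ⟨hW, hc⟩, fun v hv => ?_⟩
    have := h v hv
    rw [Nat.succ_le_iff]
    convert this
  · have h2 : ∑ W : Finset (Fin n), (if W = ∅ then 0 else r ^ W.card) =
        ∑ W : Finset (Fin n), r ^ W.card - 1 := by
      rw [eq_sub_iff_add_eq]
      have : (1:ℝ) = ∑ W : Finset (Fin n), if W = ∅ then 1 else 0 := by simp
      rw [this, ← Finset.sum_add_distrib]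
      refine Finset.sum_congr rfl fun W _ => ?_
      split_ifs with h
      · simp [h]
      · simp
    rw [h2]
    have h3 := sum_powerset_pow_le (V := Fin n) hr0
    rw [Fintype.card_fin] at h3
    have h4 : (n : ℝ) * r = Real.exp (1 / 2) * (n : ℝ) ^ (-(1 / 8) : ℝ) := by
      have : (n : ℝ) ^ (-(1 / 8) : ℝ) = n * (n : ℝ) ^ (-(9 / 8) : ℝ) := by
        nth_rewrite 2 [← Real.rpow_one (n : ℝ)]
        rw [← Real.rpow_add hn]; norm_num
      rw [this, hr]; ring
    rw [h4] at h3
    linarith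

end

/-! ### Quadratic forms of locally sparse graphs -/

open Classical in
-- Induction along a degeneracy order: a vertex v with at most two neighbours in W is removed. Each
-- edge vu at it satisfies 2 a_v a_u ≤ τ a_v² + a_u²/τ, so v is charged 2τ a_v² only once, at its
-- removal, and the remainder goes into the edge sum divided by τ.
lemma LocallySparse.sum_sum_adj_le {V : Type*} {G : SimpleGraph V} {m τ : ℝ}
    (h : LocallySparse m G) (hτ : 0 < τ) (a : V → ℝ) (W : Finset V) (hW : (W.card : ℝ) ≤ m) :
    ∑ u ∈ W, ∑ v ∈ W, (if G.Adj u v then a u * a v else 0) ≤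
      2 * τ * ∑ u ∈ W, a u ^ 2 + (∑ u ∈ W, ∑ v ∈ W, if G.Adj u v then a u ^ 2 else 0) / τ := by
  induction W using Finset.strongInduction with
  | H W ih =>
  rcases W.eq_empty_or_nonempty with rfl | hne
  · simp
  obtain ⟨v, hv, hdeg⟩ := h W hne hW
  set W' := W.erase v with hW'
  have hvW' : v ∉ W' := Finset.notMem_erase v W
  have hins : W = insert v W' := (Finset.insert_erase hv).symm
  have ihW := ih W' (Finset.erase_ssubset hv)
    (le_trans (by exact_mod_cast Finset.card_le_card (Finset.erase_subset v W)) hW)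
  have hsplit : ∀ g : V → V → ℝ, g v v = 0 → ∑ u ∈ W, ∑ w ∈ W, g u w =
      ∑ u ∈ W', ∑ w ∈ W', g u w + ∑ u ∈ W', (g v u + g u v) := by
    intro g hg
    rw [hins, Finset.sum_insert hvW', Finset.sum_insert hvW', hg]
    simp only [Finset.sum_insert hvW', Finset.sum_add_distrib]
    ring
  rw [hsplit _ (by simp), hsplit _ (by simp)]
  have hsq : ∑ u ∈ W, a u ^ 2 = a v ^ 2 + ∑ u ∈ W', a u ^ 2 := by
    rw [hins, Finset.sum_insert hvW']
  rw [hsq]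
  have hcount : ∑ u ∈ W', (if G.Adj v u then (1:ℝ) else 0) ≤ 2 := by
    rw [Finset.sum_boole]
    exact_mod_cast (Finset.card_le_card (Finset.filter_subset_filter _ (Finset.erase_subset v W))).trans hdeg
  have hnew : ∑ u ∈ W', ((if G.Adj v u then a v * a u else 0) + if G.Adj u v then a u * a v else 0) ≤
      2 * τ * a v ^ 2 + (∑ u ∈ W', ((if G.Adj v u then a v ^ 2 else 0) +
        if G.Adj u v then a u ^ 2 else 0)) / τ := by
    have h1 : ∀ u ∈ W', ((if G.Adj v u then a v * a u else 0) + if G.Adj u v then a u * a v else 0) ≤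
        τ * a v ^ 2 * (if G.Adj v u then 1 else 0) + ((if G.Adj v u then a v ^ 2 else 0) +
        if G.Adj u v then a u ^ 2 else 0) / τ := by
      intro u _
      simp only [G.adj_comm u v]
      split_ifs
      · have : 2 * (a v * a u) ≤ τ * a v ^ 2 + a u ^ 2 / τ := by
          have h2 : 0 ≤ (τ * a v - a u) ^ 2 / τ := by positivity
          have h3 : (τ * a v - a u) ^ 2 / τ = τ * a v ^ 2 + a u ^ 2 / τ - 2 * (a v * a u) := by
            field_simp; ring
          linarith
        have h4 : 0 ≤ a v ^ 2 / τ := by positivity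
        rw [add_div]; linarith
      · simp
    refine (Finset.sum_le_sum h1).trans ?_
    rw [Finset.sum_add_distrib, ← Finset.mul_sum, ← Finset.sum_div]
    have h5 := mul_le_mul_of_nonneg_left hcount (show 0 ≤ τ * a v ^ 2 by positivity)
    linarith
  rw [add_div]
  linarith

/-! ### Geometric sums over levels -/

lemma sum_pow_le_of_le {r Y : ℝ} (hr : 1 < r) (hY : 0 ≤ Y) (L : ℕ) :
    (r - 1) * ∑ s ∈ Finset.range L, (if r ^ s ≤ Y then r ^ s else 0) ≤ r * Y := by
  -- The second bound is carried along for the step in which r^L is still included: there it gives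
  -- r^(L+1) - 1 ≤ rY.
  have key : (r - 1) * ∑ s ∈ Finset.range L, (if r ^ s ≤ Y then r ^ s else 0) ≤ r * Y ∧
      (r - 1) * ∑ s ∈ Finset.range L, (if r ^ s ≤ Y then r ^ s else 0) ≤ r ^ L - 1 := by
    induction L with
    | zero => simp; nlinarith
    | succ L ih =>
      rw [Finset.sum_range_succ, mul_add]
      have h0 : 0 < r ^ L := by positivity
      have h1 : r ^ (L + 1) = r * r ^ L := pow_succ' r L
      split_ifs with h
      · constructor <;> nlinarith [ih.1, ih.2]
      · constructor <;> nlinarith [ih.1, ih.2]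
  exact key.1

lemma one_add_log_le {w : ℝ} (hw : 0 < w) : 1 + Real.log w ≤ 2 * √w := by
  have h1 := Real.log_le_sub_one_of_pos (Real.sqrt_pos.2 hw)
  rw [Real.log_sqrt hw.le] at h1
  linarith

/-- The levels `(s, t)` for which neither the degree bound nor local sparsity suffices. -/
def MidLevels (d Ω : ℝ) (s t : ℕ) : Prop :=
  √d ≤ 4 * 2 ^ s * 2 ^ t ∧ (2 : ℝ) ^ s ≤ 2 * √d * 2 ^ t ∧ (2 : ℝ) ^ t ≤ 2 * √d * 2 ^ s ∧
    (2 : ℝ) ^ s ≤ Ω ∧ (2 : ℝ) ^ t ≤ Ω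

lemma MidLevels.symm {d Ω : ℝ} {s t : ℕ} (h : MidLevels d Ω s t) : MidLevels d Ω t s :=
  ⟨by linarith [h.1, mul_right_comm (4:ℝ) (2 ^ s) (2 ^ t)], h.2.2.1, h.2.1, h.2.2.2.2, h.2.2.2.1⟩

lemma tilt_symm (d : ℝ) (s t : ℕ) : tilt d s t = tilt d t s := by
  rw [tilt, tilt, mul_right_comm]

lemma MidLevels.one_le_tilt {d Ω : ℝ} {s t : ℕ} (hd : 0 < d) (h : MidLevels d Ω s t) :
    1 ≤ tilt d s t := by
  have : 0 ≤ Real.log (4 * 2 ^ s * 2 ^ t / √d) :=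
    Real.log_nonneg ((one_le_div (Real.sqrt_pos.2 hd)).2 h.1)
  rw [tilt]; linarith

open Classical in
-- Put M = 2√d 2^t, A = log(8 · 4^t) and B = log(M/2^s); then the tilt is 1 + A - B. Being at least
-- 1, it satisfies 1 + A ≤ tilt · (1 + B), and 1 + B ≤ 2√(M/2^s). So the logarithmic loss below the
-- top level 2^s ≈ M only turns the geometric ratio 2 into √2.
lemma sum_two_pow_div_tilt_le {d Ω : ℝ} (hd : 0 < d) (t L : ℕ) :
    ∑ s ∈ Finset.range L, (if MidLevels d Ω s t then 2 ^ s / tilt d s t else 0) ≤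
      14 * √d * 2 ^ t / (1 + Real.log (8 * 4 ^ t)) := by
  have hsd := Real.sqrt_pos.2 hd
  set M := 2 * √d * 2 ^ t with hM
  have hM0 : 0 < M := by positivity
  set A := Real.log (8 * 4 ^ t) with hA
  have h41 : (1:ℝ) ≤ 8 * 4 ^ t := by
    have : (1:ℝ) ≤ 4 ^ t := one_le_pow₀ (by norm_num)
    linarith
  have hA0 : 0 ≤ A := Real.log_nonneg h41
  have hr : 1 < √2 := by
    rw [Real.lt_sqrt (by norm_num)]; norm_num
  have hterm : ∀ s, (if MidLevels d Ω s t then 2 ^ s / tilt d s t else 0) ≤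
      2 * √M / (1 + A) * (if √2 ^ s ≤ √M then √2 ^ s else 0) := by
    intro s
    have hpow : √((2:ℝ) ^ s) = √2 ^ s := by
      rw [Real.sqrt_eq_rpow, Real.sqrt_eq_rpow, ← Real.rpow_natCast, ← Real.rpow_natCast,
        ← Real.rpow_mul (by norm_num), ← Real.rpow_mul (by norm_num), mul_comm]
    by_cases h : MidLevels d Ω s t
    · rw [if_pos h]
      have hle : (2:ℝ) ^ s ≤ M := h.2.1
      rw [if_pos (by rw [← hpow]; exact Real.sqrt_le_sqrt hle)]
      set B := Real.log (M / 2 ^ s) with hB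
      have hB0 : 0 ≤ B := Real.log_nonneg ((one_le_div (by positivity)).2 hle)
      have htilt : tilt d s t = 1 + A - B := by
        have : 4 * 2 ^ s * 2 ^ t / √d = 8 * 4 ^ t / (M / 2 ^ s) := by
          have h4 : (4:ℝ) ^ t = 2 ^ t * 2 ^ t := by rw [← mul_pow]; norm_num
          rw [hM, h4]; field_simp; norm_num
        rw [tilt, this, Real.log_div (by positivity) (by positivity)]
        ring
      have h1 := h.one_le_tilt hd
      have h2 : 1 + B ≤ 2 * √(M / 2 ^ s) := one_add_log_le (by positivity)
      have h3 : 1 + A ≤ tilt d s t * (2 * √(M / 2 ^ s)) := by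
        refine le_trans ?_ (mul_le_mul_of_nonneg_left h2 (by linarith))
        rw [htilt] at h1 ⊢
        nlinarith
      have h5 : (2:ℝ) ^ s * (2 * √(M / 2 ^ s)) = 2 * √M * √2 ^ s := by
        rw [Real.sqrt_div hM0.le, hpow]
        have h6 : (2:ℝ) ^ s = √2 ^ s * √2 ^ s := by
          rw [← mul_pow, Real.mul_self_sqrt (by norm_num)]
        have h7 : 0 < √2 ^ s := by positivity
        rw [h6]; field_simp
      rw [div_mul_eq_mul_div, ← h5, div_le_div_iff₀ (by linarith) (by linarith)]
      nlinarith [pow_pos (show (0:ℝ) < 2 by norm_num) s]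
    · rw [if_neg h]
      split_ifs <;> positivity
  refine (Finset.sum_le_sum fun s _ => hterm s).trans ?_
  rw [← Finset.mul_sum]
  have hg := sum_pow_le_of_le hr (Real.sqrt_nonneg M) L
  set Z := ∑ s ∈ Finset.range L, (if √2 ^ s ≤ √M then √2 ^ s else 0)
  have hS : Z ≤ 7 / 2 * √M := by
    have h2 : √2 ^ 2 = 2 := Real.sq_sqrt (by norm_num)
    have h3 : √2 * Z - Z ≤ √2 * √M := by linarith
    have h4 : (√2 + 1) * (√2 * Z - Z) = Z := by ring_nf; rw [h2]; ring
    have h5 : √2 < 3 / 2 := by rw [Real.sqrt_lt' (by norm_num)]; norm_num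
    have h6 := mul_le_mul_of_nonneg_left h3 (show 0 ≤ √2 + 1 by positivity)
    rw [h4] at h6
    nlinarith [Real.sqrt_nonneg M]
  calc 2 * √M / (1 + A) * Z ≤ 2 * √M / (1 + A) * (7 / 2 * √M) := by gcongr
    _ = 7 * (√M * √M) / (1 + A) := by ring
    _ = _ := by rw [Real.mul_self_sqrt hM0.le, hM]; ring

/-! ### Heavy couples -/

section
variable {d : ℝ} {n : ℕ}

/-- The vertices at dyadic level `s` of `a`. -/
def levelSet (a : Fin n → ℕ) (s : ℕ) : Finset (Fin n) :=
  Finset.univ.filter fun u => a u ≠ 0 ∧ Nat.log 2 (a u) = s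

lemma sum_four_pow_card_levelSet_le (a : Fin n → ℕ) (L : ℕ) :
    ∑ s ∈ Finset.range L, (4:ℝ) ^ s * (levelSet a s).card ≤ ∑ u, (a u : ℝ) ^ 2 := by
  have h1 : ∀ s, (4:ℝ) ^ s * (levelSet a s).card =
      ∑ u, if a u ≠ 0 ∧ Nat.log 2 (a u) = s then (4:ℝ) ^ s else 0 := by
    intro s
    rw [← Finset.sum_filter, Finset.sum_const, nsmul_eq_mul, mul_comm]; rfl
  simp only [h1]
  rw [Finset.sum_comm]
  refine Finset.sum_le_sum fun u _ => ?_
  by_cases h : a u = 0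
  · simp [h]
  · simp only [ne_eq, h, not_false_eq_true, true_and, Finset.sum_ite_eq]
    split_ifs
    · have : (2:ℝ) ^ Nat.log 2 (a u) ≤ a u := by exact_mod_cast Nat.pow_log_le_self 2 h
      calc (4:ℝ) ^ Nat.log 2 (a u) = (2 ^ Nat.log 2 (a u)) ^ 2 := by
            rw [← pow_mul, mul_comm, pow_mul]; norm_num
        _ ≤ _ := by gcongr
    · positivity

/-- The entropy t log 8 per vertex is at most 3/2 times the t log 4 in the denominator, so the
logarithms cancel and no factor t is left. -/
lemma levelCost_div_le (t : ℕ) (S : Finset (Fin n)) :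
    levelCost n t S / (1 + Real.log (8 * 4 ^ t)) ≤ 3 / 2 * S.card + n * (1 / 8) ^ t := by
  have h2 : 0 < Real.log 2 := Real.log_pos (by norm_num)
  have e8 : Real.log 8 = 3 * Real.log 2 := by
    rw [show (8:ℝ) = 2 ^ 3 by norm_num, Real.log_pow]; norm_num
  have e4 : Real.log 4 = 2 * Real.log 2 := by
    rw [show (4:ℝ) = 2 ^ 2 by norm_num, Real.log_pow]; norm_num
  have e : Real.log (8 * 4 ^ t) = 3 * Real.log 2 + t * (2 * Real.log 2) := by
    rw [Real.log_mul (by norm_num) (by positivity), Real.log_pow, e8, e4]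
  have hp : 0 < 1 + Real.log (8 * 4 ^ t) := by rw [e]; positivity
  rw [div_le_iff₀ hp, levelCost, add_mul]
  refine add_le_add ?_ ?_
  · rw [e, e8]
    have : 0 ≤ (S.card : ℝ) := Nat.cast_nonneg _
    have h3 : 0 ≤ (S.card : ℝ) * (1 + 3 * Real.log 2) := by positivity
    nlinarith
  · have h3 : 1 ≤ 1 + Real.log (8 * 4 ^ t) := by rw [e]; simp; positivity
    exact le_mul_of_one_le_right (by positivity) h3

open Classical in
-- For fixed t the sum over s leaves √d 4^t times the normalised cost. The set part sums to the
-- squared norm of a; the part n 8^(-t) becomes n 2^(-t), which is summable because the base 8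
-- exceeds 4.
lemma sum_mid_cost_le (hd : 0 < d) {Ω : ℝ} (a : Fin n → ℕ) (L : ℕ) :
    ∑ s ∈ Finset.range L, ∑ t ∈ Finset.range L, (if MidLevels d Ω s t then
      (2 ^ s / tilt d s t) * (2 ^ t * levelCost n t (levelSet a t)) else 0) ≤
      √d * (21 * ∑ u, (a u : ℝ) ^ 2 + 28 * n) := by
  have hcost0 : ∀ t S, 0 ≤ levelCost n t S := fun t S => by
    have : 0 ≤ Real.log 8 := Real.log_nonneg (by norm_num)
    rw [levelCost]; positivity
  rw [Finset.sum_comm]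
  have h1 : ∀ t, ∑ s ∈ Finset.range L, (if MidLevels d Ω s t then
      (2 ^ s / tilt d s t) * (2 ^ t * levelCost n t (levelSet a t)) else 0) ≤
      √d * (21 * (4 ^ t * (levelSet a t).card) + 14 * n * (1 / 2) ^ t) := by
    intro t
    have e1 : ∑ s ∈ Finset.range L, (if MidLevels d Ω s t then
        (2 ^ s / tilt d s t) * (2 ^ t * levelCost n t (levelSet a t)) else 0) =
        (∑ s ∈ Finset.range L, (if MidLevels d Ω s t then 2 ^ s / tilt d s t else 0)) *
          (2 ^ t * levelCost n t (levelSet a t)) := by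
      rw [Finset.sum_mul]
      exact Finset.sum_congr rfl fun s _ => by split_ifs <;> simp
    rw [e1]
    have h4 : (4:ℝ) ^ t = 2 ^ t * 2 ^ t := by rw [← mul_pow]; norm_num
    have h8 : (4:ℝ) ^ t * (1 / 8) ^ t = (1 / 2) ^ t := by rw [← mul_pow]; norm_num
    calc _ ≤ 14 * √d * 2 ^ t / (1 + Real.log (8 * 4 ^ t)) * (2 ^ t * levelCost n t (levelSet a t)) := by
          refine mul_le_mul_of_nonneg_right (sum_two_pow_div_tilt_le hd t L) ?_
          have := hcost0 t (levelSet a t)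
          positivity
      _ = 14 * √d * 4 ^ t * (levelCost n t (levelSet a t) / (1 + Real.log (8 * 4 ^ t))) := by
          rw [h4]; ring
      _ ≤ 14 * √d * 4 ^ t * (3 / 2 * (levelSet a t).card + n * (1 / 8) ^ t) := by
          refine mul_le_mul_of_nonneg_left (levelCost_div_le _ _) (by positivity)
      _ = _ := by rw [← h8]; ring
  refine (Finset.sum_le_sum fun t _ => h1 t).trans ?_
  rw [← Finset.mul_sum, Finset.sum_add_distrib, ← Finset.mul_sum, ← Finset.mul_sum]
  have h2 : ∑ t ∈ Finset.range L, (1 / 2 : ℝ) ^ t ≤ 2 := by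
    exact (summable_geometric_two.sum_le_tsum _ fun i _ => by positivity).trans_eq tsum_geometric_two
  have h3 := sum_four_pow_card_levelSet_le a L
  have h5 : (14 * (n:ℝ)) * ∑ t ∈ Finset.range L, (1 / 2 : ℝ) ^ t ≤ 28 * n := by
    have : (0:ℝ) ≤ n := Nat.cast_nonneg _
    nlinarith
  gcongr

open Classical in
-- The cap Ω on the levels is used here only: it bounds the total weight with which the slack x of
-- the discrepancy bound enters.
lemma sum_mid_slack_le {Ω : ℝ} (hΩ : 0 ≤ Ω) (L : ℕ) :
    ∑ s ∈ Finset.range L, ∑ t ∈ Finset.range L, (if MidLevels d Ω s t then (2:ℝ) ^ s * 2 ^ t else 0) ≤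
      4 * Ω ^ 2 := by
  have h1 := sum_pow_le_of_le (r := 2) (by norm_num) hΩ L
  set g : ℕ → ℝ := fun s => if (2:ℝ) ^ s ≤ Ω then 2 ^ s else 0 with hg
  have hg0 : ∀ s, 0 ≤ g s := fun s => by simp only [hg]; split_ifs <;> positivity
  have h2 : ∑ s ∈ Finset.range L, ∑ t ∈ Finset.range L,
      (if MidLevels d Ω s t then (2:ℝ) ^ s * 2 ^ t else 0) ≤
      ∑ s ∈ Finset.range L, ∑ t ∈ Finset.range L, g s * g t := by
    refine Finset.sum_le_sum fun s _ => Finset.sum_le_sum fun t _ => ?_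
    split_ifs with h
    · simp only [hg, if_pos h.2.2.2.1, if_pos h.2.2.2.2]; exact le_rfl
    · exact mul_nonneg (hg0 s) (hg0 t)
  rw [← Finset.sum_mul_sum] at h2
  have h3 : 0 ≤ ∑ s ∈ Finset.range L, g s := Finset.sum_nonneg fun s _ => hg0 s
  have h4 : ∑ s ∈ Finset.range L, g s ≤ 2 * Ω := by linarith
  nlinarith

open Classical in
-- Dividing the discrepancy inequality by the tilt, which is at least 1, splits each edge count into
-- an expected part, an entropy part and a slack part. The first contributes 16 · 2.7183 · 4096 ≈
-- 178200, the second 16 · 1372 = 21952, the third 32 x Ω².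
lemma sum_mid_edgeCount_le {x Ω : ℝ} (hd : 0 < d) (hx : 0 ≤ x) (hΩ : 0 ≤ Ω) (hn : 0 < n)
    {G : SimpleGraph (Fin n)} (hG : Discrepancy d x G) (a : Fin n → ℕ)
    (ha : ∑ u, (a u : ℝ) ^ 2 ≤ 64 * n) :
    ∑ s ∈ Finset.range (64 * n + 1), ∑ t ∈ Finset.range (64 * n + 1), (if MidLevels d Ω s t then
      4 * 2 ^ s * 2 ^ t * edgeCount G (levelSet a s) (levelSet a t) else 0) ≤
      201000 * √d * n + 32 * x * Ω ^ 2 := by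
  have hn' : (0:ℝ) < n := by exact_mod_cast hn
  have hsd := Real.sqrt_pos.2 hd
  obtain ⟨L, hL⟩ : ∃ L, L = 64 * n + 1 := ⟨_, rfl⟩
  rw [← hL]
  set N : ℕ → ℝ := fun s => 4 ^ s * (levelSet a s).card with hN
  set c : ℕ → ℝ := fun s => levelCost n s (levelSet a s) with hc
  have hterm : ∀ s ∈ Finset.range L, ∀ t ∈ Finset.range L, (if MidLevels d Ω s t then
      4 * 2 ^ s * 2 ^ t * edgeCount G (levelSet a s) (levelSet a t) else 0) ≤
      16 * Real.exp 1 * √d / n * (N s * N t) +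
      8 * ((if MidLevels d Ω s t then (2 ^ s / tilt d s t) * (2 ^ t * c t) else 0) +
        (if MidLevels d Ω t s then (2 ^ t / tilt d t s) * (2 ^ s * c s) else 0)) +
      8 * x * (if MidLevels d Ω s t then (2:ℝ) ^ s * 2 ^ t else 0) := by
    intro s hs t ht
    have hN0 : ∀ s, 0 ≤ N s := fun s => by simp only [hN]; positivity
    by_cases h : MidLevels d Ω s t
    · rw [if_pos h, if_pos h, if_pos h.symm, if_pos h, tilt_symm d t s]
      have h1 := h.one_le_tilt hd
      have h2 := hG s (by rw [Finset.mem_range] at hs; omega) t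
        (by rw [Finset.mem_range] at ht; omega) (levelSet a s) (levelSet a t)
      set θ := tilt d s t
      have hθ : 0 < θ := by linarith
      set E := edgeCount G (levelSet a s) (levelSet a t)
      have h3 : E ≤ d / n * (levelSet a s).card * (levelSet a t).card *
          (Real.exp 1 * (4 * 2 ^ s * 2 ^ t / √d)) + 2 * (c s + c t) / θ + 2 * x := by
        rw [← mul_le_mul_iff_right₀ hθ]
        refine h2.trans ?_
        have e : θ * (d / n * (levelSet a s).card * (levelSet a t).card *
          (Real.exp 1 * (4 * 2 ^ s * 2 ^ t / √d)) + 2 * (c s + c t) / θ + 2 * x) =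
          θ * (d / n * (levelSet a s).card * (levelSet a t).card *
          (Real.exp 1 * (4 * 2 ^ s * 2 ^ t / √d))) + 2 * (c s + c t) + θ * (2 * x) := by
          field_simp
        rw [e]
        have h4 : 0 ≤ d / n * (levelSet a s).card * (levelSet a t).card *
          (Real.exp 1 * (4 * 2 ^ s * 2 ^ t / √d)) := by positivity
        have h5 := le_mul_of_one_le_left h4 h1
        have h6 : 2 * x ≤ θ * (2 * x) := le_mul_of_one_le_left (by linarith) h1
        simp only [hc]
        linarith
      refine (mul_le_mul_of_nonneg_left h3 (by positivity)).trans (le_of_eq ?_)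
      have h4 : ∀ t : ℕ, (4:ℝ) ^ t = 2 ^ t * 2 ^ t := fun t => by rw [← mul_pow]; norm_num
      have hdd : d = √d * √d := (Real.mul_self_sqrt hd.le).symm
      simp only [hN, h4]
      have e1 : d / √d = √d := by rw [div_eq_iff hsd.ne']; exact hdd
      calc _ = 16 * Real.exp 1 * (d / √d) / n * (2 ^ s * 2 ^ s * (levelSet a s).card *
            (2 ^ t * 2 ^ t * (levelSet a t).card)) + 8 * (2 ^ s / θ * (2 ^ t * c t) +
            2 ^ t / θ * (2 ^ s * c s)) + 8 * x * (2 ^ s * 2 ^ t) := by ring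
        _ = _ := by rw [e1]
    · have h' : ¬ MidLevels d Ω t s := fun h' => h h'.symm
      rw [if_neg h, if_neg h, if_neg h', if_neg h]
      have := mul_nonneg (hN0 s) (hN0 t)
      simp only [add_zero, mul_zero]
      positivity
  refine (Finset.sum_le_sum fun s hs => Finset.sum_le_sum fun t ht => hterm s hs t ht).trans ?_
  have hdist : ∀ f g h : ℕ → ℕ → ℝ, ∀ α β γ : ℝ, ∑ s ∈ Finset.range L, ∑ t ∈ Finset.range L,
      (α * f s t + β * (g s t + g t s) + γ * h s t) =
      α * ∑ s ∈ Finset.range L, ∑ t ∈ Finset.range L, f s t +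
      2 * β * ∑ s ∈ Finset.range L, ∑ t ∈ Finset.range L, g s t +
      γ * ∑ s ∈ Finset.range L, ∑ t ∈ Finset.range L, h s t := by
    intro f g h α β γ
    have e : ∑ s ∈ Finset.range L, ∑ t ∈ Finset.range L, g t s =
      ∑ s ∈ Finset.range L, ∑ t ∈ Finset.range L, g s t := Finset.sum_comm
    simp only [Finset.sum_add_distrib, ← Finset.mul_sum, e]
    ring
  rw [hdist (fun s t => N s * N t) (fun s t => if MidLevels d Ω s t then
    (2 ^ s / tilt d s t) * (2 ^ t * c t) else 0), ← Finset.sum_mul_sum]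
  have h1 := sum_four_pow_card_levelSet_le a L
  have hs0 : 0 ≤ ∑ s ∈ Finset.range L, N s :=
    Finset.sum_nonneg fun s _ => by simp only [hN]; positivity
  have h2 : (∑ s ∈ Finset.range L, N s) * (∑ s ∈ Finset.range L, N s) ≤ 4096 * n ^ 2 := by
    have : ∑ s ∈ Finset.range L, N s ≤ 64 * n := h1.trans ha
    nlinarith
  have h3 := sum_mid_cost_le hd (Ω := Ω) a L
  have h5 := sum_mid_slack_le (d := d) hΩ L
  have h6 : √d * (21 * ∑ u, (a u : ℝ) ^ 2 + 28 * n) ≤ √d * (21 * (64 * n) + 28 * n) := by gcongr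
  have h7 : 16 * Real.exp 1 * √d / n * ((∑ s ∈ Finset.range L, N s) * (∑ s ∈ Finset.range L, N s)) ≤
      16 * 2.7183 * √d / n * (4096 * n ^ 2) := by
    refine mul_le_mul ?_ h2 (mul_nonneg hs0 hs0) (by positivity)
    refine div_le_div_of_nonneg_right (mul_le_mul_of_nonneg_right ?_ hsd.le) hn'.le
    linarith [Real.exp_one_lt_d9]
  have h8 : 16 * 2.7183 * √d / n * (4096 * n ^ 2) = 16 * 2.7183 * 4096 * (√d * n) := by
    field_simp
  have h9 : 8 * x * ∑ s ∈ Finset.range L, ∑ t ∈ Finset.range L,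
      (if MidLevels d Ω s t then (2:ℝ) ^ s * 2 ^ t else 0) ≤ 8 * x * (4 * Ω ^ 2) := by gcongr
  have h10 : 0 ≤ √d * n := by positivity
  have h11 : √d * (21 * (64 * n) + 28 * n) = 1372 * (√d * n) := by ring
  simp only [hc]
  linarith

end

section
variable {d : ℝ} {n : ℕ}

open Classical in
lemma sum_adj_sq_le {Δ : ℝ} {H : SimpleGraph (Fin n)}
    (hdeg : ∀ u, ∑ v, (if H.Adj u v then (1:ℝ) else 0) ≤ Δ) (a : Fin n → ℝ) (W : Finset (Fin n))
    (v : Fin n) : ∑ u ∈ W, (if H.Adj u v then a v ^ 2 else 0) ≤ Δ * a v ^ 2 := by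
  calc _ ≤ ∑ u, (if H.Adj u v then a v ^ 2 else 0) :=
        Finset.sum_le_sum_of_subset_of_nonneg (Finset.subset_univ _)
          fun u _ _ => by split_ifs <;> positivity
    _ = (∑ u, (if H.Adj v u then (1:ℝ) else 0)) * a v ^ 2 := by
        rw [Finset.sum_mul]
        refine Finset.sum_congr rfl fun u _ => ?_
        rw [H.adj_comm]; split_ifs <;> simp
    _ ≤ _ := mul_le_mul_of_nonneg_right (hdeg v) (sq_nonneg _)

open Classical in
-- Meant for couples with a_u √d ≤ a_v, where a_u a_v ≤ a_v²/√d: at most `cdeg` · d edges meet v, so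
-- only a factor √d remains.
lemma sum_sum_adj_sq_div_le {cdeg : ℝ} (hd : 0 < d) {H : SimpleGraph (Fin n)}
    (hdeg : ∀ u, ∑ v, (if H.Adj u v then (1:ℝ) else 0) ≤ cdeg * d) (a : Fin n → ℝ) :
    ∑ u, ∑ v, (if H.Adj u v then a v ^ 2 / √d else 0) ≤ cdeg * √d * ∑ v, a v ^ 2 := by
  have hsd := Real.sqrt_pos.2 hd
  have hdd : √d * √d = d := Real.mul_self_sqrt hd.le
  rw [Finset.sum_comm, Finset.mul_sum]
  refine Finset.sum_le_sum fun v _ => ?_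
  have h2 : ∑ u, (if H.Adj u v then a v ^ 2 / √d else 0) =
      (∑ u, (if H.Adj u v then a v ^ 2 else 0)) / √d := by
    rw [Finset.sum_div]
    exact Finset.sum_congr rfl fun u _ => by split_ifs <;> simp
  rw [h2, div_le_iff₀ hsd]
  refine (sum_adj_sq_le hdeg a _ v).trans (le_of_eq ?_)
  nth_rewrite 1 [← hdd]; ring

open Classical in
-- At most K/ω² ≤ m vertices have a_u ≥ ω, so local sparsity applies to them. With τ = √d the charge
-- 2τ and the degree term `cdeg` · d/τ are balanced.
lemma LocallySparse.sum_high_le {m ω cdeg : ℝ} (hd : 0 < d) (hω : 0 < ω) (hcdeg : 0 ≤ cdeg)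
    {H : SimpleGraph (Fin n)} (hS : LocallySparse m H)
    (hdeg : ∀ u, ∑ v, (if H.Adj u v then (1:ℝ) else 0) ≤ cdeg * d) {a : Fin n → ℝ} {K : ℝ}
    (ha : ∑ u, a u ^ 2 ≤ K) (hm : K ≤ m * ω ^ 2) :
    ∑ u, ∑ v, (if ω ≤ a u ∧ ω ≤ a v ∧ H.Adj u v then a u * a v else 0) ≤
      (2 + cdeg) * √d * K := by
  have hsd := Real.sqrt_pos.2 hd
  have hdd : √d * √d = d := Real.mul_self_sqrt hd.le
  set W : Finset (Fin n) := Finset.univ.filter fun u => ω ≤ a u with hW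
  have hsub : ∑ u ∈ W, a u ^ 2 ≤ ∑ u, a u ^ 2 :=
    Finset.sum_le_sum_of_subset_of_nonneg (Finset.subset_univ _) fun u _ _ => sq_nonneg _
  have hWcard : (W.card : ℝ) ≤ m := by
    have h1 : W.card * ω ^ 2 ≤ K := by
      calc W.card * ω ^ 2 = ∑ u ∈ W, ω ^ 2 := by simp
        _ ≤ ∑ u ∈ W, a u ^ 2 := by
            refine Finset.sum_le_sum fun u hu => ?_
            have : ω ≤ a u := (Finset.mem_filter.1 hu).2
            gcongr
        _ ≤ _ := hsub.trans ha
    exact le_of_mul_le_mul_right (h1.trans hm) (by positivity)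
  have e1 : ∑ u, ∑ v, (if ω ≤ a u ∧ ω ≤ a v ∧ H.Adj u v then a u * a v else 0) =
      ∑ u ∈ W, ∑ v ∈ W, (if H.Adj u v then a u * a v else 0) := by
    rw [hW, Finset.sum_filter]
    refine Finset.sum_congr rfl fun u _ => ?_
    rw [Finset.sum_filter]
    split_ifs with h
    · exact Finset.sum_congr rfl fun v _ => by simp only [h, true_and, ite_and]
    · simp [h]
  rw [e1]
  refine (hS.sum_sum_adj_le hsd a W hWcard).trans ?_
  have h3 : (∑ u ∈ W, ∑ v ∈ W, if H.Adj u v then a u ^ 2 else 0) ≤ cdeg * d * K := by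
    calc _ ≤ ∑ u ∈ W, cdeg * d * a u ^ 2 := by
          refine Finset.sum_le_sum fun u _ => ?_
          simp only [H.adj_comm u]
          exact sum_adj_sq_le hdeg a W u
      _ = cdeg * d * ∑ u ∈ W, a u ^ 2 := by rw [Finset.mul_sum]
      _ ≤ _ := mul_le_mul_of_nonneg_left (hsub.trans ha) (by positivity)
  have h4 : (∑ u ∈ W, ∑ v ∈ W, if H.Adj u v then a u ^ 2 else 0) / √d ≤ cdeg * √d * K := by
    rw [div_le_iff₀ hsd]
    refine h3.trans (le_of_eq ?_)
    nth_rewrite 1 [← hdd]; ring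
  have h5 := mul_le_mul_of_nonneg_left (hsub.trans ha) (show 0 ≤ 2 * √d by positivity)
  linarith

open Classical in
/-- The contribution of a couple whose dyadic levels are `MidLevels`. -/
def midWeight (d Ω : ℝ) (G : SimpleGraph (Fin n)) (a : Fin n → ℕ) (u v : Fin n) : ℝ :=
  ∑ s ∈ Finset.range (64 * n + 1), ∑ t ∈ Finset.range (64 * n + 1),
    (if MidLevels d Ω s t then 4 * 2 ^ s * 2 ^ t *
      (if G.Adj u v ∧ u ∈ levelSet a s ∧ v ∈ levelSet a t then 1 else 0) else 0)

open Classical in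
lemma midWeight_nonneg (d Ω : ℝ) (G : SimpleGraph (Fin n)) (a : Fin n → ℕ) (u v : Fin n) :
    0 ≤ midWeight d Ω G a u v :=
  Finset.sum_nonneg fun s _ => Finset.sum_nonneg fun t _ => by split_ifs <;> positivity

open Classical in
lemma sum_midWeight_eq (d Ω : ℝ) (G : SimpleGraph (Fin n)) (a : Fin n → ℕ) :
    ∑ u, ∑ v, midWeight d Ω G a u v =
      ∑ s ∈ Finset.range (64 * n + 1), ∑ t ∈ Finset.range (64 * n + 1),
        (if MidLevels d Ω s t then
          4 * 2 ^ s * 2 ^ t * edgeCount G (levelSet a s) (levelSet a t) else 0) := by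
  unfold midWeight
  generalize 64 * n + 1 = L
  rw [Finset.sum_congr rfl fun u _ => Finset.sum_comm, Finset.sum_comm]
  refine Finset.sum_congr rfl fun s _ => ?_
  rw [Finset.sum_congr rfl fun u _ => Finset.sum_comm, Finset.sum_comm]
  refine Finset.sum_congr rfl fun t _ => ?_
  split_ifs
  · simp only [edgeCount, Finset.mul_sum]
  · simp

open Classical in
lemma le_midWeight {Ω : ℝ} {G : SimpleGraph (Fin n)} {a : Fin n → ℕ}
    (ha : ∀ u, Nat.log 2 (a u) < 64 * n + 1) {u v : Fin n} (hu : a u ≠ 0) (hv : a v ≠ 0)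
    (hadj : G.Adj u v) (hmid : MidLevels d Ω (Nat.log 2 (a u)) (Nat.log 2 (a v))) :
    4 * 2 ^ Nat.log 2 (a u) * 2 ^ Nat.log 2 (a v) ≤ midWeight d Ω G a u v := by
  have hu' := ha u
  have hv' := ha v
  unfold midWeight
  generalize 64 * n + 1 = L at hu' hv'
  refine le_trans (le_of_eq ?_) ((Finset.single_le_sum (f := fun t =>
      (if MidLevels d Ω (Nat.log 2 (a u)) t then 4 * 2 ^ Nat.log 2 (a u) * 2 ^ t *
      (if G.Adj u v ∧ u ∈ levelSet a (Nat.log 2 (a u)) ∧ v ∈ levelSet a t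
        then (1:ℝ) else 0) else 0))
      (fun t _ => by split_ifs <;> positivity) (Finset.mem_range.2 hv')).trans
      (Finset.single_le_sum (f := fun s => ∑ t ∈ Finset.range L,
      (if MidLevels d Ω s t then 4 * 2 ^ s * 2 ^ t *
      (if G.Adj u v ∧ u ∈ levelSet a s ∧ v ∈ levelSet a t then (1:ℝ) else 0) else 0))
      (fun s _ => Finset.sum_nonneg fun t _ => by split_ifs <;> positivity)
      (Finset.mem_range.2 hu')))
  rw [if_pos hmid, if_pos, mul_one]
  exact ⟨hadj, by simp [levelSet, hu], by simp [levelSet, hv]⟩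

/-- One entry is below ω and the ratio is below √d, so both entries are below √d ω; this is the cap
Ω used for the middle levels. Rounding to powers of 2 costs at most a factor 4 in the product and 2
in the ratios. -/
lemma midLevels_of_heavy {ω : ℝ} (hsd : 1 ≤ √d) {a b : ℕ} (ha : a ≠ 0) (hb : b ≠ 0)
    (hheavy : √d < a * b) (h1 : (b : ℝ) < a * √d) (h2 : (a : ℝ) < b * √d)
    (h3 : (a : ℝ) < ω ∨ (b : ℝ) < ω) :
    MidLevels d (√d * ω) (Nat.log 2 a) (Nat.log 2 b) ∧
      (a * b : ℝ) ≤ 4 * 2 ^ Nat.log 2 a * 2 ^ Nat.log 2 b := by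
  have hlow : ∀ x : ℕ, x ≠ 0 → (2:ℝ) ^ Nat.log 2 x ≤ x := fun x h => by
    exact_mod_cast Nat.pow_log_le_self 2 h
  have hup : ∀ x : ℕ, (x : ℝ) ≤ 2 * 2 ^ Nat.log 2 x := fun x => by
    have := (Nat.lt_pow_succ_log_self (b := 2) (by norm_num) x).le
    rw [pow_succ'] at this
    exact_mod_cast this
  have lb := hlow b hb
  have ha0 : (0:ℝ) ≤ a := Nat.cast_nonneg _
  have hb0 : (0:ℝ) ≤ b := Nat.cast_nonneg _
  have hbd : (a : ℝ) ≤ √d * ω ∧ (b : ℝ) ≤ √d * ω := by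
    rcases h3 with c | c
    · constructor <;> nlinarith
    · constructor <;> nlinarith
  have hprod : (a * b : ℝ) ≤ 4 * 2 ^ Nat.log 2 a * 2 ^ Nat.log 2 b := by
    calc (a * b : ℝ) ≤ (2 * 2 ^ Nat.log 2 a) * (2 * 2 ^ Nat.log 2 b) := by
          gcongr
          · exact hup a
          · exact hup b
      _ = _ := by ring
  refine ⟨⟨by linarith, ?_, ?_, (hlow a ha).trans hbd.1, lb.trans hbd.2⟩, hprod⟩
  · calc (2:ℝ) ^ Nat.log 2 a ≤ b * √d := (hlow a ha).trans h2.le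
      _ ≤ (2 * 2 ^ Nat.log 2 b) * √d := by
        gcongr
        exact hup b
      _ = _ := by ring
  · calc (2:ℝ) ^ Nat.log 2 b ≤ a * √d := lb.trans h1.le
      _ ≤ (2 * 2 ^ Nat.log 2 a) * √d := by
        gcongr
        exact hup a
      _ = _ := by ring

open Classical in
-- A heavy couple has ratio at least √d (degree cap, `t₁`), or both entries at least ω (local
-- sparsity, `t₂`), or middle levels (discrepancy). Local sparsity passes to the subgraph H, and for
-- the discrepancy part the edges of H are simply counted as edges of G.
lemma sum_heavy_le {x m ω cdeg : ℝ} (hd : 1 ≤ d) (hx : 0 ≤ x) (hω : 0 < ω) (hn : 0 < n)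
    (hcdeg : 0 ≤ cdeg) {G H : SimpleGraph (Fin n)} (hHG : H ≤ G)
    (hdeg : ∀ u, ∑ v, (if H.Adj u v then (1:ℝ) else 0) ≤ cdeg * d)
    (hG : Discrepancy d x G) (hS : LocallySparse m G) (hm : 64 * n ≤ m * ω ^ 2)
    (hxω : 32 * x * (d * ω ^ 2) ≤ √d * n) (a : Fin n → ℕ)
    (ha : ∑ u, (a u : ℝ) ^ 2 ≤ 64 * n) :
    ∑ u, ∑ v, (if H.Adj u v ∧ √d < a u * a v then (a u * a v : ℝ) else 0) ≤
      (256 * cdeg + 201200) * √d * n := by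
  have hsd : 1 ≤ √d := Real.one_le_sqrt.2 hd
  have hdd : √d * √d = d := Real.mul_self_sqrt (by linarith)
  have hn' : (0:ℝ) < n := by exact_mod_cast hn
  have hal : ∀ u, Nat.log 2 (a u) < 64 * n + 1 := by
    intro u
    have h1 : (a u : ℝ) ^ 2 ≤ 64 * n :=
      (Finset.single_le_sum (f := fun u => (a u : ℝ) ^ 2) (fun v _ => sq_nonneg _)
        (Finset.mem_univ u)).trans ha
    have h2 : a u ^ 2 ≤ 64 * n := by exact_mod_cast h1
    have h3 := Nat.log_le_self 2 (a u)
    nlinarith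
  set t₁ : Fin n → Fin n → ℝ := fun u v => if H.Adj u v then (a v : ℝ) ^ 2 / √d else 0 with ht₁
  set t₂ : Fin n → Fin n → ℝ := fun u v =>
    if ω ≤ (a u : ℝ) ∧ ω ≤ (a v : ℝ) ∧ H.Adj u v then (a u : ℝ) * a v else 0 with ht₂
  have h₁0 : ∀ u v, 0 ≤ t₁ u v := fun u v => by simp only [ht₁]; split_ifs <;> positivity
  have h₂0 : ∀ u v, 0 ≤ t₂ u v := fun u v => by simp only [ht₂]; split_ifs <;> positivity
  have hpt : ∀ u v, (if H.Adj u v ∧ √d < a u * a v then (a u * a v : ℝ) else 0) ≤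
      t₁ u v + t₁ v u + t₂ u v + midWeight d (√d * ω) G a u v := by
    intro u v
    have p1 := h₁0 u v
    have p2 := h₁0 v u
    have p3 := h₂0 u v
    have p4 := midWeight_nonneg d (√d * ω) G a u v
    split_ifs with h
    swap; · linarith
    obtain ⟨hadj, hheavy⟩ := h
    have hau : (0:ℝ) ≤ a u := Nat.cast_nonneg _
    have hav : (0:ℝ) ≤ a v := Nat.cast_nonneg _
    by_cases c1 : a u * √d ≤ a v
    · have : (a u * a v : ℝ) ≤ t₁ u v := by
        simp only [ht₁, if_pos hadj]
        rw [le_div_iff₀ (by linarith), sq, mul_right_comm]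
        exact mul_le_mul_of_nonneg_right c1 hav
      linarith
    by_cases c2 : a v * √d ≤ a u
    · have : (a u * a v : ℝ) ≤ t₁ v u := by
        simp only [ht₁, if_pos hadj.symm]
        rw [le_div_iff₀ (by linarith), sq, mul_assoc]
        exact mul_le_mul_of_nonneg_left c2 hau
      linarith
    by_cases c3 : ω ≤ (a u : ℝ) ∧ ω ≤ (a v : ℝ)
    · have : (a u * a v : ℝ) = t₂ u v := by
        simp only [ht₂, if_pos (show ω ≤ (a u : ℝ) ∧ ω ≤ (a v : ℝ) ∧ H.Adj u v from ⟨c3.1, c3.2, hadj⟩)]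
      linarith
    have hu0 : a u ≠ 0 := by
      intro h0; rw [h0, Nat.cast_zero, zero_mul] at hheavy; linarith
    have hv0 : a v ≠ 0 := by
      intro h0; rw [h0, Nat.cast_zero, mul_zero] at hheavy; linarith
    obtain ⟨hmid, hle⟩ := midLevels_of_heavy (ω := ω) hsd hu0 hv0 hheavy (not_le.1 c1) (not_le.1 c2)
      (by simpa only [not_and_or, not_le] using c3)
    have := hle.trans (le_midWeight hal hu0 hv0 (hHG hadj) hmid)
    linarith
  have hsum₁ : ∑ u, ∑ v, t₁ u v ≤ cdeg * √d * (64 * n) :=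
    (sum_sum_adj_sq_div_le (by linarith) hdeg _).trans
      (mul_le_mul_of_nonneg_left ha (by positivity))
  have hSH : LocallySparse m H := by
    intro W' hne hc
    obtain ⟨v, hv, h⟩ := hS W' hne hc
    exact ⟨v, hv, (Finset.card_le_card (Finset.monotone_filter_right _ fun u _ h => hHG h)).trans h⟩
  have hsum₂ : ∑ u, ∑ v, t₂ u v ≤ (2 + cdeg) * √d * (64 * n) :=
    hSH.sum_high_le (by linarith) hω hcdeg hdeg ha hm
  have hsum₃ : ∑ u, ∑ v, midWeight d (√d * ω) G a u v ≤ 201001 * √d * n := by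
    rw [sum_midWeight_eq]
    refine (sum_mid_edgeCount_le (by linarith) hx (by positivity) hn hG a ha).trans ?_
    have : (√d * ω) ^ 2 = d * ω ^ 2 := by rw [mul_pow, sq √d, hdd]
    rw [this]
    linarith
  refine (Finset.sum_le_sum fun u _ => Finset.sum_le_sum fun v _ => hpt u v).trans ?_
  simp only [Finset.sum_add_distrib]
  have h5 : ∑ u, ∑ v, t₁ v u = ∑ u, ∑ v, t₁ u v := Finset.sum_comm
  rw [h5]
  have : 0 ≤ cdeg * √d * n := by positivity
  have : 0 ≤ √d * n := by positivity
  linarith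

/-! ### The centred quadratic form of the pruned graph -/

lemma prune_adj_iff {τ : ℝ} {G : SimpleGraph (Fin n)} {u v : Fin n} :
    (prune τ G).Adj u v ↔ G.Adj u v ∧ u ∈ lowDegree τ G ∧ v ∈ lowDegree τ G := by
  simp [prune, lowDegree]

lemma prune_le (τ : ℝ) (G : SimpleGraph (Fin n)) : prune τ G ≤ G := fun _ _ h => h.1

open Classical in
lemma sum_prune_adj_le {τ : ℝ} (hτ : 0 ≤ τ) (G : SimpleGraph (Fin n)) (u : Fin n) :
    ∑ v, (if (prune τ G).Adj u v then (1:ℝ) else 0) ≤ τ := by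
  by_cases hu : u ∈ lowDegree τ G
  · calc _ ≤ ∑ v, (if G.Adj u v then (1:ℝ) else 0) := by
          refine Finset.sum_le_sum fun v _ => ?_
          by_cases h : (prune τ G).Adj u v
          · rw [if_pos h, if_pos (prune_le τ G h)]
          · rw [if_neg h]; split_ifs <;> norm_num
      _ = ((G.neighborSet u).ncard : ℝ) := (ncard_neighborSet_eq_sum G u).symm
      _ ≤ τ := (Finset.mem_filter.1 hu).2.le
  · have : ∀ v, ¬ (prune τ G).Adj u v := fun v h => hu (prune_adj_iff.1 h).2.1
    simpa [this] using hτ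

open Classical in
/-- The centred adjacency matrix. -/
def centredAdj (p : ℝ) (H : SimpleGraph (Fin n)) : Matrix (Fin n) (Fin n) ℝ :=
  Matrix.of fun u v => (if H.Adj u v then 1 else 0) - p * (if u ≠ v then 1 else 0)

lemma centredAdj_symm (p : ℝ) (H : SimpleGraph (Fin n)) (u v : Fin n) :
    centredAdj p H u v = centredAdj p H v u := by
  by_cases h : H.Adj u v
  · simp [centredAdj, h, h.symm, eq_comm]
  · have h' : ¬ H.Adj v u := fun h' => h h'.symm
    simp [centredAdj, h, h', eq_comm]

open Classical in
-- Couples with an end outside U are bounded by Cauchy–Schwarz and |Uᶜ| ≤ n/d, giving 2 · 64 n²/√d.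
-- Heavy couples satisfy a_u a_v ≤ (a_u a_v)²/√d, giving 4096 n²/√d.
lemma abs_sum_not_light_le (hd : 1 ≤ d) (k : Fin n → ℤ) (hk : ∑ u, (k u : ℝ) ^ 2 ≤ 64 * n)
    {U : Finset (Fin n)} (hU : (Uᶜ.card : ℝ) ≤ n / d) :
    |∑ u, ∑ v, (if u ≠ v then (k u * k v : ℝ) - lightWeight d k U u v else 0)| ≤
      4224 * n ^ 2 / √d := by
  have hsd : 1 ≤ √d := Real.one_le_sqrt.2 hd
  have hdd : √d * √d = d := Real.mul_self_sqrt (by linarith)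
  have hn' : (0:ℝ) ≤ n := Nat.cast_nonneg n
  obtain ⟨a, haabs⟩ : ∃ a : Fin n → ℝ, ∀ u, a u = |(k u : ℝ)| := ⟨_, fun _ => rfl⟩
  have ha0 : ∀ u, 0 ≤ a u := fun u => by rw [haabs]; exact abs_nonneg _
  have hasq : ∑ u, (a u : ℝ) ^ 2 ≤ 64 * n := by simpa only [haabs, sq_abs] using hk
  have habsmul : ∀ u v, |(k u * k v : ℝ)| = a u * a v := fun u v => by
    rw [abs_mul, haabs, haabs]
  set h₂ : Fin n → Fin n → ℝ := fun u v =>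
    if u ≠ v then (k u * k v : ℝ) - lightWeight d k U u v else 0 with hh₂
  set i : Fin n → ℝ := fun u => if u ∈ Uᶜ then a u else 0 with hi
  have hpt : ∀ u v, |h₂ u v| ≤ i u * a v + a u * i v + a u ^ 2 * a v ^ 2 / √d := by
    intro u v
    have q1 := ha0 u
    have q2 := ha0 v
    have p1 : 0 ≤ i u * a v := by simp only [hi]; split_ifs <;> positivity
    have p2 : 0 ≤ a u * i v := by simp only [hi]; split_ifs <;> positivity
    have p3 : 0 ≤ a u ^ 2 * a v ^ 2 / √d := by positivity
    by_cases huv : u = v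
    · simp only [hh₂, huv, ne_eq, not_true_eq_false, if_false, abs_zero]
      rw [huv] at p1 p2 p3; positivity
    simp only [hh₂, ne_eq, huv, not_false_eq_true, if_true, lightWeight, habsmul]
    by_cases c2 : u ∈ U
    swap
    · have : i u = a u := by simp [hi, c2]
      simp only [c2, false_and, if_false, sub_zero, habsmul]
      rw [this] at p1 ⊢; linarith
    by_cases c3 : v ∈ U
    swap
    · have : i v = a v := by simp [hi, c3]
      simp only [c3, false_and, and_false, if_false, sub_zero, habsmul]
      rw [this] at p2 ⊢; linarith
    by_cases c4 : a u * a v ≤ √d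
    · simp only [c2, c3, c4, true_and, if_true, sub_self, abs_zero]; positivity
    · simp only [c2, c3, c4, true_and, if_false, sub_zero, habsmul]
      have h3 : a u * a v ≤ a u ^ 2 * a v ^ 2 / √d := by
        rw [le_div_iff₀ (by linarith)]
        push Not at c4
        have : (0:ℝ) ≤ a u * a v := by positivity
        nlinarith
      linarith
  have hsa : (∑ v, a v) ^ 2 ≤ 64 * n ^ 2 := by
    have := sq_sum_le_card_mul_sum_sq (s := Finset.univ) (f := fun v => a v)
    rw [Finset.card_univ, Fintype.card_fin] at this
    nlinarith
  have hsi : (∑ v, i v) ^ 2 ≤ 64 * n ^ 2 / d := by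
    have h1 : ∑ v, i v = ∑ v ∈ Uᶜ, a v := by simp only [hi, Finset.sum_ite_mem, Finset.univ_inter]
    rw [h1]
    refine (sq_sum_le_card_mul_sum_sq (s := Uᶜ) (f := fun v => a v)).trans ?_
    have h2 : ∑ u ∈ Uᶜ, a u ^ 2 ≤ 64 * n :=
      (Finset.sum_le_sum_of_subset_of_nonneg (Finset.subset_univ _) fun u _ _ => sq_nonneg _).trans hasq
    calc _ ≤ n / d * (64 * n) := by gcongr
      _ = _ := by ring
  have hsi0 : 0 ≤ ∑ v, i v := Finset.sum_nonneg fun v _ => by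
    have := ha0 v; simp only [hi]; split_ifs <;> positivity
  have hsa0 : 0 ≤ ∑ v, a v := Finset.sum_nonneg fun v _ => ha0 v
  have hprod : (∑ v, i v) * (∑ v, a v) ≤ 64 * n ^ 2 / √d := by
    have h1 : (∑ v, i v) * √d ≤ 8 * n := by
      refine abs_le_of_sq_le_sq' ?_ (by positivity) |>.2
      rw [mul_pow, sq √d, hdd]
      rw [le_div_iff₀ (by linarith)] at hsi
      nlinarith
    have h2 : ∑ v, a v ≤ 8 * n := by
      refine abs_le_of_sq_le_sq' ?_ (by positivity) |>.2
      nlinarith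
    rw [le_div_iff₀ (by linarith)]
    nlinarith [mul_le_mul h1 h2 hsa0 (by positivity)]
  calc _ ≤ ∑ u, ∑ v, |h₂ u v| := (Finset.abs_sum_le_sum_abs _ _).trans
          (Finset.sum_le_sum fun u _ => Finset.abs_sum_le_sum_abs _ _)
    _ ≤ ∑ u, ∑ v, (i u * a v + a u * i v + a u ^ 2 * a v ^ 2 / √d) :=
        Finset.sum_le_sum fun u _ => Finset.sum_le_sum fun v _ => hpt u v
    _ = 2 * ((∑ v, i v) * (∑ v, a v)) + (∑ v, a v ^ 2) * (∑ v, a v ^ 2) / √d := by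
        simp only [Finset.sum_add_distrib, ← Finset.sum_div, ← Finset.sum_mul_sum]
        ring
    _ ≤ 2 * (64 * n ^ 2 / √d) + (64 * n) * (64 * n) / √d := by gcongr
    _ = _ := by ring

open Classical in
lemma abs_form_centredAdj_le {x m ω cdeg : ℝ} (hd : 1 ≤ d) (hx : 0 ≤ x) (hω : 0 < ω) (hn : 0 < n)
    (hcdeg : 0 ≤ cdeg) {G : SimpleGraph (Fin n)}
    (hU : ((lowDegree (cdeg * d) G)ᶜ.card : ℝ) ≤ n / d) (hL : LightBound d G)
    (hG : Discrepancy d x G) (hS : LocallySparse m G) (hm : 64 * n ≤ m * ω ^ 2)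
    (hxω : 32 * x * (d * ω ^ 2) ≤ √d * n) (k : Fin n → ℤ)
    (hk : ∑ u, (k u : ℝ) ^ 2 ≤ 64 * n) :
    |∑ u, ∑ v, centredAdj (d / n) (prune (cdeg * d) G) u v * k u * k v| ≤
      ((256 * cdeg + 210000) * √d) * n := by
  set U := lowDegree (cdeg * d) G with hUdef
  set H := prune (cdeg * d) G with hH
  have hsd : 1 ≤ √d := Real.one_le_sqrt.2 hd
  have hdd : √d * √d = d := Real.mul_self_sqrt (by linarith)
  have hn' : (0:ℝ) < n := by exact_mod_cast hn
  set w := lightWeight d k U with hw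
  set a : Fin n → ℕ := fun u => (k u).natAbs with ha
  have haabs : ∀ u, (a u : ℝ) = |(k u : ℝ)| := fun u => by
    simp only [ha, Nat.cast_natAbs, Int.cast_abs]
  have hasq : ∑ u, (a u : ℝ) ^ 2 ≤ 64 * n := by simpa only [haabs, sq_abs] using hk
  have hheavy := sum_heavy_le hd hx hω hn hcdeg (prune_le (cdeg * d) G)
    (sum_prune_adj_le (by positivity) G) hG hS hm hxω a hasq
  rw [← hH] at hheavy
  have hlight := hL k hk U
  set h₁ : Fin n → Fin n → ℝ := fun u v =>
    if H.Adj u v ∧ √d < a u * a v then (k u * k v : ℝ) else 0 with hh₁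
  set h₂ : Fin n → Fin n → ℝ := fun u v => if u ≠ v then (k u * k v : ℝ) - w u v else 0 with hh₂
  have habsmul : ∀ u v, |(k u * k v : ℝ)| = a u * a v := fun u v => by
    rw [abs_mul, haabs, haabs]
  -- On U × U the pruned graph agrees with G, so its light part is written through G, whose edges
  -- are independent. The set U depends on G, which is why `LightBound` is uniform over all vertex
  -- sets.
  have hdecomp : ∑ u, ∑ v, centredAdj (d / n) H u v * k u * k v =
      (∑ u, ∑ v, (if G.Adj u v then w u v else 0) - d / n * ∑ u, ∑ v, (if u ≠ v then w u v else 0))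
        + ∑ u, ∑ v, h₁ u v - d / n * ∑ u, ∑ v, h₂ u v := by
    simp only [Finset.mul_sum, ← Finset.sum_add_distrib, ← Finset.sum_sub_distrib]
    refine Finset.sum_congr rfl fun u _ => Finset.sum_congr rfl fun v _ => ?_
    have e1 : (if H.Adj u v then (k u * k v : ℝ) else 0) = (if G.Adj u v then w u v else 0) + h₁ u v := by
      simp only [hh₁, hw, lightWeight, hH, prune_adj_iff, ← hUdef, habsmul]
      by_cases c1 : G.Adj u v <;> by_cases c2 : u ∈ U <;> by_cases c3 : v ∈ U <;>
        by_cases c4 : (a u * a v : ℝ) ≤ √d <;> simp [c1, c2, c3, c4, not_lt.2, not_le.1]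
    have e2 : (if u ≠ v then (k u * k v : ℝ) else 0) = (if u ≠ v then w u v else 0) + h₂ u v := by
      simp only [hh₂]; split_ifs <;> ring
    have e3 : centredAdj (d / n) H u v * k u * k v = (if H.Adj u v then (k u * k v : ℝ) else 0) -
        d / n * (if u ≠ v then (k u * k v : ℝ) else 0) := by
      simp only [centredAdj, Matrix.of_apply]
      split_ifs <;> ring
    rw [e3, e1, e2]; ring
  have hb₁ : |∑ u, ∑ v, h₁ u v| ≤ (256 * cdeg + 201200) * √d * n := by
    refine le_trans ?_ hheavy
    refine (Finset.abs_sum_le_sum_abs _ _).trans (Finset.sum_le_sum fun u _ => ?_)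
    refine (Finset.abs_sum_le_sum_abs _ _).trans (Finset.sum_le_sum fun v _ => ?_)
    simp only [hh₁]
    split_ifs
    · rw [habsmul]
    · simp
  have hb₂ := abs_sum_not_light_le hd k hk hU
  have hb₂' : |d / n * ∑ u, ∑ v, h₂ u v| ≤ 4224 * √d * n := by
    rw [abs_mul, abs_of_nonneg (by positivity)]
    calc _ ≤ d / n * (4224 * n ^ 2 / √d) := by gcongr
      _ = 4224 * (d / √d) * n := by field_simp
      _ = _ := by rw [← hdd, mul_div_assoc, Real.sqrt_mul_self (by linarith), div_self (by linarith), mul_one]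
  rw [hdecomp]
  have q1 := abs_le.1 hlight
  have q2 := abs_le.1 hb₁
  have q3 := abs_le.1 hb₂'
  have : 0 ≤ √d * n := by positivity
  rw [abs_le]
  constructor <;> linarith [q1.1, q1.2, q2.1, q2.2, q3.1, q3.2]

end

/-! ### From integer vectors to the operator norm -/

lemma exists_int_toward_zero (r : ℝ) : ∃ k : ℤ, |(k : ℝ)| ≤ |r| ∧ |r - k| ≤ 1 := by
  rcases le_total 0 r with h | h
  · refine ⟨⌊r⌋, ?_, ?_⟩
    · rw [abs_of_nonneg (by exact_mod_cast Int.floor_nonneg.2 h), abs_of_nonneg h]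
      exact Int.floor_le r
    · rw [abs_le]; constructor <;> linarith [Int.floor_le r, Int.lt_floor_add_one r]
  · refine ⟨⌈r⌉, ?_, ?_⟩
    · have : (⌈r⌉ : ℝ) ≤ 0 := by exact_mod_cast Int.ceil_le.2 (by simpa using h)
      rw [abs_of_nonpos this, abs_of_nonpos h]
      linarith [Int.le_ceil r]
    · rw [abs_le]; constructor <;> linarith [Int.le_ceil r, Int.ceil_lt_add_one r]

/-- The coordinates of 4√n x are rounded toward zero: the norm cannot grow, and an error of at most
1 per coordinate becomes √n/(4√n) = 1/4 after rescaling. -/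
lemma exists_int_vector_near {n : ℕ} (hn : 0 < n) (x : EuclideanSpace ℝ (Fin n)) (hx : ‖x‖ ≤ 1) :
    ∃ k : Fin n → ℤ, ∑ u, (k u : ℝ) ^ 2 ≤ 16 * n ∧
      ‖x - (4 * √n)⁻¹ • WithLp.toLp 2 (fun u => (k u : ℝ))‖ ≤ 1 / 4 ∧
      ‖(4 * √n)⁻¹ • (WithLp.toLp 2 (fun u => (k u : ℝ)) : EuclideanSpace ℝ (Fin n))‖ ≤ 1 := by
  have hn' : (0:ℝ) < n := by exact_mod_cast hn
  have hsn := Real.sqrt_pos.2 hn'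
  have hnn : √(n:ℝ) ^ 2 = n := Real.sq_sqrt hn'.le
  choose k hk1 hk2 using fun u => exists_int_toward_zero (4 * √n * x u)
  have hxx : ∑ u, x u ^ 2 ≤ 1 := by
    rw [← EuclideanSpace.real_norm_sq_eq]; nlinarith [norm_nonneg x]
  have hs : ∑ u, (k u : ℝ) ^ 2 ≤ 16 * n := by
    calc ∑ u, (k u : ℝ) ^ 2 ≤ ∑ u, (4 * √n * x u) ^ 2 :=
          Finset.sum_le_sum fun u _ => sq_le_sq.2 (hk1 u)
      _ = 16 * n * ∑ u, x u ^ 2 := by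
          rw [Finset.mul_sum]
          refine Finset.sum_congr rfl fun u _ => ?_
          rw [mul_pow, mul_pow, hnn]; ring
      _ ≤ 16 * n * 1 := by gcongr
      _ = _ := mul_one _
  refine ⟨k, hs, ?_, ?_⟩
  · refine abs_le_of_sq_le_sq' ?_ (by norm_num) |>.2
    rw [EuclideanSpace.real_norm_sq_eq]
    calc _ = ∑ u, ((4 * √n)⁻¹ * (4 * √n * x u - k u)) ^ 2 := by
          refine Finset.sum_congr rfl fun u _ => ?_
          simp only [PiLp.sub_apply, PiLp.smul_apply, smul_eq_mul]
          congr 1; field_simp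
      _ ≤ ∑ u : Fin n, (16 * (n:ℝ))⁻¹ := by
          refine Finset.sum_le_sum fun u _ => ?_
          have h1 : (4 * √n * x u - k u) ^ 2 ≤ 1 := by
            rw [← sq_abs]; nlinarith [hk2 u, abs_nonneg (4 * √n * x u - k u)]
          rw [mul_pow, inv_pow, mul_pow, hnn]
          have : (0:ℝ) ≤ (4 ^ 2 * (n:ℝ))⁻¹ := by positivity
          calc _ ≤ (4 ^ 2 * (n:ℝ))⁻¹ * 1 := by gcongr
            _ = _ := by norm_num
      _ = 1 / 16 := by
          rw [Finset.sum_const, Finset.card_univ, Fintype.card_fin, nsmul_eq_mul]; field_simp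
      _ ≤ _ := by norm_num
  · refine abs_le_of_sq_le_sq' ?_ (by norm_num) |>.2
    rw [EuclideanSpace.real_norm_sq_eq]
    calc _ = (16 * (n:ℝ))⁻¹ * ∑ u, (k u : ℝ) ^ 2 := by
          rw [Finset.mul_sum]
          refine Finset.sum_congr rfl fun u _ => ?_
          simp only [PiLp.smul_apply, smul_eq_mul]
          rw [mul_pow, inv_pow, mul_pow, hnn]; norm_num
      _ ≤ (16 * (n:ℝ))⁻¹ * (16 * n) := by gcongr
      _ = 1 ^ 2 := by field_simp

lemma inner_toEuclideanCLM {n : ℕ} (M : Matrix (Fin n) (Fin n) ℝ) (x y : Fin n → ℝ) :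
    inner ℝ (WithLp.toLp 2 y) (Matrix.toEuclideanCLM (𝕜 := ℝ) M (WithLp.toLp 2 x)) =
      ∑ u, ∑ v, M u v * y u * x v := by
  simp only [Matrix.toEuclideanCLM_toLp, PiLp.inner_apply, Matrix.mulVec, dotProduct]
  refine Finset.sum_congr rfl fun u _ => ?_
  simp only [RCLike.inner_apply, conj_trivial, Finset.sum_mul]
  exact Finset.sum_congr rfl fun v _ => by ring

/-- Polarisation with k ± l, whose squared norms are at most 4 · 16n = 64n, bounds the bilinear form
on lattice vectors. Replacing x and y by nearby rescaled lattice vectors costs ‖T‖/4 each, so ‖T‖ ≤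
K/32 + ‖T‖/2, and the last term is absorbed. -/
lemma norm_toEuclideanCLM_le_of_int_form {n : ℕ} (hn : 0 < n) {M : Matrix (Fin n) (Fin n) ℝ}
    (hM : ∀ u v, M u v = M v u) {K : ℝ}
    (hK : ∀ k : Fin n → ℤ, ∑ u, (k u : ℝ) ^ 2 ≤ 64 * n → |∑ u, ∑ v, M u v * k u * k v| ≤ K * n) :
    ‖Matrix.toEuclideanCLM (𝕜 := ℝ) M‖ ≤ K / 16 := by
  set T := Matrix.toEuclideanCLM (𝕜 := ℝ) M with hT
  have hn' : (0:ℝ) < n := by exact_mod_cast hn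
  have hnn : √(n:ℝ) ^ 2 = n := Real.sq_sqrt hn'.le
  have hpol : ∀ k l : Fin n → ℤ, ∑ u, (k u : ℝ) ^ 2 ≤ 16 * n → ∑ u, (l u : ℝ) ^ 2 ≤ 16 * n →
      |∑ u, ∑ v, M u v * k u * l v| ≤ K * n / 2 := by
    intro k l hk hl
    have h1 := hK (fun u => k u + l u) (by
      calc ∑ u, (((k u + l u : ℤ)) : ℝ) ^ 2 ≤ ∑ u, (2 * (k u : ℝ) ^ 2 + 2 * (l u : ℝ) ^ 2) := by
            refine Finset.sum_le_sum fun u _ => ?_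
            push_cast; nlinarith [sq_nonneg ((k u : ℝ) - l u)]
        _ ≤ _ := by rw [Finset.sum_add_distrib, ← Finset.mul_sum, ← Finset.mul_sum]; linarith)
    have h2 := hK (fun u => k u - l u) (by
      calc ∑ u, (((k u - l u : ℤ)) : ℝ) ^ 2 ≤ ∑ u, (2 * (k u : ℝ) ^ 2 + 2 * (l u : ℝ) ^ 2) := by
            refine Finset.sum_le_sum fun u _ => ?_
            push_cast; nlinarith [sq_nonneg ((k u : ℝ) + l u)]
        _ ≤ _ := by rw [Finset.sum_add_distrib, ← Finset.mul_sum, ← Finset.mul_sum]; linarith)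
    have hsw : ∑ u, ∑ v, M u v * l u * k v = ∑ u, ∑ v, M u v * k u * l v := by
      rw [Finset.sum_comm]
      exact Finset.sum_congr rfl fun u _ => Finset.sum_congr rfl fun v _ => by rw [hM v u]; ring
    have h3 : ∑ u, ∑ v, M u v * ((k u + l u : ℤ) : ℝ) * ((k v + l v : ℤ) : ℝ) -
        ∑ u, ∑ v, M u v * ((k u - l u : ℤ) : ℝ) * ((k v - l v : ℤ) : ℝ) =
        4 * ∑ u, ∑ v, M u v * k u * l v := by
      have : 4 * ∑ u, ∑ v, M u v * k u * l v = 2 * ∑ u, ∑ v, M u v * k u * l v +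
        2 * ∑ u, ∑ v, M u v * l u * k v := by rw [hsw]; ring
      rw [this]
      simp only [Finset.mul_sum, ← Finset.sum_sub_distrib, ← Finset.sum_add_distrib]
      refine Finset.sum_congr rfl fun u _ => Finset.sum_congr rfl fun v _ => ?_
      push_cast; ring
    rw [abs_le] at h1 h2 ⊢
    constructor <;> linarith
  have hbil : ∀ x y : EuclideanSpace ℝ (Fin n), ‖x‖ ≤ 1 → ‖y‖ ≤ 1 →
      inner ℝ y (T x) ≤ K / 32 + ‖T‖ / 2 := by
    intro x y hx hy
    obtain ⟨k, hk, hxk, hk1⟩ := exists_int_vector_near hn x hx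
    obtain ⟨l, hl, hyl, hl1⟩ := exists_int_vector_near hn y hy
    set z : EuclideanSpace ℝ (Fin n) := (4 * √n)⁻¹ • WithLp.toLp 2 (fun u => (k u : ℝ)) with hz
    set w : EuclideanSpace ℝ (Fin n) := (4 * √n)⁻¹ • WithLp.toLp 2 (fun u => (l u : ℝ)) with hw
    have e : inner ℝ y (T x) = inner ℝ y (T (x - z)) + inner ℝ (y - w) (T z) + inner ℝ w (T z) := by
      rw [map_sub, inner_sub_right, inner_sub_left]; ring
    have b1 : inner ℝ y (T (x - z)) ≤ ‖T‖ / 4 := by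
      calc inner ℝ y (T (x - z)) ≤ ‖y‖ * ‖T (x - z)‖ := real_inner_le_norm _ _
        _ ≤ 1 * (‖T‖ * (1 / 4)) := by
            gcongr
            exact (T.le_opNorm _).trans (by gcongr)
        _ = _ := by ring
    have b2 : inner ℝ (y - w) (T z) ≤ ‖T‖ / 4 := by
      calc inner ℝ (y - w) (T z) ≤ ‖y - w‖ * ‖T z‖ := real_inner_le_norm _ _
        _ ≤ (1 / 4) * (‖T‖ * 1) := by
            gcongr
            exact (T.le_opNorm _).trans (by gcongr)
        _ = _ := by ring
    have b3 : inner ℝ w (T z) ≤ K / 32 := by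
      rw [hw, hz, map_smul, inner_smul_left, inner_smul_right, hT, inner_toEuclideanCLM]
      simp only [conj_trivial]
      have h1 := (le_abs_self _).trans (hpol l k hl hk)
      have h2 : (4 * √n)⁻¹ * (4 * √n)⁻¹ = (16 * (n:ℝ))⁻¹ := by
        rw [← mul_inv, ← sq, mul_pow, hnn]; norm_num
      rw [← mul_assoc, h2]
      calc _ ≤ (16 * (n:ℝ))⁻¹ * (K * n / 2) := by gcongr
        _ = K / 32 := by field_simp; ring
    linarith
  have hK0 : 0 ≤ K := by
    have h0 := hK 0 (by simp)
    simp only [Pi.zero_apply, Int.cast_zero, mul_zero, Finset.sum_const_zero, abs_zero] at h0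
    exact nonneg_of_mul_nonneg_left h0 hn'
  have hnorm : ‖T‖ ≤ K / 32 + ‖T‖ / 2 := by
    refine T.opNorm_le_of_unit_norm (by positivity) fun x hx => ?_
    by_cases h0 : T x = 0
    · rw [h0, norm_zero]; positivity
    have h1 := hbil x (‖T x‖⁻¹ • T x) hx.le (by
      rw [norm_smul, norm_inv, norm_norm, inv_mul_cancel₀ (norm_ne_zero_iff.2 h0)])
    rw [inner_smul_left, real_inner_self_eq_norm_sq] at h1
    simp only [conj_trivial] at h1
    have h2 : ‖T x‖⁻¹ * ‖T x‖ ^ 2 = ‖T x‖ := by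
      have := norm_ne_zero_iff.2 h0
      field_simp
    rwa [h2] at h1
  linarith

lemma sum_sq_mul_le_of_norm {n : ℕ} (M : Matrix (Fin n) (Fin n) ℝ) {L : ℝ}
    (hL : ‖Matrix.toEuclideanCLM (𝕜 := ℝ) M‖ ≤ L) (x : Fin n → ℝ) :
    ∑ u, (∑ v, M u v * x v) ^ 2 ≤ L ^ 2 * ∑ v, x v ^ 2 := by
  have h1 := (Matrix.toEuclideanCLM (𝕜 := ℝ) M).le_of_opNorm_le hL (WithLp.toLp 2 x)
  have h2 : ‖Matrix.toEuclideanCLM (𝕜 := ℝ) M (WithLp.toLp 2 x)‖ ^ 2 ≤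
      (L * ‖(WithLp.toLp 2 x : EuclideanSpace ℝ (Fin n))‖) ^ 2 := by gcongr
  rw [mul_pow, EuclideanSpace.real_norm_sq_eq, EuclideanSpace.real_norm_sq_eq] at h2
  simpa only [Matrix.toEuclideanCLM_toLp, Matrix.mulVec, dotProduct] using h2

/-! ### The norm of the Z-shape matrix -/

/-- The off-diagonal matrix of characters. -/
def chiMatrix {n : ℕ} (p : ℝ) (G : SimpleGraph (Fin n)) : Matrix (Fin n) (Fin n) ℝ :=
  Matrix.of fun u v => if u ≠ v then chi p G u v else 0

/-- Extension of a function on ordered pairs by zero. -/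
def extendPair {n : ℕ} (f : OrdPair n → ℝ) (k l : Fin n) : ℝ :=
  if h : k ≠ l then f ⟨(k, l), h⟩ else 0

lemma sum_ordPair {n : ℕ} (F : Fin n → Fin n → ℝ) :
    ∑ x : OrdPair n, F x.1.1 x.1.2 = ∑ k, ∑ l, if k ≠ l then F k l else 0 := by
  rw [← Fintype.sum_prod_type' (fun k l => if k ≠ l then F k l else 0), ← Finset.sum_filter]
  exact (Finset.sum_subtype (Finset.univ.filter fun x : Fin n × Fin n => x.1 ≠ x.2)
    (by simp) (fun x => F x.1 x.2)).symm

lemma sum_extendPair_sq {n : ℕ} (f : OrdPair n → ℝ) :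
    ∑ k, ∑ l, extendPair f k l ^ 2 = ∑ x, f x ^ 2 := by
  have h1 : ∑ x, f x ^ 2 = ∑ x : OrdPair n, extendPair f x.1.1 x.1.2 ^ 2 := by
    refine Finset.sum_congr rfl fun x _ => ?_
    rw [extendPair, dif_pos x.2]
  rw [h1, sum_ordPair (fun k l => extendPair f k l ^ 2)]
  refine Finset.sum_congr rfl fun k _ => Finset.sum_congr rfl fun l _ => ?_
  by_cases h : k = l
  · simp [h, extendPair]
  · simp [h]

/-- The conditions i ≠ k, j ≠ k, j ≠ l are enforced by the zero diagonal of X, and k ≠ l by the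
extension by zero. Only i ≠ l has to be imposed, by subtracting the terms with l = i. -/
lemma zMatrix_mulVec_eq {n : ℕ} (p : ℝ) (G : SimpleGraph (Fin n)) (f : OrdPair n → ℝ)
    (x : OrdPair n) :
    ∑ y, zMatrix p G x y * f y =
      ∑ k, chiMatrix p G x.1.1 k * (chiMatrix p G x.1.2 k *
        ∑ l, chiMatrix p G x.1.2 l * extendPair f k l) -
      chiMatrix p G x.1.2 x.1.1 * ∑ k, chiMatrix p G x.1.2 k *
        (chiMatrix p G x.1.1 k * extendPair f k x.1.1) := by
  obtain ⟨⟨i, j⟩, hij⟩ := x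
  simp only at hij ⊢
  have h1 : ∑ y : OrdPair n, zMatrix p G ⟨(i, j), hij⟩ y * f y = ∑ y : OrdPair n,
      (if i ≠ y.1.1 ∧ i ≠ y.1.2 ∧ j ≠ y.1.1 ∧ j ≠ y.1.2 then
        chi p G i y.1.1 * chi p G j y.1.1 * chi p G j y.1.2 else 0) *
        extendPair f y.1.1 y.1.2 := by
    refine Finset.sum_congr rfl fun y _ => ?_
    rw [extendPair, dif_pos y.2]; rfl
  rw [h1, sum_ordPair (fun k l => (if i ≠ k ∧ i ≠ l ∧ j ≠ k ∧ j ≠ l then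
        chi p G i k * chi p G j k * chi p G j l else 0) * extendPair f k l)]
  simp only [Finset.mul_sum, ← Finset.sum_sub_distrib]
  refine Finset.sum_congr rfl fun k _ => ?_
  have h2 : chiMatrix p G j i * (chiMatrix p G j k * (chiMatrix p G i k * extendPair f k i)) =
      ∑ l, if l = i then chiMatrix p G j l * (chiMatrix p G j k * (chiMatrix p G i k * extendPair f k l))
        else 0 := by
    rw [Finset.sum_ite_eq']; simp
  rw [h2, ← Finset.sum_sub_distrib]
  refine Finset.sum_congr rfl fun l _ => ?_
  by_cases c1 : l = i
  · subst c1
    simp; ring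
  · by_cases c2 : k = l
    · simp [c2, extendPair]
    · by_cases c3 : i = k
      · simp [c3, chiMatrix]
      · by_cases c4 : j = k
        · simp [c4, chiMatrix]
        · by_cases c5 : j = l
          · simp [c5, chiMatrix]
          · have c1' : ¬ i = l := fun h => c1 h.symm
            simp [c1, c1', c2, c3, c4, c5, chiMatrix]; ring

/-- The main part A acts by X in l for each k, by multiplication with X j k, then by X in k for each
j: L · m · L. In the correction B the index l is tied to i, so two of the three characters only
multiply: m · L · m. -/
lemma specNorm_zMatrix_le {n : ℕ} {p L m : ℝ} {G : SimpleGraph (Fin n)} (hm0 : 0 ≤ m)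
    (hL : ‖Matrix.toEuclideanCLM (𝕜 := ℝ) (chiMatrix p G)‖ ≤ L)
    (hm : ∀ u v, |chiMatrix p G u v| ≤ m) :
    specNorm (zMatrix p G) ≤ L ^ 2 * m + m ^ 2 * L := by
  have hL0 : 0 ≤ L := (norm_nonneg _).trans hL
  set X := chiMatrix p G with hX
  have hmsq : ∀ u v, X u v ^ 2 ≤ m ^ 2 := fun u v => sq_le_sq' (abs_le.1 (hm u v)).1 (abs_le.1 (hm u v)).2
  refine ContinuousLinearMap.opNorm_le_bound _ (by positivity) fun f => ?_
  set g : Fin n → Fin n → ℝ := extendPair f with hg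
  have hgf : ∑ k, ∑ l, g k l ^ 2 = ‖f‖ ^ 2 := by
    rw [hg, sum_extendPair_sq, EuclideanSpace.real_norm_sq_eq]
  set A : EuclideanSpace ℝ (OrdPair n) := WithLp.toLp 2 fun x =>
    ∑ k, X x.1.1 k * (X x.1.2 k * ∑ l, X x.1.2 l * g k l) with hA
  set B : EuclideanSpace ℝ (OrdPair n) := WithLp.toLp 2 fun x =>
    X x.1.2 x.1.1 * ∑ k, X x.1.2 k * (X x.1.1 k * g k x.1.1) with hB
  have hAB : Matrix.toEuclideanCLM (𝕜 := ℝ) (zMatrix p G) f = A - B := by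
    ext x
    have := zMatrix_mulVec_eq p G f x
    rw [← hX, ← hg] at this
    rw [PiLp.sub_apply, hA, hB, ← this]
    rfl
  have hdrop : ∀ F : Fin n → Fin n → ℝ, (∀ i j, 0 ≤ F i j) →
      ∑ x : OrdPair n, F x.1.1 x.1.2 ≤ ∑ i, ∑ j, F i j := by
    intro F hF
    rw [sum_ordPair]
    refine Finset.sum_le_sum fun i _ => Finset.sum_le_sum fun j _ => ?_
    split_ifs
    · exact le_rfl
    · exact hF i j
  have hAn : ‖A‖ ≤ L ^ 2 * m * ‖f‖ := by
    refine abs_le_of_sq_le_sq' ?_ (by positivity) |>.2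
    rw [EuclideanSpace.real_norm_sq_eq]
    calc ∑ x, A x ^ 2 ≤ ∑ i, ∑ j, (∑ k, X i k * (X j k * ∑ l, X j l * g k l)) ^ 2 :=
          hdrop (fun i j => (∑ k, X i k * (X j k * ∑ l, X j l * g k l)) ^ 2) fun i j => sq_nonneg _
      _ = ∑ j, ∑ i, (∑ k, X i k * (X j k * ∑ l, X j l * g k l)) ^ 2 := Finset.sum_comm
      _ ≤ ∑ j, L ^ 2 * ∑ k, (X j k * ∑ l, X j l * g k l) ^ 2 :=
          Finset.sum_le_sum fun j _ => sum_sq_mul_le_of_norm X hL _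
      _ ≤ ∑ j, L ^ 2 * ∑ k, m ^ 2 * (∑ l, X j l * g k l) ^ 2 := by
          refine Finset.sum_le_sum fun j _ => ?_
          gcongr with k
          rw [mul_pow]
          exact mul_le_mul_of_nonneg_right (hmsq j k) (sq_nonneg _)
      _ = L ^ 2 * m ^ 2 * ∑ k, ∑ j, (∑ l, X j l * g k l) ^ 2 := by
          rw [Finset.sum_comm (f := fun k j => (∑ l, X j l * g k l) ^ 2)]
          simp only [Finset.mul_sum, mul_assoc]
      _ ≤ L ^ 2 * m ^ 2 * ∑ k, L ^ 2 * ∑ l, g k l ^ 2 := by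
          gcongr with k
          exact sum_sq_mul_le_of_norm X hL _
      _ = (L ^ 2 * m * ‖f‖) ^ 2 := by
          rw [← Finset.mul_sum, hgf]; ring
  have hBn : ‖B‖ ≤ m ^ 2 * L * ‖f‖ := by
    refine abs_le_of_sq_le_sq' ?_ (by positivity) |>.2
    rw [EuclideanSpace.real_norm_sq_eq]
    calc ∑ x, B x ^ 2 ≤ ∑ i, ∑ j, (X j i * ∑ k, X j k * (X i k * g k i)) ^ 2 :=
          hdrop (fun i j => (X j i * ∑ k, X j k * (X i k * g k i)) ^ 2) fun i j => sq_nonneg _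
      _ ≤ ∑ i, ∑ j, m ^ 2 * (∑ k, X j k * (X i k * g k i)) ^ 2 := by
          gcongr with i _ j
          rw [mul_pow]
          exact mul_le_mul_of_nonneg_right (hmsq j i) (sq_nonneg _)
      _ = m ^ 2 * ∑ i, ∑ j, (∑ k, X j k * (X i k * g k i)) ^ 2 := by
          simp only [Finset.mul_sum]
      _ ≤ m ^ 2 * ∑ i, L ^ 2 * ∑ k, (X i k * g k i) ^ 2 := by
          gcongr with i
          exact sum_sq_mul_le_of_norm X hL _
      _ ≤ m ^ 2 * ∑ i, L ^ 2 * ∑ k, m ^ 2 * g k i ^ 2 := by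
          gcongr with i _ k
          rw [mul_pow]
          exact mul_le_mul_of_nonneg_right (hmsq i k) (sq_nonneg _)
      _ = m ^ 2 * (L ^ 2 * (m ^ 2 * ∑ k, ∑ i, g k i ^ 2)) := by
          rw [Finset.sum_comm (f := fun k i => g k i ^ 2)]
          simp only [Finset.mul_sum]
      _ = (m ^ 2 * L * ‖f‖) ^ 2 := by rw [hgf]; ring
  rw [hAB]
  calc ‖A - B‖ ≤ ‖A‖ + ‖B‖ := norm_sub_le _ _
    _ ≤ L ^ 2 * m * ‖f‖ + m ^ 2 * L * ‖f‖ := add_le_add hAn hBn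
    _ = _ := by ring

/-! ### The trace of a power -/

lemma trace_pow_le {ι : Type*} [Fintype ι] [DecidableEq ι] (M : Matrix ι ι ℝ) (q : ℕ) :
    ((M * M.transpose) ^ q).trace ≤ Fintype.card ι * specNorm M ^ (2 * q) := by
  set N := (M * M.transpose) ^ q with hN
  have hent : ∀ i, N i i ≤ ‖Matrix.toEuclideanCLM (𝕜 := ℝ) N‖ := by
    intro i
    have h1 : inner ℝ (EuclideanSpace.single i (1:ℝ))
        (Matrix.toEuclideanCLM (𝕜 := ℝ) N (EuclideanSpace.single i (1:ℝ))) = N i i := by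
      rw [EuclideanSpace.inner_single_left,
        show EuclideanSpace.single i (1:ℝ) = WithLp.toLp 2 (Pi.single i 1) from rfl,
        Matrix.toEuclideanCLM_toLp]
      simp
    rw [← h1]
    refine (real_inner_le_norm _ _).trans ?_
    refine (mul_le_mul_of_nonneg_left (ContinuousLinearMap.le_opNorm _ _) (norm_nonneg _)).trans ?_
    simp
  have hnorm : ‖Matrix.toEuclideanCLM (𝕜 := ℝ) N‖ ≤ specNorm M ^ (2 * q) := by
    -- Bounding the norm of a power needs the identity to have norm 1, which fails on the zero
    -- space.
    rcases isEmpty_or_nonempty ι with h | h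
    · have : N = 0 := Subsingleton.elim _ _
      rw [this, map_zero, norm_zero]
      exact pow_nonneg (norm_nonneg _) _
    rw [hN, map_pow, map_mul, pow_mul]
    refine (norm_pow_le _ _).trans ?_
    gcongr
    have h2 : M.transpose = star M := by
      rw [Matrix.star_eq_conjTranspose, Matrix.conjTranspose_eq_transpose_of_trivial]
    rw [h2, map_star, sq]
    refine (norm_mul_le _ _).trans ?_
    rw [ContinuousLinearMap.star_eq_adjoint, LinearIsometryEquiv.norm_map]; exact le_rfl
  calc N.trace = ∑ i, N i i := rfl
    _ ≤ ∑ _i : ι, specNorm M ^ (2 * q) := Finset.sum_le_sum fun i _ => (hent i).trans hnorm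
    _ = _ := by rw [Finset.sum_const, Finset.card_univ, nsmul_eq_mul]

lemma card_ordPair (n : ℕ) : (Fintype.card (OrdPair n) : ℝ) = n * (n - 1) := by
  have h := sum_ordPair (n := n) (fun _ _ => 1)
  simp only [Finset.sum_const, Finset.card_univ, nsmul_eq_mul, mul_one] at h
  rw [h]
  have : ∀ k : Fin n, ∑ l, (if k ≠ l then (1:ℝ) else 0) = n - 1 := by
    intro k
    have h1 : ∀ l, (if k ≠ l then (1:ℝ) else 0) = 1 - if k = l then 1 else 0 := by
      intro l; split_ifs <;> simp_all
    simp only [h1, Finset.sum_sub_distrib, Finset.sum_ite_eq]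
    simp
  simp only [this, Finset.sum_const, Finset.card_univ, nsmul_eq_mul, Fintype.card_fin]

/-! ### Labels of steps at first and last appearances -/

namespace ShapeWalk
variable {n q : ℕ} (P : ShapeWalk n q)

lemma role_injective (t : Fin (2 * q)) : Function.Injective (P.role t) := by
  intro a b h
  unfold role at h
  split_ifs at h
  · exact (P.ψ t).injective h
  · exact Fin.rev_injective ((P.ψ t).injective h)

lemma edge_injective (t : Fin (2 * q)) {s s' : Fin 3} (h : P.edge (t, s) = P.edge (t, s')) :
    s = s' := by
  have hi := P.role_injective t
  simp only [edge, Sym2.eq_iff, hi.eq_iff] at h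
  revert h
  fin_cases s <;> fin_cases s' <;> simp [tail, head]

lemma mem_edge_role {e : Fin (2 * q) × Fin 3} {w : Fin n} (h : w ∈ P.edge e) :
    ∃ r, P.role e.1 r = w := by
  rcases Sym2.mem_iff.1 h with h | h
  · exact ⟨_, h.symm⟩
  · exact ⟨_, h.symm⟩

/-- An earlier use of the edge would show the vertex in an earlier block, and within one block the
three edges are distinct. -/
lemma isFirstUse_of_firstAppearance {t : Fin (2 * q)} {s : Fin 3}
    (h : P.FirstAppearance t (head s)) : P.IsFirstUse (t, s) := by
  rintro ⟨t', s'⟩ he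
  have hmem : P.role t (head s) ∈ P.edge (t', s') := by rw [he]; exact Sym2.mem_mk_right _ _
  obtain ⟨r, hr⟩ := P.mem_edge_role hmem
  rcases lt_trichotomy t' t with hlt | rfl | hlt
  · exact absurd hr (h.2 t' hlt r)
  · rw [P.edge_injective t' he]
  · have := Fin.lt_def.1 hlt
    simp only [time]; omega

lemma isLastUse_of_lastAppearance {t : Fin (2 * q)} {s : Fin 3}
    (h : P.LastAppearance t (tail s)) : P.IsLastUse (t, s) := by
  rintro ⟨t', s'⟩ he
  have hmem : P.role t (tail s) ∈ P.edge (t', s') := by rw [he]; exact Sym2.mem_mk_left _ _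
  obtain ⟨r, hr⟩ := P.mem_edge_role hmem
  rcases lt_trichotomy t' t with hlt | rfl | hlt
  · have := Fin.lt_def.1 hlt
    simp only [time]; omega
  · rw [P.edge_injective t' he]
  · exact absurd hr (h.2 t' hlt r)

lemma time_injective : Function.Injective (time (q := q)) := by
  rintro ⟨t, s⟩ ⟨t', s'⟩ h
  simp only [time] at h
  ext <;> simp <;> omega

lemma isSingleton_of_first_last {e : Fin (2 * q) × Fin 3} (h1 : P.IsFirstUse e)
    (h2 : P.IsLastUse e) : P.IsSingleton e :=
  fun e' he => time_injective (le_antisymm (h2 e' he) (h1 e' he))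

lemma label_of_firstAppearance {t : Fin (2 * q)} {s : Fin 3}
    (h : P.FirstAppearance t (head s)) :
    P.label (t, s) = .singleton ∨ P.label (t, s) = .F ∨ P.label (t, s) = .S := by
  unfold label
  rw [if_pos (P.isFirstUse_of_firstAppearance h)]
  split_ifs <;> simp

lemma label_of_lastAppearance {t : Fin (2 * q)} {s : Fin 3}
    (h : P.LastAppearance t (tail s)) :
    P.label (t, s) = .singleton ∨ P.label (t, s) = .R := by
  have h2 := P.isLastUse_of_lastAppearance h
  unfold label
  by_cases hs : P.IsSingleton (t, s)
  · simp [hs]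
  · rw [if_neg hs, if_neg (fun h1 => hs (P.isSingleton_of_first_last h1 h2)), if_pos h2]
    simp

/-- Vertex 3 is reached by the last step alone, so at a first appearance that step cannot be a
surprise visit. Vertex 2 is reached twice, and there the second step can be one. -/
lemma label_two_of_firstAppearance {t : Fin (2 * q)} (h : P.FirstAppearance t 3) :
    P.label (t, 2) = .singleton ∨ P.label (t, 2) = .F := by
  have hi := P.role_injective t
  have hd : ¬ P.DestSeen (t, 2) := by
    rintro (⟨t', ht', r, hr⟩ | h0 | h1 | ⟨s', hs', h2⟩)
    · exact h.2 t' ht' r hr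
    · exact absurd (hi h0) (show (0 : Fin 4) ≠ 3 by decide)
    · exact absurd (hi h1) (show (1 : Fin 4) ≠ 3 by decide)
    · have := hi h2
      revert this hs'
      fin_cases s' <;> simp [head]
  unfold label
  rw [if_pos (P.isFirstUse_of_firstAppearance (s := 2) h), if_neg hd]
  split_ifs <;> simp

end ShapeWalk

/-! ### The bound on a block -/

section
variable {d : ℝ} {n : ℕ}

lemma stepValue_nonneg (x : StepLabel) : 0 ≤ ShapeWalk.stepValue d n x ∨ d < 0 := by
  by_cases hd : 0 ≤ d
  · left; cases x <;> simp only [ShapeWalk.stepValue] <;> positivity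
  · right; linarith

/-- The product equals √d e^(-d): a singleton step can pay for one appearance factor √n. -/
lemma stepValue_singleton_mul_le (hd : 1 < d) (hn : 0 < n) :
    ShapeWalk.stepValue d n .singleton * √n ≤ 1 := by
  have hn' : (0:ℝ) < n := by exact_mod_cast hn
  have hsd : 1 < √d := by rw [Real.lt_sqrt (by norm_num)]; linarith
  have hsn := Real.sqrt_pos.2 hn'
  have hdd : √d * √d = d := Real.mul_self_sqrt (by linarith)
  have hnn : √(n:ℝ) * √n = n := Real.mul_self_sqrt hn'.le
  have h1 : √(n / d) * (d / n) * Real.exp (-d) * √n = √d * Real.exp (-d) := by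
    rw [Real.sqrt_div hn'.le]
    have : √(n:ℝ) / √d * (d / n) * Real.exp (-d) * √n = (√(n:ℝ) * √n) * (d / √d) / n * Real.exp (-d) := by
      ring
    rw [this, hnn, show d / √d = √d by rw [div_eq_iff (by linarith), hdd]]
    field_simp
  simp only [ShapeWalk.stepValue]
  rw [h1, Real.exp_neg, ← div_eq_mul_inv, div_le_one (Real.exp_pos _)]
  have := Real.add_one_le_exp d
  nlinarith

set_option maxHeartbeats 800000 in
-- Here N = √n, D = √d, E and V are the entry and exit vertex factors, p the surprise costs, f and l
-- the events of first and last appearance, and κ dominates every lower-order cost. If the middle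
-- step is H, vertex 1 is not at its last and vertex 2 not at its first appearance. The middle step
-- is then worth N/D and the groups of the two outer steps at most Nc each, which is the extremal
-- value c²N²(N/D). For any other middle label at most two powers of N survive.
lemma block_product_le {c κ N D s₀ s₁ s₂ E₀ E₁ V₂ V₃ p₀ p₁ p₂ : ℝ} {x₀ x₁ x₂ : StepLabel}
    {sv : StepLabel → ℝ} (h₀ : s₀ = sv x₀) (h₁ : s₁ = sv x₁) (h₂ : s₂ = sv x₂)
    (hc : 1 ≤ c) (hD : 1 ≤ D) (hN : 1 ≤ N) (hκ : 1 ≤ κ) (hcκ : c * D ≤ κ)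
    (hlarge : κ ^ 5 * D ≤ N)
    (hsv0 : ∀ x, 0 ≤ sv x) (hH : sv .H = N / D) (hF : sv .F = 1) (hS : sv .S = 1) (hR : sv .R = 1)
    (hsing : sv .singleton * N ≤ 1)
    {f₂ f₃ l₀ l₁ : Prop}
    (hE₀ : l₀ ∧ E₀ = N ∨ ¬ l₀ ∧ E₀ = 1) (hE₁ : l₁ ∧ E₁ = N ∨ ¬ l₁ ∧ E₁ = 1)
    (hV₂ : f₂ ∧ V₂ = N ∨ ¬ f₂ ∧ 0 ≤ V₂ ∧ V₂ ≤ κ) (hV₃ : f₃ ∧ V₃ = N ∨ ¬ f₃ ∧ 0 ≤ V₃ ∧ V₃ ≤ κ)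
    (hp₀ : x₀ = .S ∧ 0 ≤ p₀ ∧ p₀ ≤ κ ∨ x₀ ≠ .S ∧ p₀ = 1)
    (hp₁ : x₁ = .S ∧ 0 ≤ p₁ ∧ p₁ ≤ κ ∨ x₁ ≠ .S ∧ p₁ = 1)
    (hp₂ : x₂ = .S ∧ 0 ≤ p₂ ∧ p₂ ≤ κ ∨ x₂ ≠ .S ∧ p₂ = 1)
    (hV₂c : ¬ f₂ → (x₀ = .R ∨ x₀ = .H) → x₁ = .H → V₂ ≤ c)
    (hV₃H : ¬ f₃ → x₂ = .H → V₃ ≤ c * D)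
    (hf₂ : f₂ → (x₀ = .singleton ∨ x₀ = .F ∨ x₀ = .S) ∧ (x₁ = .singleton ∨ x₁ = .F ∨ x₁ = .S))
    (hf₃ : f₃ → x₂ = .singleton ∨ x₂ = .F)
    (hl₀ : l₀ → x₀ = .singleton ∨ x₀ = .R)
    (hl₁ : l₁ → (x₁ = .singleton ∨ x₁ = .R) ∧ (x₂ = .singleton ∨ x₂ = .R)) :
    (E₀ * E₁ * V₂ * V₃) * (p₀ * p₁ * p₂) * (s₀ * s₁ * s₂) ≤ c ^ 2 * (N ^ 2 * (N / D)) := by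
  have hN0 : 0 < N := by linarith
  have hD0 : 0 < D := by linarith
  have hsing1 : sv .singleton ≤ 1 := by nlinarith [hsv0 .singleton]
  have hle1 : ∀ x, x ≠ .H → sv x ≤ 1 := by
    intro x hx; cases x
    · exact hsing1
    · exact hF.le
    · exact hS.le
    · exact hR.le
    · exact absurd rfl hx
  have hND : N / D ≤ N := div_le_self hN0.le hD
  have hleN : ∀ x, sv x ≤ N := by
    intro x
    by_cases hx : x = .H
    · rw [hx, hH]; exact hND
    · exact (hle1 x hx).trans hN
  have hp0 : ∀ {x : StepLabel} {p : ℝ}, (x = .S ∧ 0 ≤ p ∧ p ≤ κ ∨ x ≠ .S ∧ p = 1) → 0 ≤ p ∧ p ≤ κ := by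
    rintro x p (h | h)
    · exact h.2
    · rw [h.2]; exact ⟨by norm_num, hκ⟩
  have hE0 : ∀ {l : Prop} {E : ℝ}, (l ∧ E = N ∨ ¬ l ∧ E = 1) → 0 ≤ E := by
    rintro l E (h | h) <;> rw [h.2] <;> linarith
  have hV0 : ∀ {f : Prop} {V : ℝ}, (f ∧ V = N ∨ ¬ f ∧ 0 ≤ V ∧ V ≤ κ) → 0 ≤ V := by
    rintro f V (h | h)
    · rw [h.2]; linarith
    · exact h.2.1
  have e₀ := hE0 hE₀
  have e₁ := hE0 hE₁
  have v₂ := hV0 hV₂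
  have v₃ := hV0 hV₃
  have n₀ : 0 ≤ s₀ := h₀ ▸ hsv0 x₀
  have n₁ : 0 ≤ s₁ := h₁ ▸ hsv0 x₁
  have n₂ : 0 ≤ s₂ := h₂ ▸ hsv0 x₂
  obtain ⟨q₀, q₀'⟩ := hp0 hp₀
  obtain ⟨q₁, q₁'⟩ := hp0 hp₁
  obtain ⟨q₂, q₂'⟩ := hp0 hp₂
  have hA₀ : E₀ * s₀ ≤ N := by
    rcases hE₀ with ⟨h, rfl⟩ | ⟨h, rfl⟩
    · rw [h₀]
      rcases hl₀ h with hx | hx <;> rw [hx]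
      · linarith
      · rw [hR]; linarith
    · rw [one_mul, h₀]; exact hleN _
  -- A missing third power of N leaves room for all lower-order costs, as κ^5 ≤ N/D.
  have hsmall : ∀ Z : ℝ, Z ≤ N ^ 2 * κ ^ 5 → Z ≤ c ^ 2 * (N ^ 2 * (N / D)) := by
    intro Z hZ
    refine hZ.trans ?_
    have h1 : κ ^ 5 ≤ N / D := by rw [le_div_iff₀ hD0]; exact hlarge
    calc N ^ 2 * κ ^ 5 ≤ 1 * (N ^ 2 * (N / D)) := by rw [one_mul]; gcongr
      _ ≤ c ^ 2 * (N ^ 2 * (N / D)) := by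
          gcongr
          nlinarith
  have hκ2 : κ ≤ κ ^ 2 := by nlinarith
  by_cases hx₁ : x₁ = .H
  · -- the middle step is high-multiplicity
    have hnf₂ : ¬ f₂ := fun h => by rcases (hf₂ h).2 with h | h | h <;> rw [h] at hx₁ <;> cases hx₁
    have hnl₁ : ¬ l₁ := fun h => by rcases (hl₁ h).1 with h | h <;> rw [h] at hx₁ <;> cases hx₁
    have hE₁' : E₁ = 1 := by
      rcases hE₁ with h | h
      · exact absurd h.1 hnl₁
      · exact h.2
    have hp₁' : p₁ = 1 := by
      rcases hp₁ with h | h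
      · rw [hx₁] at h; cases h.1
      · exact h.2
    have hs₁ : s₁ = N / D := by rw [h₁, hx₁, hH]
    have hV₂' : V₂ ≤ κ := by
      rcases hV₂ with h | h
      · exact absurd h.1 hnf₂
      · exact h.2.2
    -- Step 0 yields a power of N only through an R or H label; vertex 2 is then reached by R or by
    -- two H steps and costs just c.
    have hT₀ : (E₀ * s₀) * V₂ * p₀ ≤ N * c ∨ (E₀ * s₀) * V₂ * p₀ ≤ κ ^ 2 := by
      by_cases hx₀ : x₀ = .R ∨ x₀ = .H
      · left
        have hp₀' : p₀ = 1 := by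
          rcases hp₀ with h | h
          · rcases hx₀ with h' | h' <;> rw [h'] at h <;> cases h.1
          · exact h.2
        rw [hp₀', mul_one]
        exact mul_le_mul hA₀ (hV₂c hnf₂ hx₀ hx₁) v₂ hN0.le
      · right
        have hA : E₀ * s₀ ≤ 1 := by
          rcases hE₀ with ⟨h, rfl⟩ | ⟨h, rfl⟩
          · rcases hl₀ h with hx | hx
            · rw [h₀, hx]; linarith
            · exact absurd (Or.inl hx) hx₀
          · rw [one_mul, h₀]; exact hle1 _ fun h => hx₀ (Or.inr h)
        calc (E₀ * s₀) * V₂ * p₀ ≤ 1 * κ * κ := by gcongr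
          _ = κ ^ 2 := by ring
    have hT₃ : s₂ * V₃ * p₂ ≤ N * c ∨ s₂ * V₃ * p₂ ≤ κ ^ 2 := by
      rcases hV₃ with ⟨h, hV⟩ | ⟨h, hv, hv'⟩
      · left
        have hp₂' : p₂ = 1 := by
          rcases hp₂ with h' | h'
          · rcases hf₃ h with h'' | h'' <;> rw [h''] at h' <;> cases h'.1
          · exact h'.2
        have : s₂ ≤ 1 := by
          rw [h₂]; exact hle1 _ fun h' => by rcases hf₃ h with h'' | h'' <;> rw [h''] at h' <;> cases h'
        rw [hp₂', mul_one, hV, mul_comm]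
        exact mul_le_mul_of_nonneg_left (this.trans hc) hN0.le
      · by_cases hx₂ : x₂ = .H
        · left
          have hp₂' : p₂ = 1 := by
            rcases hp₂ with h' | h'
            · rw [hx₂] at h'; cases h'.1
            · exact h'.2
          have hV := hV₃H h hx₂
          rw [hp₂', mul_one, h₂, hx₂, hH]
          -- The cost c√d of a vertex reached by a single H step is cancelled by the √d in the
          -- denominator of that step's value.
          calc N / D * V₃ ≤ N / D * (c * D) := by gcongr
            _ = N * c := by field_simp
        · right
          have : s₂ ≤ 1 := by rw [h₂]; exact hle1 _ hx₂
          calc s₂ * V₃ * p₂ ≤ 1 * κ * κ := by gcongr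
            _ = κ ^ 2 := by ring
    have hcκ' : c ≤ κ := by nlinarith
    have t₀ : 0 ≤ (E₀ * s₀) * V₂ * p₀ := by positivity
    have t₃ : 0 ≤ s₂ * V₃ * p₂ := by positivity
    have hprod : (E₀ * E₁ * V₂ * V₃) * (p₀ * p₁ * p₂) * (s₀ * s₁ * s₂) =
        ((E₀ * s₀) * V₂ * p₀) * (s₂ * V₃ * p₂) * (N / D) := by
      rw [hE₁', hp₁', hs₁]; ring
    rw [hprod]
    have hND0 : 0 ≤ N / D := by positivity
    rcases hT₀ with a | a <;> rcases hT₃ with b | b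
    · calc _ ≤ (N * c) * (N * c) * (N / D) :=
          mul_le_mul_of_nonneg_right (mul_le_mul a b t₃ (by positivity)) hND0
        _ = _ := by ring
    · refine hsmall _ ?_
      calc _ ≤ (N * κ) * κ ^ 2 * N := mul_le_mul (mul_le_mul
            (a.trans (mul_le_mul_of_nonneg_left hcκ' hN0.le)) b t₃ (by positivity)) hND hND0
            (by positivity)
        _ = N ^ 2 * κ ^ 3 := by ring
        _ ≤ N ^ 2 * κ ^ 5 := mul_le_mul_of_nonneg_left (pow_le_pow_right₀ hκ (by norm_num)) (by positivity)
    · refine hsmall _ ?_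
      calc _ ≤ κ ^ 2 * (N * κ) * N := mul_le_mul (mul_le_mul a
            (b.trans (mul_le_mul_of_nonneg_left hcκ' hN0.le)) t₃ (by positivity)) hND hND0
            (by positivity)
        _ = N ^ 2 * κ ^ 3 := by ring
        _ ≤ N ^ 2 * κ ^ 5 := mul_le_mul_of_nonneg_left (pow_le_pow_right₀ hκ (by norm_num)) (by positivity)
    · refine hsmall _ ?_
      calc _ ≤ κ ^ 2 * κ ^ 2 * N := mul_le_mul (mul_le_mul a b t₃ (by positivity)) hND hND0 (by positivity)
        _ = N * κ ^ 4 := by ring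
        _ ≤ N ^ 2 * κ ^ 5 := mul_le_mul (le_self_pow₀ hN (by norm_num))
            (pow_le_pow_right₀ hκ (by norm_num)) (by positivity) (by positivity)
  · -- otherwise at most two powers of `N` survive
    refine hsmall _ ?_
    have hs₁ : s₁ ≤ 1 := by rw [h₁]; exact hle1 _ hx₁
    have hA₃ : s₂ * V₃ ≤ N * κ := by
      rcases hV₃ with ⟨h, hV⟩ | ⟨h, hv, hv'⟩
      · have : s₂ ≤ 1 := by
          rw [h₂]; exact hle1 _ fun h' => by rcases hf₃ h with h'' | h'' <;> rw [h''] at h' <;> cases h'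
        calc s₂ * V₃ ≤ 1 * N := by rw [hV]; exact mul_le_mul_of_nonneg_right this hN0.le
          _ ≤ N * κ := by rw [one_mul]; exact le_mul_of_one_le_right hN0.le hκ
      · exact mul_le_mul (h₂ ▸ hleN x₂) hv' hv hN0.le
    have hprod : (E₀ * E₁ * V₂ * V₃) * (p₀ * p₁ * p₂) * (s₀ * s₁ * s₂) =
        ((E₀ * s₀) * (E₁ * s₁) * V₂ * (s₂ * V₃)) * (p₀ * p₁ * p₂) := by ring
    rw [hprod]
    have hmain : (E₀ * s₀) * (E₁ * s₁) * V₂ * (s₂ * V₃) ≤ N ^ 2 * κ ^ 2 := by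
      rcases hV₂ with ⟨h, hV⟩ | ⟨h, hv, hv'⟩
      · -- the middle exit vertex appears for the first time
        have hA : E₀ * s₀ ≤ 1 := by
          rcases hE₀ with ⟨h', rfl⟩ | ⟨h', rfl⟩
          · rw [h₀]
            have : x₀ = .singleton := by
              rcases hl₀ h' with hx | hx
              · exact hx
              · rcases (hf₂ h).1 with hy | hy | hy <;> rw [hx] at hy <;> cases hy
            rw [this]; linarith
          · rw [one_mul, h₀]
            exact hle1 _ fun hx => by
              rcases (hf₂ h).1 with hy | hy | hy <;> rw [hx] at hy <;> cases hy
        have hB : E₁ * s₁ ≤ 1 := by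
          rcases hE₁ with ⟨h', rfl⟩ | ⟨h', rfl⟩
          · rw [h₁]
            have : x₁ = .singleton := by
              rcases (hl₁ h').1 with hx | hx
              · exact hx
              · rcases (hf₂ h).2 with hy | hy | hy <;> rw [hx] at hy <;> cases hy
            rw [this]; linarith
          · rw [one_mul]; exact hs₁
        have b₁ : 0 ≤ E₁ * s₁ := mul_nonneg e₁ n₁
        have b₃ : 0 ≤ s₂ * V₃ := mul_nonneg n₂ v₃
        calc _ ≤ 1 * 1 * N * (N * κ) := by
              rw [hV]
              exact mul_le_mul (mul_le_mul_of_nonneg_right (mul_le_mul hA hB b₁ zero_le_one) hN0.le)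
                hA₃ b₃ (by positivity)
          _ = N ^ 2 * κ := by ring
          _ ≤ _ := mul_le_mul_of_nonneg_left hκ2 (by positivity)
      · have b₁ : 0 ≤ E₁ * s₁ := mul_nonneg e₁ n₁
        have b₃ : 0 ≤ s₂ * V₃ := mul_nonneg n₂ v₃
        rcases hE₁ with ⟨h', hE⟩ | ⟨h', hE⟩
        · -- the middle entry vertex appears for the last time
          have hC : s₂ * V₃ ≤ κ := by
            rcases hV₃ with ⟨h'', hV⟩ | ⟨h'', hw, hw'⟩
            · have : x₂ = .singleton := by
                rcases (hl₁ h').2 with hx | hx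
                · exact hx
                · rcases hf₃ h'' with hy | hy <;> rw [hx] at hy <;> cases hy
              rw [h₂, this, hV]; linarith
            · have : s₂ ≤ 1 := by
                rw [h₂]; exact hle1 _ fun hx => by
                  rcases (hl₁ h').2 with hy | hy <;> rw [hx] at hy <;> cases hy
              calc s₂ * V₃ ≤ 1 * κ := by gcongr
                _ = κ := one_mul _
          have hB : E₁ * s₁ ≤ N * 1 := by rw [hE]; exact mul_le_mul_of_nonneg_left hs₁ hN0.le
          calc _ ≤ N * (N * 1) * κ * κ := mul_le_mul (mul_le_mul (mul_le_mul hA₀ hB b₁ hN0.le) hv' hv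
                (by positivity)) hC b₃ (by positivity)
            _ = _ := by ring
        · have hB : E₁ * s₁ ≤ 1 * 1 := by rw [hE]; exact mul_le_mul_of_nonneg_left hs₁ zero_le_one
          calc _ ≤ N * (1 * 1) * κ * (N * κ) := mul_le_mul (mul_le_mul (mul_le_mul hA₀ hB b₁ hN0.le)
                hv' hv (by positivity)) hA₃ b₃ (by positivity)
            _ = _ := by ring
    have hppp : p₀ * p₁ * p₂ ≤ κ * κ * κ :=
      mul_le_mul (mul_le_mul q₀' q₁' q₁ (by linarith)) q₂' q₂ (by positivity)
    calc _ ≤ (N ^ 2 * κ ^ 2) * (κ * κ * κ) := mul_le_mul hmain hppp (by positivity) (by positivity)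
      _ = _ := by ring

/-- The number κ = c√d(8q)^(a+1) dominates each of c, c√d, 8q and (8q)^a, so the block is an
instance of `block_product_le`. -/
lemma vtxcost_mul_edgeval_le {c κ : ℝ} {a q : ℕ} (hc : 1 ≤ c) (hd : 1 < d) (hn : 0 < n)
    (hκ : c * √d * (8 * q : ℝ) ^ (a + 1) ≤ κ) (hlarge : κ ^ 5 * √d ≤ √n)
    (P : ShapeWalk n q) (t : Fin (2 * q)) :
    P.vtxcost c a d t * P.edgeval d t ≤ c ^ 2 * (n * √(n / d)) := by
  have hn' : (1:ℝ) ≤ n := by exact_mod_cast hn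
  have hsd : 1 < √d := by rw [Real.lt_sqrt (by norm_num)]; linarith
  have hsn : 1 ≤ √(n:ℝ) := Real.one_le_sqrt.2 hn'
  have hq : 1 ≤ (8 * q : ℝ) := by
    have : 0 < q := by have := t.2; omega
    have : (1:ℝ) ≤ q := by exact_mod_cast this
    linarith
  have hQ1 : (8 * q : ℝ) ≤ (8 * q : ℝ) ^ (a + 1) := le_self_pow₀ hq (by omega)
  have hQa : (8 * q : ℝ) ^ a ≤ (8 * q : ℝ) ^ (a + 1) := pow_le_pow_right₀ hq (by omega)
  have hQ : 1 ≤ (8 * q : ℝ) ^ (a + 1) := one_le_pow₀ hq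
  have hcd : 1 ≤ c * √d := by nlinarith
  have hcdκ : c * √d ≤ κ := le_trans (by nlinarith) hκ
  have hQκ : (8 * q : ℝ) ^ (a + 1) ≤ κ := le_trans (by nlinarith) hκ
  have hcκ : c ≤ κ := le_trans (by nlinarith) hcdκ
  have hκ1 : 1 ≤ κ := hQ.trans hQκ
  have hfac : ∀ r, ¬ (P.FirstAppearance t r ∨ P.LastAppearance t r) →
      (r = 2 ∨ r = 3) → 0 ≤ P.vertexFactor c d t r ∧ P.vertexFactor c d t r ≤ κ := by
    intro r hr hr'
    unfold ShapeWalk.vertexFactor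
    rw [if_neg hr, if_neg (by rcases hr' with rfl | rfl <;> decide)]
    split_ifs
    · exact ⟨by linarith, hcκ⟩
    · exact ⟨by linarith, hcκ⟩
    · exact ⟨by linarith, hcdκ⟩
    · exact ⟨by linarith, hQ1.trans hQκ⟩
  have hentry : ∀ r, (r = 0 ∨ r = 1) → (P.LastAppearance t r ∧ P.vertexFactor c d t r = √n ∨
      ¬ P.LastAppearance t r ∧ P.vertexFactor c d t r = 1) := by
    intro r hr
    have hF : ¬ P.FirstAppearance t r := fun h => by
      rcases hr with rfl | rfl <;> rcases h.1 with h | h <;> exact absurd h (by decide)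
    unfold ShapeWalk.vertexFactor
    by_cases hl : P.LastAppearance t r
    · left; exact ⟨hl, if_pos (Or.inr hl)⟩
    · right
      refine ⟨hl, ?_⟩
      rw [if_neg (by tauto), if_pos hr]
  have hexit : ∀ r, (r = 2 ∨ r = 3) → (P.FirstAppearance t r ∧ P.vertexFactor c d t r = √n ∨
      ¬ P.FirstAppearance t r ∧ 0 ≤ P.vertexFactor c d t r ∧ P.vertexFactor c d t r ≤ κ) := by
    intro r hr
    have hL : ¬ P.LastAppearance t r := fun h => by
      rcases hr with rfl | rfl <;> rcases h.1 with h | h <;> exact absurd h (by decide)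
    by_cases hf : P.FirstAppearance t r
    · left; exact ⟨hf, by unfold ShapeWalk.vertexFactor; exact if_pos (Or.inl hf)⟩
    · right
      exact ⟨hf, hfac r (by tauto) hr⟩
  have hpur : ∀ s, (P.label (t, s) = .S ∧
      0 ≤ (if P.label (t, s) = .S then (8 * q : ℝ) ^ a else 1) ∧
      (if P.label (t, s) = .S then (8 * q : ℝ) ^ a else 1) ≤ κ) ∨
      (P.label (t, s) ≠ .S ∧ (if P.label (t, s) = .S then (8 * q : ℝ) ^ a else 1) = 1) := by
    intro s
    by_cases h : P.label (t, s) = .S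
    · left; rw [if_pos h]; exact ⟨h, by positivity, hQa.trans hQκ⟩
    · right; rw [if_neg h]; exact ⟨h, rfl⟩
  have hL : ∀ r, (r = 2 ∨ r = 3) → ¬ P.LastAppearance t r := fun r hr h => by
    rcases hr with rfl | rfl <;> rcases h.1 with h | h <;> exact absurd h (by decide)
  have hnd : √((n:ℝ) / d) = √n / √d := Real.sqrt_div (by linarith) _
  have key := block_product_le (c := c) (κ := κ) (N := √n) (D := √d)
    (sv := ShapeWalk.stepValue d n) (x₀ := P.label (t, 0)) (x₁ := P.label (t, 1))
    (x₂ := P.label (t, 2)) rfl rfl rfl hc hsd.le hsn hκ1 hcdκ hlarge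
    (fun x => (stepValue_nonneg x).resolve_right (by linarith))
    (by simp only [ShapeWalk.stepValue, hnd]) rfl rfl rfl (stepValue_singleton_mul_le hd hn)
    (hentry 0 (Or.inl rfl)) (hentry 1 (Or.inr rfl)) (hexit 2 (Or.inl rfl)) (hexit 3 (Or.inr rfl))
    (hpur 0) (hpur 1) (hpur 2)
    (by
      intro hf h0 h1
      unfold ShapeWalk.vertexFactor
      rw [if_neg (by have := hL 2 (Or.inl rfl); tauto), if_neg (by decide)]
      rcases h0 with h0 | h0
      · rw [if_pos ⟨0, rfl, h0⟩]
      · split_ifs with h2 h3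
        · exact le_rfl
        · exact le_rfl
        · exact absurd ⟨0, 1, by decide, rfl, rfl, h0, h1⟩ h3
        · exact absurd ⟨0, 1, by decide, rfl, rfl, h0, h1⟩ h3)
    (by
      intro hf h2
      unfold ShapeWalk.vertexFactor
      rw [if_neg (by have := hL 3 (Or.inr rfl); tauto), if_neg (by decide)]
      split_ifs with h3 h4 h5
      · nlinarith
      · nlinarith
      · exact le_rfl
      · exact absurd ⟨2, rfl, h2⟩ h5)
    (fun h => ⟨P.label_of_firstAppearance (s := 0) h, P.label_of_firstAppearance (s := 1) h⟩)
    (fun h => P.label_two_of_firstAppearance h)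
    (fun h => P.label_of_lastAppearance (s := 0) h)
    (fun h => ⟨P.label_of_lastAppearance (s := 1) h, P.label_of_lastAppearance (s := 2) h⟩)
  have hnn : √(n:ℝ) ^ 2 = n := Real.sq_sqrt (by linarith)
  rw [hnn, ← hnd] at key
  unfold ShapeWalk.vtxcost ShapeWalk.edgeval ShapeWalk.purFactor
  rw [Fin.prod_univ_four, Fin.prod_univ_three, Fin.prod_univ_three]
  convert key

end

/-! ### The norm of the pruned matrix -/

section
variable {d : ℝ} {n : ℕ}

lemma chiMatrix_eq_smul {p : ℝ} (hp : 0 < p) (hp1 : p < 1) (G : SimpleGraph (Fin n)) :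
    chiMatrix p G = (√(p * (1 - p)))⁻¹ • centredAdj p G := by
  have h1 : 0 < 1 - p := by linarith
  have a0 := Real.sqrt_pos.2 hp
  have b0 := Real.sqrt_pos.2 h1
  have a2 : √p * √p = p := Real.mul_self_sqrt hp.le
  have b2 : √(1 - p) * √(1 - p) = 1 - p := Real.mul_self_sqrt h1.le
  have hs : √(p * (1 - p)) = √p * √(1 - p) := Real.sqrt_mul hp.le _
  have e1 : √((1 - p) / p) = (√p * √(1 - p))⁻¹ * (1 - p) := by
    rw [Real.sqrt_div h1.le]; field_simp; rw [sq, b2]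
  have e2 : -√(p / (1 - p)) = (√p * √(1 - p))⁻¹ * (-p) := by
    rw [Real.sqrt_div hp.le]; field_simp; rw [sq, a2]
  ext u v
  simp only [chiMatrix, centredAdj, chi, Matrix.of_apply, Matrix.smul_apply, smul_eq_mul, hs, e1, e2]
  by_cases huv : u = v
  · subst huv; simp
  · by_cases h : G.Adj u v
    · simp [huv, h]
    · simp [huv, h]

lemma specNorm_prunedZ_le {cdeg K : ℝ} (hd : 1 < d) (hn : 2 * d ≤ n) (hK : 0 ≤ K)
    {G : SimpleGraph (Fin n)}
    (h : ‖Matrix.toEuclideanCLM (𝕜 := ℝ) (centredAdj (d / n) (prune (cdeg * d) G))‖ ≤ K * √d) :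
    specNorm (prunedZ cdeg d G) ≤ (4 * K ^ 2 + 2 * K) * (n * √(n / d)) := by
  have hn0 : (0:ℝ) < n := by linarith
  have hd0 : 0 < d := by linarith
  have hsd : 1 < √d := by rw [Real.lt_sqrt (by norm_num)]; linarith
  have hsn := Real.sqrt_pos.2 hn0
  have hnn : √(n:ℝ) ^ 2 = n := Real.sq_sqrt hn0.le
  have hdd : √d ^ 2 = d := Real.sq_sqrt hd0.le
  have hnd : √((n:ℝ) / d) = √n / √d := Real.sqrt_div hn0.le _
  set p := d / (n:ℝ) with hp
  have hp0 : 0 < p := by positivity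
  have hp2 : p ≤ 1 / 2 := by rw [hp, div_le_iff₀ hn0]; linarith
  have hL : ‖Matrix.toEuclideanCLM (𝕜 := ℝ) (chiMatrix p (prune (cdeg * d) G))‖ ≤ 2 * K * √n := by
    rw [chiMatrix_eq_smul hp0 (by linarith), map_smul, norm_smul, Real.norm_eq_abs,
      abs_of_nonneg (by positivity)]
    have h1 : √d / (2 * √n) ≤ √(p * (1 - p)) := by
      refine Real.le_sqrt_of_sq_le ?_
      rw [div_pow, hdd, mul_pow, hnn]
      have : d / (2 ^ 2 * (n:ℝ)) = p * (1 / 4) := by rw [hp]; ring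
      rw [this]
      exact mul_le_mul_of_nonneg_left (by linarith) hp0.le
    have h2 : 0 < √d / (2 * √n) := by positivity
    calc _ ≤ (√d / (2 * √n))⁻¹ * (K * √d) := by gcongr
      _ = _ := by field_simp
  have hm : ∀ u v, |chiMatrix p (prune (cdeg * d) G) u v| ≤ √(n / d) := by
    intro u v
    have hnp : (n:ℝ) / d = 1 / p := by rw [hp]; field_simp
    have h1 : √((1 - p) / p) ≤ √(n / d) := by
      rw [hnp]; gcongr; linarith
    have h2 : √(p / (1 - p)) ≤ √(n / d) := by
      rw [hnp]
      refine Real.sqrt_le_sqrt ?_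
      rw [div_le_div_iff₀ (by linarith) hp0]; nlinarith
    simp only [chiMatrix, chi, Matrix.of_apply]
    split_ifs
    · rw [abs_of_nonneg (Real.sqrt_nonneg _)]; exact h1
    · rw [abs_neg, abs_of_nonneg (Real.sqrt_nonneg _)]; exact h2
    · rw [abs_zero]; exact Real.sqrt_nonneg _
  have hmain := specNorm_zMatrix_le (Real.sqrt_nonneg _) hL hm
  rw [prunedZ, edgeProb_eq hd0.le (by linarith), ← hp]
  refine hmain.trans ?_
  -- The correction term is smaller than the main term by a factor √d.
  have h3 : √((n:ℝ) / d) ^ 2 * √n ≤ n * √(n / d) := by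
    have e : (√(n:ℝ) / √d) ^ 2 * √n = (√(n:ℝ) ^ 2) * (√n / √d) / √d := by
      field_simp
    rw [hnd, e, hnn]
    exact div_le_self (by positivity) hsd.le
  have h4 : (2 * K * √n) ^ 2 * √(n / d) = 4 * K ^ 2 * (n * √(n / d)) := by
    rw [mul_pow, hnn]; ring
  rw [h4]
  nlinarith

open Classical in
-- A Schur test valid for every graph: pruned row sums are at most (`cdeg` + 1)d. The result O(d) is
-- written as K√d with K of order √d so that `specNorm_prunedZ_le` applies to it on the bad event.
lemma norm_centredAdj_le {cdeg : ℝ} (hd : 1 < d) (hn : 0 < n) (hc : 0 ≤ cdeg)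
    (G : SimpleGraph (Fin n)) :
    ‖Matrix.toEuclideanCLM (𝕜 := ℝ) (centredAdj (d / n) (prune (cdeg * d) G))‖ ≤
      4 * (cdeg + 1) * √d * √d := by
  have hn0 : (0:ℝ) < n := by exact_mod_cast hn
  have hdd : √d * √d = d := Real.mul_self_sqrt (by linarith)
  set M := centredAdj (d / n) (prune (cdeg * d) G) with hM
  have hrow : ∀ u, ∑ v, |M u v| ≤ (cdeg + 1) * d := by
    intro u
    calc ∑ v, |M u v| ≤ ∑ v, ((if (prune (cdeg * d) G).Adj u v then 1 else 0) + d / n) := by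
          refine Finset.sum_le_sum fun v _ => ?_
          have : 0 ≤ d / n := by positivity
          simp only [hM, centredAdj, Matrix.of_apply]
          refine (abs_sub _ _).trans ?_
          split_ifs <;> simp [abs_of_nonneg this] <;> linarith
      _ = ∑ v, (if (prune (cdeg * d) G).Adj u v then (1:ℝ) else 0) + d := by
          rw [Finset.sum_add_distrib, Finset.sum_const, Finset.card_univ, Fintype.card_fin,
            nsmul_eq_mul]
          congr 1; field_simp
      _ ≤ cdeg * d + d := by gcongr; exact sum_prune_adj_le (by positivity) G u
      _ = _ := by ring
  have hsymm := centredAdj_symm (d / n) (prune (cdeg * d) G)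
  rw [← hM] at hsymm
  have hform : ∀ k : Fin n → ℤ, ∑ u, (k u : ℝ) ^ 2 ≤ 64 * n →
      |∑ u, ∑ v, M u v * k u * k v| ≤ (64 * ((cdeg + 1) * d)) * n := by
    intro k hk
    have h1 : |∑ u, ∑ v, M u v * k u * k v| ≤
        ∑ u, ∑ v, (|M u v| * (k u : ℝ) ^ 2 / 2 + |M u v| * (k v : ℝ) ^ 2 / 2) := by
      refine (Finset.abs_sum_le_sum_abs _ _).trans (Finset.sum_le_sum fun u _ => ?_)
      refine (Finset.abs_sum_le_sum_abs _ _).trans (Finset.sum_le_sum fun v _ => ?_)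
      rw [mul_assoc, abs_mul]
      have : |(k u * k v : ℝ)| ≤ (k u : ℝ) ^ 2 / 2 + (k v : ℝ) ^ 2 / 2 := by
        rw [abs_le]
        constructor <;> nlinarith [sq_nonneg ((k u : ℝ) - k v), sq_nonneg ((k u : ℝ) + k v)]
      calc _ ≤ |M u v| * ((k u : ℝ) ^ 2 / 2 + (k v : ℝ) ^ 2 / 2) := by gcongr
        _ = _ := by ring
    have h2 : ∑ u, ∑ v, (|M u v| * (k u : ℝ) ^ 2 / 2 + |M u v| * (k v : ℝ) ^ 2 / 2) =
        ∑ u, (∑ v, |M u v|) * (k u : ℝ) ^ 2 := by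
      have h3 : ∑ u, ∑ v, |M u v| * (k v : ℝ) ^ 2 / 2 = ∑ u, ∑ v, |M u v| * (k u : ℝ) ^ 2 / 2 := by
        rw [Finset.sum_comm]
        exact Finset.sum_congr rfl fun u _ => Finset.sum_congr rfl fun v _ => by rw [hsymm v u]
      simp only [Finset.sum_add_distrib]
      rw [h3, ← Finset.sum_add_distrib]
      refine Finset.sum_congr rfl fun u _ => ?_
      rw [← Finset.sum_add_distrib, Finset.sum_mul]
      exact Finset.sum_congr rfl fun v _ => by ring
    rw [h2] at h1
    calc _ ≤ ∑ u, ((cdeg + 1) * d) * (k u : ℝ) ^ 2 := h1.trans <|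
          Finset.sum_le_sum fun u _ => mul_le_mul_of_nonneg_right (hrow u) (sq_nonneg _)
      _ = ((cdeg + 1) * d) * ∑ u, (k u : ℝ) ^ 2 := by rw [Finset.mul_sum]
      _ ≤ ((cdeg + 1) * d) * (64 * n) := by gcongr
      _ = _ := by ring
  refine (norm_toEuclideanCLM_le_of_int_form hn hsymm hform).trans (le_of_eq ?_)
  rw [mul_assoc (4 * (cdeg + 1)), hdd]; ring

/-- The constant of the norm bound. -/
def normConst (cdeg : ℝ) : ℝ :=
  4 * ((256 * cdeg + 210000) / 16) ^ 2 + 2 * ((256 * cdeg + 210000) / 16)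

lemma normConst_pos {cdeg : ℝ} (hc : 0 ≤ cdeg) : 0 < normConst cdeg := by
  unfold normConst; positivity

/-- The event that the spectral norm exceeds the bound although the graph is locally sparse. -/
def badEvent (cdeg d δ : ℝ) (n : ℕ) : Set (SimpleGraph (Fin n)) :=
  {G | LocallySparse ((n:ℝ) ^ δ) G ∧
    ¬ specNorm (prunedZ cdeg d G) ≤ normConst cdeg * (n * √(n / d))}

lemma measure_badEvent_le {cdeg δ : ℝ} (hc : 10 ≤ cdeg) (hd : 1 < d) (hn : 2 * d ≤ n)
    (hδ : 2048 * √d ≤ (n:ℝ) ^ (δ / 2)) :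
    (sparseGraph d n).real (badEvent cdeg d δ n) ≤
      2 * Real.exp (-n) + (64 * n + 1) ^ 2 * Real.exp (-(n:ℝ) ^ (δ / 2)) := by
  have hn0 : (0:ℝ) < n := by linarith
  have hdn : d ≤ n := by linarith
  have hn' : 0 < n := by exact_mod_cast hn0
  have hsub : badEvent cdeg d δ n ⊆ ({G | n / d < ((lowDegree (cdeg * d) G)ᶜ.card : ℝ)} ∪
      {G | ¬ LightBound d G}) ∪ {G | ¬ Discrepancy d ((n:ℝ) ^ (δ / 2)) G} := by
    rintro G ⟨hS, hnorm⟩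
    by_contra hcon
    simp only [Set.mem_union, Set.mem_ofPred_eq, not_or, not_not, not_lt] at hcon
    obtain ⟨⟨hU, hL⟩, hG⟩ := hcon
    apply hnorm
    -- At most 64n/ω² = n^δ entries exceed ω, as local sparsity requires. With slack x = n^(δ/2) the
    -- slack term is 2048 d n^(1-δ/2), at most √d n by the assumption on δ.
    set ω := √(64 * (n:ℝ) ^ (1 - δ)) with hω
    have hpow : 0 < (n:ℝ) ^ (1 - δ) := Real.rpow_pos_of_pos hn0 _
    have hω2 : ω ^ 2 = 64 * (n:ℝ) ^ (1 - δ) := Real.sq_sqrt (by positivity)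
    have hω0 : 0 < ω := Real.sqrt_pos.2 (by positivity)
    have hm : 64 * (n:ℝ) ≤ (n:ℝ) ^ δ * ω ^ 2 := by
      rw [hω2]
      have : (n:ℝ) ^ δ * (64 * (n:ℝ) ^ (1 - δ)) = 64 * ((n:ℝ) ^ δ * (n:ℝ) ^ (1 - δ)) := by ring
      rw [this, ← Real.rpow_add hn0]
      simp
    have hxω : 32 * (n:ℝ) ^ (δ / 2) * (d * ω ^ 2) ≤ √d * n := by
      have hdd : √d * √d = d := Real.mul_self_sqrt (by linarith)
      have e : (n:ℝ) ^ (δ / 2) * (n:ℝ) ^ (1 - δ) * (n:ℝ) ^ (δ / 2) = n := by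
        rw [← Real.rpow_add hn0, ← Real.rpow_add hn0]
        have : δ / 2 + (1 - δ) + δ / 2 = 1 := by ring
        rw [this, Real.rpow_one]
      have hy : 0 ≤ (n:ℝ) ^ (δ / 2) * (n:ℝ) ^ (1 - δ) := by positivity
      calc 32 * (n:ℝ) ^ (δ / 2) * (d * ω ^ 2) =
            √d * ((n:ℝ) ^ (δ / 2) * (n:ℝ) ^ (1 - δ) * (2048 * √d)) := by
              rw [hω2]; nth_rewrite 1 [← hdd]; ring
        _ ≤ √d * ((n:ℝ) ^ (δ / 2) * (n:ℝ) ^ (1 - δ) * (n:ℝ) ^ (δ / 2)) := by gcongr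
        _ = _ := by rw [e]
    have hform := abs_form_centredAdj_le hd.le (Real.rpow_nonneg hn0.le _) hω0 hn' (by linarith)
      hU hL hG hS hm hxω
    have hnm := norm_toEuclideanCLM_le_of_int_form hn' (centredAdj_symm _ _) hform
    exact specNorm_prunedZ_le hd hn (by positivity) (hnm.trans (le_of_eq (by ring)))
  refine (measureReal_mono hsub).trans ((measureReal_union_le _ _).trans ?_)
  have h1 := measureReal_union_le (μ := sparseGraph d n)
    {G | n / d < ((lowDegree (cdeg * d) G)ᶜ.card : ℝ)} {G | ¬ LightBound d G}
  have h2 := measure_card_compl_lowDegree_le (n := n) hc hd hdn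
  have h3 := measure_not_lightBound_le (n := n) hd hdn
  have h4 := measure_not_discrepancy_le hd hdn ((n:ℝ) ^ (δ / 2))
  linarith

/-! ### The trace moment -/

/-- On the 2-cycle event the norm is at most b unless the bad event occurs, and then still at most
ρb. The bad part adds ρ^(2q) times its probability, at most 1, so the auxiliary cost is 1 + 1 = 2.
-/
lemma traceMoment_le {cdeg κ₀ C ρ : ℝ} {q : ℕ} (hd : 1 < d) (hn : 2 * d ≤ n) (hc : 0 ≤ cdeg)
    (hC : normConst cdeg ≤ C)
    (hρ : 4 * (4 * (cdeg + 1) * √d) ^ 2 + 2 * (4 * (cdeg + 1) * √d) ≤ ρ * C) {δ : ℝ}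
    (hsub : TwoCycleEvent κ₀ d n ⊆ {G | LocallySparse ((n:ℝ) ^ δ) G})
    (htail : ρ ^ (2 * q) * (sparseGraph d n).real (badEvent cdeg d δ n) ≤ 1) :
    traceMoment cdeg κ₀ d n q ≤ ((n:ℝ) * (n - 1)) * 2 * (C * (n * √(n / d))) ^ (2 * q) := by
  have hn0 : (0:ℝ) < n := by linarith
  have hn1 : (0:ℝ) ≤ n * (n - 1) := mul_nonneg hn0.le (by linarith)
  have hCpos : 0 < C := (normConst_pos hc).trans_le hC
  set b := C * (n * √(n / d)) with hb
  have hb0 : 0 ≤ b := by positivity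
  have hpt : ∀ G, (TwoCycleEvent κ₀ d n).indicator
      (fun G => ((prunedZ cdeg d G * (prunedZ cdeg d G).transpose) ^ q).trace) G ≤
      (n:ℝ) * (n - 1) * b ^ (2 * q) + (badEvent cdeg d δ n).indicator
        (fun _ => (n:ℝ) * (n - 1) * (ρ * b) ^ (2 * q)) G := by
    intro G
    have hρb : 0 ≤ (ρ * b) ^ (2 * q) := by rw [pow_mul]; positivity
    have hind : 0 ≤ (badEvent cdeg d δ n).indicator
        (fun _ => (n:ℝ) * (n - 1) * (ρ * b) ^ (2 * q)) G :=
      Set.indicator_nonneg (fun _ _ => mul_nonneg hn1 hρb) G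
    by_cases hE : G ∈ TwoCycleEvent κ₀ d n
    · rw [Set.indicator_of_mem hE]
      have htr := trace_pow_le (prunedZ cdeg d G) q
      rw [card_ordPair] at htr
      by_cases hgood : specNorm (prunedZ cdeg d G) ≤ b
      · have h1 : specNorm (prunedZ cdeg d G) ^ (2 * q) ≤ b ^ (2 * q) :=
          pow_le_pow_left₀ (norm_nonneg _) hgood _
        have h2 := mul_le_mul_of_nonneg_left h1 hn1
        linarith
      · have hbad : G ∈ badEvent cdeg d δ n := by
          refine ⟨hsub hE, fun h => hgood (h.trans ?_)⟩
          rw [hb]; gcongr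
        rw [Set.indicator_of_mem hbad]
        have h0 := specNorm_prunedZ_le hd hn (by positivity)
          (norm_centredAdj_le hd (by exact_mod_cast hn0) hc G)
        have h3 : specNorm (prunedZ cdeg d G) ≤ ρ * b := by
          refine h0.trans ((mul_le_mul_of_nonneg_right hρ (by positivity)).trans (le_of_eq ?_))
          rw [hb]; ring
        have h1 : specNorm (prunedZ cdeg d G) ^ (2 * q) ≤ (ρ * b) ^ (2 * q) :=
          pow_le_pow_left₀ (norm_nonneg _) h3 _
        have h2 := mul_le_mul_of_nonneg_left h1 hn1
        have h4 : 0 ≤ (n:ℝ) * (n - 1) * b ^ (2 * q) := by positivity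
        linarith
    · rw [Set.indicator_of_notMem hE]
      have h4 : 0 ≤ (n:ℝ) * (n - 1) * b ^ (2 * q) := by positivity
      linarith
  have hmeas : MeasurableSet (badEvent cdeg d δ n) := (Set.toFinite _).measurableSet
  calc traceMoment cdeg κ₀ d n q ≤ ∫ G, ((n:ℝ) * (n - 1) * b ^ (2 * q) +
        (badEvent cdeg d δ n).indicator (fun _ => (n:ℝ) * (n - 1) * (ρ * b) ^ (2 * q)) G)
          ∂(sparseGraph d n) := integral_mono Integrable.of_finite Integrable.of_finite hpt
    _ = (n:ℝ) * (n - 1) * b ^ (2 * q) +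
        (sparseGraph d n).real (badEvent cdeg d δ n) * ((n:ℝ) * (n - 1) * (ρ * b) ^ (2 * q)) := by
        rw [integral_add Integrable.of_finite Integrable.of_finite, integral_const,
          integral_indicator_const _ hmeas]
        simp
    _ = (n:ℝ) * (n - 1) * b ^ (2 * q) *
        (1 + ρ ^ (2 * q) * (sparseGraph d n).real (badEvent cdeg d δ n)) := by
        rw [mul_pow]; ring
    _ ≤ (n:ℝ) * (n - 1) * b ^ (2 * q) * (1 + 1) := by gcongr
    _ = _ := by ring

end

/-! ### Asymptotics -/

lemma eventually_le_natCast_rpow (K : ℝ) {ε : ℝ} (hε : 0 < ε) :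
    ∀ᶠ n : ℕ in atTop, K ≤ (n:ℝ) ^ ε :=
  ((tendsto_rpow_atTop hε).comp tendsto_natCast_atTop_atTop).eventually_ge_atTop K

lemma eventually_log_le_rpow {η ε : ℝ} (hη : 0 < η) (hε : 0 < ε) :
    ∀ᶠ n : ℕ in atTop, Real.log n ≤ η * (n:ℝ) ^ ε := by
  have h := (isLittleO_log_rpow_atTop hε).bound hη
  have h2 := tendsto_natCast_atTop_atTop.eventually h
  filter_upwards [h2] with n hn
  rw [Real.norm_eq_abs, Real.norm_eq_abs, abs_of_nonneg (Real.rpow_nonneg (Nat.cast_nonneg n) ε)] at hn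
  exact (le_abs_self _).trans hn

lemma eventually_measure_badEvent_le {cdeg d δ : ℝ} (hc : 10 ≤ cdeg) (hd : 1 < d) (hδ : 0 < δ)
    (hδ1 : δ ≤ 1) :
    ∀ᶠ n : ℕ in atTop, (sparseGraph d n).real (badEvent cdeg d δ n) ≤
      Real.exp (-((n:ℝ) ^ (δ / 2) / 2)) := by
  filter_upwards [eventually_le_natCast_rpow (2048 * √d) (half_pos hδ),
    tendsto_natCast_atTop_atTop.eventually_ge_atTop (2 * d),
    tendsto_natCast_atTop_atTop.eventually_ge_atTop (5000:ℝ),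
    eventually_log_le_rpow (η := 1 / 6) (by norm_num) (half_pos hδ)] with n h1 h2 h3 h4
  have hn0 : (0:ℝ) < n := by linarith
  set y := (n:ℝ) ^ (δ / 2) with hy
  have hyn : y ≤ n := by
    calc y ≤ (n:ℝ) ^ (1:ℝ) := Real.rpow_le_rpow_of_exponent_le (by linarith) (by linarith)
      _ = n := Real.rpow_one _
  refine (measure_badEvent_le hc hd h2 h1).trans ?_
  have h5 : Real.exp (-(n:ℝ)) ≤ Real.exp (-y) := Real.exp_le_exp.2 (by linarith)
  have h6 : (n:ℝ) ^ 3 ≤ Real.exp (y / 2) := by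
    calc (n:ℝ) ^ 3 = Real.exp (3 * Real.log n) := by
          rw [← Real.exp_log hn0, ← Real.exp_nat_mul, Real.log_exp]; norm_num
      _ ≤ _ := Real.exp_le_exp.2 (by linarith)
  have h7 : 2 + (64 * (n:ℝ) + 1) ^ 2 ≤ (n:ℝ) ^ 3 := by nlinarith [sq_nonneg (n:ℝ)]
  calc 2 * Real.exp (-(n:ℝ)) + (64 * n + 1) ^ 2 * Real.exp (-y)
      ≤ (2 + (64 * (n:ℝ) + 1) ^ 2) * Real.exp (-y) := by rw [add_mul]; gcongr
    _ ≤ Real.exp (y / 2) * Real.exp (-y) := by gcongr; exact h7.trans h6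
    _ = _ := by rw [← Real.exp_add]; ring_nf

lemma exists_twoCycleEvent_subset {d κ₀ : ℝ} (hd : 1 < d) (hκ : 0 < κ₀) :
    ∃ δ : ℝ, 0 < δ ∧ δ ≤ 1 ∧ ∀ᶠ n : ℕ in atTop,
      TwoCycleEvent κ₀ d n ⊆ {G | LocallySparse ((n:ℝ) ^ δ) G} := by
  have hld : 0 < Real.log d := Real.log_pos hd
  have hl2 : 0 < Real.log 2 := Real.log_pos (by norm_num)
  set β := κ₀ / Real.log d with hβ
  have hβ0 : 0 < β := by positivity
  -- With r about (β log n)/2, half the guaranteed radius, 2^r exceeds n^(β log 2/4); the spare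
  -- factor 2 in the exponent absorbs the rounding of r.
  refine ⟨min (β * Real.log 2 / 4) 1, lt_min (by positivity) one_pos, min_le_right _ _, ?_⟩
  have hlog : Tendsto (fun n : ℕ => Real.log n) atTop atTop :=
    Real.tendsto_log_atTop.comp tendsto_natCast_atTop_atTop
  filter_upwards [hlog.eventually_gt_atTop (4 / β), eventually_gt_atTop 1] with n hn hn1
  intro G hG
  have hn0 : (0:ℝ) < n := by exact_mod_cast (by omega : 0 < n)
  have hln : 0 < Real.log n := lt_trans (by positivity) hn
  have hval : κ₀ * Real.logb d n = β * Real.log n := by rw [Real.logb, hβ]; ring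
  have hbl : 4 < β * Real.log n := by rwa [div_lt_iff₀' hβ0] at hn
  set r := ⌊β * Real.log n / 2⌋₊ with hr
  have hr1 : (r:ℝ) ≤ β * Real.log n / 2 := Nat.floor_le (by positivity)
  have hr2 : β * Real.log n / 2 < r + 1 := Nat.lt_floor_add_one _
  refine locallySparse_of_mem_twoCycleEvent (r := r) ?_ ?_ hG
  · rw [hval]; linarith
  · have h1 : (n:ℝ) ^ min (β * Real.log 2 / 4) 1 ≤ (n:ℝ) ^ (β * Real.log 2 / 4) :=
      Real.rpow_le_rpow_of_exponent_le (by exact_mod_cast hn1.le) (min_le_left _ _)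
    refine h1.trans_lt ?_
    rw [Real.rpow_def_of_pos hn0, ← Real.exp_log (show (0:ℝ) < 2 ^ r by positivity), Real.exp_lt_exp,
      Real.log_pow]
    nlinarith

/-- The dimension is polynomial, so the root is at most exp(3 log n/(2q)), which tends to 1 because
q is at least of order log² n. -/
lemma eventually_dimension_root_le {q : ℕ → ℕ}
    (hq : (fun n : ℕ => Real.log n ^ 2) =O[atTop] (fun n : ℕ => (q n : ℝ))) {ε : ℝ} (hε : 0 < ε) :
    ∀ᶠ n : ℕ in atTop, ((n : ℝ) * (n - 1) * 2) ^ ((1 : ℝ) / (2 * q n)) ≤ 1 + ε := by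
  obtain ⟨K, hK, hbound⟩ := hq.exists_pos
  have hlog : Tendsto (fun n : ℕ => Real.log n) atTop atTop :=
    Real.tendsto_log_atTop.comp tendsto_natCast_atTop_atTop
  have hle : 0 < Real.log (1 + ε) := Real.log_pos (by linarith)
  filter_upwards [hbound.bound, hlog.eventually_gt_atTop (2 * K / Real.log (1 + ε)),
    eventually_gt_atTop 1] with n h1 h2 hn1
  have hn1' : (2:ℝ) ≤ n := by exact_mod_cast hn1
  have hn0 : (0:ℝ) < n := by linarith
  have hln : 0 < Real.log n := lt_trans (by positivity) h2
  rw [Real.norm_eq_abs, Real.norm_eq_abs, abs_of_nonneg (by positivity),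
    abs_of_nonneg (Nat.cast_nonneg _)] at h1
  have hq0 : (0:ℝ) < q n := by
    have : 0 < K * (q n : ℝ) := lt_of_lt_of_le (by positivity) h1
    exact pos_of_mul_pos_right this hK.le
  have hbase : (n : ℝ) * (n - 1) * 2 ≤ (n:ℝ) ^ (3:ℝ) := by
    rw [show (3:ℝ) = ((3:ℕ):ℝ) by norm_num, Real.rpow_natCast]; nlinarith [sq_nonneg (n:ℝ)]
  have hb0 : 0 ≤ (n : ℝ) * (n - 1) * 2 := by
    have : (0:ℝ) ≤ n - 1 := by linarith
    positivity
  refine (Real.rpow_le_rpow hb0 hbase (by positivity)).trans ?_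
  rw [← Real.rpow_mul hn0.le, Real.rpow_def_of_pos hn0]
  rw [← Real.le_log_iff_exp_le (by linarith)]
  rw [div_lt_iff₀ hle] at h2
  have h3 : Real.log n * (3 * (1 / (2 * q n))) = 3 * Real.log n / (2 * q n) := by ring
  rw [h3, div_le_iff₀ (by positivity)]
  have h4 : Real.log n * (2 * K) ≤ Real.log n * (Real.log n * Real.log (1 + ε)) := by gcongr
  have h5 : Real.log n ^ 2 * Real.log (1 + ε) ≤ K * q n * Real.log (1 + ε) := by gcongr
  have h6 : K * (2 * Real.log n) ≤ K * (q n * Real.log (1 + ε)) := by nlinarith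
  have h7 := le_of_mul_le_mul_left h6 hK
  linarith

/-- Of √n = n^(1/4) · n^(1/4), one factor pays for the power 5(a+1) of q and the other for the
constants depending on d. -/
lemma eventually_label_le {c d : ℝ} {a : ℕ} (hc : 1 ≤ c) (hd : 1 < d) {q : ℕ → ℕ} {δ : ℝ}
    (hδ : δ * (5 * (a + 1)) ≤ 1 / 4) (hq : ∀ᶠ n : ℕ in atTop, (q n : ℝ) ≤ (n:ℝ) ^ δ) :
    ∀ᶠ n : ℕ in atTop, (c * √d * (8 * q n : ℝ) ^ (a + 1)) ^ 5 * √d ≤ √n := by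
  filter_upwards [hq, eventually_le_natCast_rpow ((c * √d) ^ 5 * √d * 8 ^ (5 * (a + 1)))
    (ε := 1 / 4) (by norm_num), eventually_gt_atTop 0] with n h1 h2 hn
  have hn1 : (1:ℝ) ≤ n := by exact_mod_cast hn
  have hn0 : (0:ℝ) < n := by linarith
  have h3 : (q n : ℝ) ^ (5 * (a + 1)) ≤ (n:ℝ) ^ (1 / 4 : ℝ) := by
    calc (q n : ℝ) ^ (5 * (a + 1)) ≤ ((n:ℝ) ^ δ) ^ (5 * (a + 1)) := by gcongr
      _ = (n:ℝ) ^ (δ * (5 * (a + 1))) := by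
          rw [← Real.rpow_natCast, ← Real.rpow_mul hn0.le]; push_cast; rfl
      _ ≤ _ := Real.rpow_le_rpow_of_exponent_le hn1 hδ
  have h4 : √(n:ℝ) = (n:ℝ) ^ (1 / 4 : ℝ) * (n:ℝ) ^ (1 / 4 : ℝ) := by
    rw [Real.sqrt_eq_rpow, ← Real.rpow_add hn0]; norm_num
  calc _ = ((c * √d) ^ 5 * √d * 8 ^ (5 * (a + 1))) * (q n : ℝ) ^ (5 * (a + 1)) := by
        rw [mul_pow (c * √d), ← pow_mul, mul_comm (a + 1) 5, mul_pow (8:ℝ)]; ring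
    _ ≤ (n:ℝ) ^ (1 / 4 : ℝ) * (n:ℝ) ^ (1 / 4 : ℝ) := by
        have : 0 ≤ (c * √d) ^ 5 * √d * 8 ^ (5 * (a + 1)) := by positivity
        gcongr
    _ = _ := h4.symm

lemma isValidBlockValue_z {cdeg c : ℝ} (hcdeg : 10 ≤ cdeg) (hc : 1 ≤ c) (a : ℕ) {d κ₀ : ℝ}
    (hd : 1 < d) (hκ : 0 < κ₀) :
    ∃ δ : ℝ, 0 < δ ∧ ∀ q : ℕ → ℕ,
      (fun n : ℕ => Real.log n ^ 2) =O[atTop] (fun n : ℕ => (q n : ℝ)) →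
      (∀ᶠ n : ℕ in atTop, (q n : ℝ) ≤ (n : ℝ) ^ δ) →
      IsValidBlockValue cdeg κ₀ d c a q (fun n => (normConst cdeg + c ^ 2) * (n * √(n / d))) := by
  obtain ⟨δ', hδ', hδ1, hsub⟩ := exists_twoCycleEvent_subset hd hκ
  -- The first bound makes ρ^(2q) smaller than the inverse tail exp(n^(δ'/2)/2); the second keeps
  -- the label costs of a block below √n.
  set δ := min (δ' / 4) (1 / (20 * (a + 1))) with hδ
  have hδ0 : 0 < δ := lt_min (by positivity) (by positivity)
  refine ⟨δ, hδ0, fun q hq hqle => ?_⟩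
  have hN := normConst_pos (cdeg := cdeg) (by linarith)
  set C := normConst cdeg + c ^ 2 with hC
  have hC0 : 0 < C := by positivity
  set Y := 4 * (4 * (cdeg + 1) * √d) ^ 2 + 2 * (4 * (cdeg + 1) * √d) with hY
  have hY0 : 0 ≤ Y := by positivity
  -- The ratio ρ depends on d, but it enters only through ρ^(2q) against the tail probability, so C
  -- stays independent of d.
  set ρ := 1 + Y / C with hρ
  have hρ1 : 1 ≤ ρ := by
    have : 0 ≤ Y / C := by positivity
    rw [hρ]; linarith
  have hρC : Y ≤ ρ * C := by rw [hρ, add_mul, div_mul_cancel₀ _ hC0.ne']; linarith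
  refine ⟨⟨fun _ => 2, fun _ => by norm_num, ?_, fun ε hε => eventually_dimension_root_le hq hε⟩, ?_⟩
  · filter_upwards [hsub, hqle, eventually_measure_badEvent_le hcdeg hd hδ' hδ1,
      tendsto_natCast_atTop_atTop.eventually_ge_atTop (2 * d),
      eventually_le_natCast_rpow (4 * Real.log ρ) (show 0 < δ' / 4 by positivity),
      eventually_gt_atTop 0] with n h1 h2 h3 h4 h5 hn
    have hn1 : (1:ℝ) ≤ n := by exact_mod_cast hn
    have hn0 : (0:ℝ) < n := by linarith
    refine traceMoment_le hd h4 (by linarith) (by rw [hC]; nlinarith) hρC h1 ?_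
    have hq' : (q n : ℝ) ≤ (n:ℝ) ^ (δ' / 4) :=
      h2.trans (Real.rpow_le_rpow_of_exponent_le hn1 (min_le_left _ _))
    have hlρ : 0 ≤ Real.log ρ := Real.log_nonneg hρ1
    have hsq : (n:ℝ) ^ (δ' / 2) = (n:ℝ) ^ (δ' / 4) * (n:ℝ) ^ (δ' / 4) := by
      rw [← Real.rpow_add hn0]; ring_nf
    have h6 : ρ ^ (2 * q n) ≤ Real.exp ((n:ℝ) ^ (δ' / 2) / 2) := by
      rw [← Real.exp_log (show 0 < ρ by linarith), ← Real.exp_nat_mul, Real.exp_le_exp, hsq]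
      push_cast
      nlinarith [mul_le_mul hq' h5 (by positivity) (by positivity)]
    calc _ ≤ Real.exp ((n:ℝ) ^ (δ' / 2) / 2) * Real.exp (-((n:ℝ) ^ (δ' / 2) / 2)) := by gcongr
      _ = 1 := by rw [← Real.exp_add]; simp
  · have hδa : δ * (5 * (a + 1)) ≤ 1 / 4 := by
      have : δ ≤ 1 / (20 * (a + 1)) := min_le_right _ _
      calc δ * (5 * (a + 1)) ≤ 1 / (20 * (a + 1)) * (5 * ((a:ℝ) + 1)) := by gcongr
        _ = 1 / 4 := by field_simp; norm_num
    filter_upwards [eventually_label_le hc hd hδa hqle, eventually_gt_atTop 0] with n h1 hn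
    intro P t
    refine (vtxcost_mul_edgeval_le hc hd hn le_rfl h1 P t).trans ?_
    gcongr
    rw [hC]; linarith

lemma tendsto_specNorm_le {cdeg d : ℝ} (hcdeg : 10 ≤ cdeg) (hd : 1 < d) :
    Tendsto (fun n : ℕ => (sparseGraph d n).real
      {G | specNorm (prunedZ cdeg d G) ≤ normConst cdeg * (n * √(n / d))}) atTop (𝓝 1) := by
  have hpow : ∀ ε : ℝ, 0 < ε → Tendsto (fun n : ℕ => (n:ℝ) ^ (-ε)) atTop (𝓝 0) := fun ε hε =>
    (tendsto_rpow_neg_atTop hε).comp tendsto_natCast_atTop_atTop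
  have hlow : Tendsto (fun n : ℕ => 1 - (Real.exp (-((n:ℝ) ^ ((1 / 8 : ℝ) / 2) / 2)) +
      (Real.exp (Real.exp (1 / 2) * (n:ℝ) ^ (-(1 / 8) : ℝ)) - 1))) atTop (𝓝 (1 - (0 + (1 - 1)))) := by
    refine tendsto_const_nhds.sub (Tendsto.add ?_ (Tendsto.sub_const ?_ 1))
    · refine Real.tendsto_exp_neg_atTop_nhds_zero.comp ?_
      exact ((tendsto_rpow_atTop (by norm_num)).comp tendsto_natCast_atTop_atTop).atTop_div_const
        (by norm_num)
    · have h1 : Tendsto (fun n : ℕ => Real.exp (1 / 2) * (n:ℝ) ^ (-(1 / 8) : ℝ)) atTop (𝓝 0) := by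
        simpa using (hpow (1 / 8) (by norm_num)).const_mul (Real.exp (1 / 2))
      have h2 := (Real.continuous_exp.tendsto 0).comp h1
      rw [Real.exp_zero] at h2
      exact h2
  rw [show (1:ℝ) - (0 + (1 - 1)) = 1 by norm_num] at hlow
  refine tendsto_of_tendsto_of_tendsto_of_le_of_le' hlow tendsto_const_nhds ?_
    (Eventually.of_forall fun n => measureReal_le_one)
  have hsmall : ∀ᶠ n : ℕ in atTop, d * (n:ℝ) ^ (-(1 / 8) : ℝ) ≤ 1 := by
    have h := (hpow (1 / 8) (by norm_num)).const_mul d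
    rw [mul_zero] at h
    exact h.eventually_le_const one_pos
  filter_upwards [eventually_measure_badEvent_le hcdeg hd (δ := 1 / 8) (by norm_num) (by norm_num),
    hsmall, tendsto_natCast_atTop_atTop.eventually_ge_atTop d] with n h1 h2 h3
  have h4 := measure_not_locallySparse_le hd h3 h2
  set S : Set (SimpleGraph (Fin n)) :=
    {G | specNorm (prunedZ cdeg d G) ≤ normConst cdeg * (n * √(n / d))} with hS
  have hcompl : (sparseGraph d n).real Sᶜ = 1 - (sparseGraph d n).real S :=
    probReal_compl_eq_one_sub (Set.toFinite _).measurableSet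
  -- Without the 2-cycle event, local sparsity at scale n^(1/8) comes from the first moment bound.
  have hsub : Sᶜ ⊆ badEvent cdeg d (1 / 8) n ∪ {G | ¬ LocallySparse ((n:ℝ) ^ (1 / 8 : ℝ)) G} := by
    intro G hG
    by_cases h : LocallySparse ((n:ℝ) ^ (1 / 8 : ℝ)) G
    · exact Or.inl ⟨h, hG⟩
    · exact Or.inr h
  have h5 := (measureReal_mono (μ := sparseGraph d n) hsub).trans (measureReal_union_le _ _)
  linarith

end

end SparseZ

theorem mainTheorem5 (cdeg : ℝ) (hcdeg : 10 ≤ cdeg) :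
    (∀ c : ℝ, 1 ≤ c → ∀ a : ℕ, ∃ C : ℝ, 0 < C ∧ ∀ d : ℝ, 1 < d →
      ∀ κ₀ : ℝ, 0 < κ₀ → ∃ δ : ℝ, 0 < δ ∧ ∀ q : ℕ → ℕ,
        (fun n : ℕ => Real.log n ^ 2) =O[Filter.atTop] (fun n : ℕ => (q n : ℝ)) →
        (∀ᶠ n : ℕ in Filter.atTop, (q n : ℝ) ≤ (n : ℝ) ^ δ) →
        SparseZ.IsValidBlockValue cdeg κ₀ d c a q (fun n : ℕ => C * (n * √(n / d)))) ∧
    (∃ C : ℝ, 0 < C ∧ ∀ d : ℝ, 1 < d →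
      Filter.Tendsto
        (fun n : ℕ => (SparseZ.sparseGraph d n).real
          {G | SparseZ.specNorm (SparseZ.prunedZ cdeg d G) ≤ C * (n * √(n / d))})
        Filter.atTop (nhds 1)) := by
  have hN := SparseZ.normConst_pos (cdeg := cdeg) (by linarith)
  refine ⟨fun c hc a => ⟨SparseZ.normConst cdeg + c ^ 2, by positivity, fun d hd κ₀ hκ => ?_⟩,
    ⟨SparseZ.normConst cdeg, hN, fun d hd => SparseZ.tendsto_specNorm_le hcdeg hd⟩⟩
  exact SparseZ.isValidBlockValue_z hcdeg hc a hd hκ
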